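/- Let $\varepsilon,\sigma,\alpha,\gamma,\chi>0$, let $g(x)=\frac{1}{2\pi\sigma^2}e^{-|x|^2/(2\sigma^2)}$ on $\mathbb R^2$, and let $y\in\mathbb R^2$ be a home location. Let $\mathbf C_y:\mathbb R^2\to\mathbb R^2$ be bounded, uniformly continuous and of class $C^1$, with partial derivatives $\partial_{x_1}\mathbf C_y,\partial_{x_2}\mathbf C_y$ that are bounded and uniformly continuous, and let $\Pi_y$ be its flow: $\partial_t\Pi_y(t)z=\mathbf C_y(\Pi_y(t)z)$ for $t\in\mathbb R$, $\Pi_y(0)z=z$. Let $A$ be the infinitesimal generator of the heat semigroup on $L^1(\mathbb R^2)$, $$T_A(t)v(x)=\int_{\mathbb R^2}\frac{1}{4\pi\varepsilon^2t}e^{-\frac{|x-z|^2}{4\varepsilon^2t}}v(z)\,dz\quad(t>0),\qquad T_A(0)v=v$$ (so $A$ is the $L^1$-realization of $\varepsilon^2\Delta$), and let $B_y$ be the infinitesimal generator of the convection semigroup on $L^1(\mathbb R^2)$, $$T_{B_y}(t)v(x)=\exp\Big(-\int_0^t(\nabla\cdot\mathbf C_y)(\Pi_y(-s)x)\,ds\Big)\,v(\Pi_y(-t)x)$$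 (so $B_yv=-\nabla\cdot(v\,\mathbf C_y)$ for regular $v$). The sum $A+B_y$ has the domain $D(A)\cap D(B_y)$ (which equals $D(A)$). For $(u_0,v_0,w_0)\in\mathbb R\times L^1(\mathbb R^2)\times L^1(\mathbb R^2)$ (in particular for non-negative data), a mild solution of the return-to-home system $$\begin{cases}u_y'(t)=\chi\int_{\mathbb R^2}w_y(t,x)\,dx-\gamma u_y(t),\\ v_y'(t)=(A+B_y)v_y(t)-\alpha v_y(t)+\gamma\,g(\cdot-y)\,u_y(t),\\ w_y'(t)=\alpha v_y(t)-\chi w_y(t)\end{cases}$$ with initial value $(u_0,v_0,w_0)$ is a continuous map $(u_y,v_y,w_y):[0,\infty)\to\mathbb R\times L^1(\mathbb R^2)\times L^1(\mathbb R^2)$ such that, for all $t\ge0$, $\int_0^tv_y(s)\,ds\in D(A+B_y)$ and $$\begin{aligned}u_y(t)&=u_0+\chi\int_{\mathbb R^2}\Big(\int_0^tw_y(s)\,ds\Big)dx-\gamma\int_0^tu_y(s)\,ds,\\ v_y(t)&=v_0+(A+B_y)\int_0^tv_y(s)\,ds-\alpha\int_0^tv_y(s)\,ds+\gamma\Big(\int_0^tu_y(s)\,ds\Big)g(\cdot-y),\\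 w_y(t)&=w_0+\alpha\int_0^tv_y(s)\,ds-\chi\int_0^tw_y(s)\,ds.\end{aligned}$$ Theorem 4.8. The operator $\alpha I-A-B_y$ has a bounded inverse defined on all of $L^1(\mathbb R^2)$, and there is $\delta>0$ such that the following holds for every $(u_0,v_0,w_0)\in\mathbb R\times L^1(\mathbb R^2)\times L^1(\mathbb R^2)$. Put $$n(y)=u_0+\int_{\mathbb R^2}v_0\,dx+\int_{\mathbb R^2}w_0\,dx,\qquad \tau=\frac{1}{\frac1\gamma+\frac1\alpha+\frac1\chi},$$ $$\bar u(y)=\frac{n(y)}{1+\frac\gamma\alpha+\frac\gamma\chi},\qquad \bar v_y=(\alpha I-A-B_y)^{-1}\big(\tau\,n(y)\,g(\cdot-y)\big),\qquad \bar w_y=\frac{\alpha}{\chi}\,\bar v_y.$$ Then $(\bar u(y),\bar v_y,\bar w_y)$ is an equilibrium of the system, that is, $\chi\int\bar w_y\,dx=\gamma\bar u(y)$, $\bar v_y\in D(A+B_y)$ with $(A+B_y)\bar v_y-\alpha\bar v_y+\gamma\bar u(y)g(\cdot-y)=0$, and $\alpha\bar v_y=\chi\bar w_y$. The system has exactly one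 mild solution $(u_y,v_y,w_y)$ on $[0,\infty)$ with initial value $(u_0,v_0,w_0)$, it satisfies $u_y(t)+\int v_y(t,x)\,dx+\int w_y(t,x)\,dx=n(y)$ for all $t\ge0$, and it converges exponentially to the equilibrium: there is $M>0$ such that for all $t\ge0$ $$|u_y(t)-\bar u(y)|\le Me^{-\delta t},\qquad \|v_y(t)-\bar v_y\|_{L^1(\mathbb R^2)}\le Me^{-\delta t},\qquad \|w_y(t)-\bar w_y\|_{L^1(\mathbb R^2)}\le Me^{-\delta t}.$$ -/

import Mathlib

open MeasureTheory Filter Topology Set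

namespace ReturnHome

noncomputable section

/-- The plane `ℝ²` with its Euclidean norm. -/
abbrev Plane : Type := EuclideanSpace ℝ (Fin 2)

/-- The Banach space `L¹(ℝ²)` of (classes of) real integrable functions on the plane. -/
abbrev L1 : Type := Lp ℝ 1 (volume : Measure Plane)

/-- The class in `L¹(ℝ²)` of an integrable function (and `0` for a non-integrable one). -/
def toL1 (f : Plane → ℝ) : L1 :=
  open Classical in if h : Integrable f volume then h.toL1 f else 0

/-- The total mass `∫ f(x) dx` of an element of `L¹(ℝ²)`. -/
def mass (f : L1) : ℝ := ∫ x, f x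

/-! ### The speed field and its flow -/

/-- The partial derivative `∂C/∂x_i` of a vector field on the plane. -/
def partialDeriv (C : Plane → Plane) (i : Fin 2) (x : Plane) : Plane :=
  fderiv ℝ C x (EuclideanSpace.single i 1)

/-- The divergence `∂C₁/∂x₁ + ∂C₂/∂x₂`. -/
def divergence (C : Plane → Plane) (x : Plane) : ℝ :=
  ∑ i : Fin 2, partialDeriv C i x i

/-- The regularity of a speed field: `C` is bounded, uniformly continuous and of class `C¹`, and its
partial derivatives are bounded and uniformly continuous. -/
structure IsAdmissibleSpeed (C : Plane → Plane) : Prop where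
  bounded : ∃ M : ℝ, ∀ x, ‖C x‖ ≤ M
  uniformContinuous : UniformContinuous C
  contDiff : ContDiff ℝ 1 C
  partialDeriv_bounded : ∀ i, ∃ M : ℝ, ∀ x, ‖partialDeriv C i x‖ ≤ M
  partialDeriv_uniformContinuous : ∀ i, UniformContinuous (partialDeriv C i)

/-- `γ` is the trajectory of `C` that starts at `z`: `γ' = C(γ)` on the whole line, `γ(0) = z`. -/
def IsTrajectory (C : Plane → Plane) (z : Plane) (γ : ℝ → Plane) : Prop :=
  γ 0 = z ∧ ∀ t : ℝ, HasDerivAt γ (C (γ t)) t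

/-- The flow `Π(t)z` of the speed field `C`. The trajectories exist and are unique when `C` is
admissible, see `flow_isTrajectory` and `IsTrajectory.eq_flow`. -/
def flow (C : Plane → Plane) (t : ℝ) (z : Plane) : Plane :=
  Classical.epsilon (IsTrajectory C z) t

/-- An admissible speed field is Lipschitz continuous. -/
theorem IsAdmissibleSpeed.exists_lipschitzWith {C : Plane → Plane} (hC : IsAdmissibleSpeed C) :
    ∃ K : NNReal, LipschitzWith K C := by
  obtain ⟨M0, h0⟩ := hC.partialDeriv_bounded 0
  obtain ⟨M1, h1⟩ := hC.partialDeriv_bounded 1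
  have hM0 : 0 ≤ M0 := (norm_nonneg _).trans (h0 0)
  have hM1 : 0 ≤ M1 := (norm_nonneg _).trans (h1 0)
  refine ⟨(M0 + M1).toNNReal, ?_⟩
  refine lipschitzWith_of_nnnorm_fderiv_le (𝕜 := ℝ) (hC.contDiff.differentiable (by norm_num)) ?_
  intro x
  rw [← NNReal.coe_le_coe, coe_nnnorm, Real.coe_toNNReal _ (by positivity)]
  refine ContinuousLinearMap.opNorm_le_bound _ (by positivity) fun v => ?_
  have hv : v = v 0 • EuclideanSpace.single (0 : Fin 2) (1 : ℝ)
      + v 1 • EuclideanSpace.single (1 : Fin 2) (1 : ℝ) := by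
    ext i
    fin_cases i <;> simp
  have e0 : ‖v 0‖ ≤ ‖v‖ := PiLp.norm_apply_le v 0
  have e1 : ‖v 1‖ ≤ ‖v‖ := PiLp.norm_apply_le v 1
  have key : fderiv ℝ C x v = v 0 • partialDeriv C 0 x + v 1 • partialDeriv C 1 x := by
    conv_lhs => rw [hv]
    simp [partialDeriv]
  rw [key]
  calc _ ≤ ‖v 0 • partialDeriv C 0 x‖ + ‖v 1 • partialDeriv C 1 x‖ := norm_add_le _ _
    _ ≤ ‖v‖ * M0 + ‖v‖ * M1 := by
        rw [norm_smul, norm_smul]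
        gcongr
        · exact h0 x
        · exact h1 x
    _ = _ := by ring

/-- Uniqueness of the trajectories on a symmetric time interval. -/
theorem eqOn_of_hasDerivAt {C : Plane → Plane} {K : NNReal} (hK : LipschitzWith K C)
    {γ η : ℝ → Plane} {a : ℝ} (h0 : γ 0 = η 0)
    (hγ : ∀ t ∈ Ioo (-a) a, HasDerivAt γ (C (γ t)) t)
    (hη : ∀ t ∈ Ioo (-a) a, HasDerivAt η (C (η t)) t) : EqOn γ η (Ioo (-a) a) := by
  rcases le_or_gt a 0 with ha | ha
  · intro t ht
    exact absurd (ht.1.trans ht.2) (by linarith)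
  · exact ODE_solution_unique_of_mem_Ioo (v := fun _ => C) (s := fun _ => univ) (K := K)
      (fun _ _ => hK.lipschitzOnWith) (t₀ := 0) ⟨by linarith, ha⟩
      (fun t ht => ⟨hγ t ht, mem_univ _⟩) (fun t ht => ⟨hη t ht, mem_univ _⟩) h0

/-- The global trajectories of an admissible speed field exist. -/
theorem IsAdmissibleSpeed.exists_isTrajectory {C : Plane → Plane} (hC : IsAdmissibleSpeed C)
    (z : Plane) : ∃ γ, IsTrajectory C z γ := by
  obtain ⟨K, hK⟩ := hC.exists_lipschitzWith
  obtain ⟨M, hM⟩ := hC.bounded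
  have hM0 : 0 ≤ M := (norm_nonneg _).trans (hM 0)
  have hloc : ∀ a : ℝ, ∃ γ : ℝ → Plane, γ 0 = z ∧
      ∀ t ∈ Ioo (-a) a, HasDerivAt γ (C (γ t)) t := by
    intro a
    rcases le_or_gt a 0 with ha | ha
    · exact ⟨fun _ => z, rfl, fun t ht => absurd (ht.1.trans ht.2) (by linarith)⟩
    · have hpl : IsPicardLindelof (fun _ => C) (tmin := -a) (tmax := a)
          ⟨0, by constructor <;> linarith⟩ z (M * a).toNNReal 0 M.toNNReal K :=
        { lipschitzOnWith := fun _ _ => hK.lipschitzOnWith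
          continuousOn := fun _ _ => continuousOn_const
          norm_le := fun _ _ x _ => (hM x).trans (Real.le_coe_toNNReal M)
          mul_max_le := by
            rw [Real.coe_toNNReal _ hM0, Real.coe_toNNReal _ (by positivity)]
            simp }
      obtain ⟨γ, h0, h1⟩ := hpl.exists_eq_forall_mem_Icc_hasDerivWithinAt₀
      exact ⟨γ, h0, fun t ht =>
        (h1 t (Ioo_subset_Icc_self ht)).hasDerivAt (Icc_mem_nhds ht.1 ht.2)⟩
  choose γ h0 h1 using hloc
  have hagree : ∀ a b t, t ∈ Ioo (-a) a → a ≤ b → γ a t = γ b t := by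
    intro a b t ht hab
    exact eqOn_of_hasDerivAt hK ((h0 a).trans (h0 b).symm) (h1 a)
      (fun s hs => h1 b s ⟨by linarith [hs.1], by linarith [hs.2]⟩) ht
  refine ⟨fun t => γ (|t| + 1) t, h0 _, fun t => ?_⟩
  have hmem : t ∈ Ioo (-(|t| + 1)) (|t| + 1) :=
    ⟨by linarith [neg_abs_le t], by linarith [le_abs_self t]⟩
  refine (h1 (|t| + 1) t hmem).congr_of_eventuallyEq ?_
  filter_upwards [Ioo_mem_nhds hmem.1 hmem.2] with s hs
  rcases le_total (|s| + 1) (|t| + 1) with h | h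
  · exact hagree _ _ s ⟨by linarith [neg_abs_le s], by linarith [le_abs_self s]⟩ h
  · exact (hagree _ _ s hs h).symm

theorem flow_isTrajectory {C : Plane → Plane} (hC : IsAdmissibleSpeed C) (z : Plane) :
    IsTrajectory C z (fun t => flow C t z) :=
  Classical.epsilon_spec (hC.exists_isTrajectory z)

theorem IsTrajectory.eq_flow {C : Plane → Plane} (hC : IsAdmissibleSpeed C) {z : Plane}
    {γ : ℝ → Plane} (hγ : IsTrajectory C z γ) (t : ℝ) : γ t = flow C t z := by
  obtain ⟨K, hK⟩ := hC.exists_lipschitzWith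
  have hf := flow_isTrajectory hC z
  exact eqOn_of_hasDerivAt hK (hγ.1.trans hf.1.symm) (fun s _ => hγ.2 s) (fun s _ => hf.2 s)
    (a := |t| + 1) ⟨by linarith [neg_abs_le t], by linarith [le_abs_self t]⟩

/-! ### The semigroups of diffusion and of convection, and their generators -/

/-- The heat kernel `K(t,x) = (4 π ε² t)⁻¹ exp(-|x|² / (4 ε² t))`. -/
def heatKernel (ε t : ℝ) (x : Plane) : ℝ :=
  1 / (4 * Real.pi * ε ^ 2 * t) * Real.exp (-(‖x‖ ^ 2 / (4 * ε ^ 2 * t)))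

/-- The diffusion semigroup: `T(t)v = K(t,·) * v` for `t > 0`, and `T(0)v = v`. -/
def diffusionSemigroup (ε : ℝ) (t : ℝ) (v : L1) : L1 :=
  if 0 < t then toL1 (fun x => ∫ z, heatKernel ε t (x - z) * v z) else v

/-- The convection semigroup:
`T(t)v(x) = exp(-∫₀ᵗ (div C)(Π(-s)x) ds) v(Π(-t)x)`. -/
def convectionSemigroup (C : Plane → Plane) (t : ℝ) (v : L1) : L1 :=
  toL1 (fun x => Real.exp (-∫ s in (0 : ℝ)..t, divergence C (flow C (-s) x)) * v (flow C (-t) x))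

/-- The graph of the infinitesimal generator of a semigroup `T` on `L¹(ℝ²)`: the pairs `(u, f)` with
`(T(t)u - u) / t → f` in `L¹(ℝ²)` as `t ↘ 0`. The domain is the set of the first components. -/
def generatorGraph (T : ℝ → L1 → L1) : Set (L1 × L1) :=
  {p | Tendsto (fun t : ℝ => t⁻¹ • (T t p.1 - p.1)) (𝓝[>] 0) (𝓝 p.2)}

/-- The graph of the generator `A` of the diffusion semigroup. -/
def graphA (ε : ℝ) : Set (L1 × L1) := generatorGraph (diffusionSemigroup ε)

/-- The graph of the generator `B` of the convection semigroup. -/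
def graphB (C : Plane → Plane) : Set (L1 × L1) := generatorGraph (convectionSemigroup C)

/-- The graph of the sum `A + B`, whose domain `D(A) ∩ D(B)` is `D(A)` because `D(A) ⊆ D(B)`. -/
def graphAB (ε : ℝ) (C : Plane → Plane) : Set (L1 × L1) :=
  {p | ∃ a b : L1, (p.1, a) ∈ graphA ε ∧ (p.1, b) ∈ graphB C ∧ p.2 = a + b}

/-- `R` is the (bounded, everywhere defined) inverse of `λ I - G : D(G) → L¹(ℝ²)`, where `G` is the
operator with the given graph: `R f = v` iff `v ∈ D(G)` and `λ v - G v = f`. -/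
def IsResolvent (G : Set (L1 × L1)) (lam : ℝ) (R : L1 →L[ℝ] L1) : Prop :=
  ∀ f v : L1, R f = v ↔ (v, lam • v - f) ∈ G

/-! ### The return-to-home system -/

/-- The Gaussian density `g` centred at `0` with standard deviation `σ`. -/
def gaussian (σ : ℝ) (x : Plane) : ℝ :=
  1 / (2 * Real.pi * σ ^ 2) * Real.exp (-((x 0 ^ 2 + x 1 ^ 2) / (2 * σ ^ 2)))

/-- The translate `g(· - y)` as an element of `L¹(ℝ²)`. -/
def gaussianAt (σ : ℝ) (y : Plane) : L1 := toL1 (fun x => gaussian σ (x - y))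

/-- `(u, v, w)` is a mild solution on `[0, ∞)`, with initial value `(u₀, v₀, w₀)`, of the system
`u' = χ ∫ w dx - γ u`, `v' = (A + B) v - α v + γ g(· - y) u`, `w' = α v - χ w`:
it is continuous with values in `ℝ × L¹ × L¹`, its time integrals lie in the domain of the operator
on the right-hand side, and it satisfies the system integrated in time.
Only the values at times `t ≥ 0` matter. -/
structure IsMildSolution (ε σ α γ χ : ℝ) (C : Plane → Plane) (y : Plane)
    (u₀ : ℝ) (v₀ w₀ : L1) (u : ℝ → ℝ) (v w : ℝ → L1) : Prop where
  continuousOn_u : ContinuousOn u (Ici 0)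
  continuousOn_v : ContinuousOn v (Ici 0)
  continuousOn_w : ContinuousOn w (Ici 0)
  eq_u : ∀ t, 0 ≤ t → u t = u₀ + (χ * mass (∫ s in (0 : ℝ)..t, w s) - γ * ∫ s in (0 : ℝ)..t, u s)
  eq_v : ∀ t, 0 ≤ t → ∃ f : L1, (∫ s in (0 : ℝ)..t, v s, f) ∈ graphAB ε C ∧
    v t = v₀ + (f - α • (∫ s in (0 : ℝ)..t, v s) + (γ * ∫ s in (0 : ℝ)..t, u s) • gaussianAt σ y)
  eq_w : ∀ t, 0 ≤ t → w t = w₀ + (α • (∫ s in (0 : ℝ)..t, v s) - χ • ∫ s in (0 : ℝ)..t, w s)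

/-- `(ū, v̄, w̄)` is an equilibrium of the system. -/
structure IsEquilibrium (ε σ α γ χ : ℝ) (C : Plane → Plane) (y : Plane)
    (u : ℝ) (v w : L1) : Prop where
  eq_u : χ * mass w - γ * u = 0
  eq_v : ∃ f : L1, (v, f) ∈ graphAB ε C ∧ f - α • v + (γ * u) • gaussianAt σ y = 0
  eq_w : α • v - χ • w = 0

end

end ReturnHome

/-!
The operator `A + B` is a perturbation of the generator of the heat semigroup by a first order
operator. The heat semigroup maps `L¹` into the domain of `B`, and `B T_A(t)` has norm of order
`t ^ (-1/2)`, the size of the gradient of the heat kernel (`exists_mem_generator_convection`). Since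
this singularity is integrable, `B (λ I - A)⁻¹`, a Laplace transform, has norm less than `1` for
large `λ`, and `λ I - A - B` is onto by a Neumann series. The sum of two generators of contraction
semigroups is dissipative, so `λ I - A - B` has a bounded inverse for every `λ > 0`
(`isMaxDissipative_sumGraph`); for `λ = α` this is the inverse in the theorem. That the convection
semigroup consists of isometries of `L¹` which preserve the mass is the change of variables formula,
with the Jacobian determinant given by Liouville's formula (`lintegral_jacobian_mul`). Both
semigroups preserve the mass, hence `∫ (A + B) v = 0` on the domain.

The remaining argument uses only this: a densely defined maximal dissipative operator `G` on a Banach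
space, a functional `m` of norm at most `1` that vanishes on the range of `G`, and a vector `g` of
norm at most `1` with `m g = 1`. On `ℝ × E × E` with the sum norm the operator of the whole system is
maximal dissipative, because every loss term of one compartment is the gain term of another
(`isMaxDissipative_systemGraph`), so mild solutions exist by the Hille–Yosida theorem
(`IsMaxDissipative.exists_mild`). The masses `u`, `V = m v`, `W = m w` solve the cyclic linear system
`u' = χ W - γ u`, `V' = γ u - α V`, `W' = α V - χ W`, so their sum is constant. If the sum is zero,
the derivative of `γ u² + α V² + χ W²` is minus the sum of the squares of the differences of the
fluxes, which controls the function itself (`weighted_sq_le`), and `u` decays exponentially. Then `v`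
decays as well: it is damped at the rate `α`, and fed by `u` only. Likewise `w`, which is damped at
the rate `χ` and fed by `v` only (`norm_le_of_mild`, `exists_decay`). The bounds are linear in the
initial value. Applied to the difference of two solutions with the same initial value they give
uniqueness, and applied to the difference of a solution and the equilibrium of the same mass they
give the convergence.
-/

namespace ReturnHome

/-! ### Maximal dissipative operators -/

section Dissipative

variable {X : Type*} [NormedAddCommGroup X] [NormedSpace ℝ X]

/-- A linear operator on a Banach space, given by its graph, is maximal dissipative if
`‖lam v - G v‖ ≥ lam ‖v‖` and `lam I - G` is onto for every `lam > 0`. -/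
structure IsMaxDissipative (G : Submodule ℝ (X × X)) : Prop where
  norm_le : ∀ p ∈ G, ∀ lam : ℝ, 0 < lam → lam * ‖p.1‖ ≤ ‖lam • p.1 - p.2‖
  exists_mem : ∀ lam : ℝ, 0 < lam → ∀ f : X, ∃ v : X, (v, lam • v - f) ∈ G

/-- An a priori bound for a curve all of whose backward Euler steps are almost expansive. It is the
substitute for differentiating the norm. -/
theorem norm_le_of_backward_step {Y Y' : ℝ → X} {Q q : ℝ → ℝ} {T : ℝ} (hT : 0 ≤ T)
    (hc : ContinuousOn Y (Icc 0 T))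
    (hd : ∀ s ∈ Ioc 0 T, HasDerivAt Y (Y' s) s)
    (hQ : ∀ s, HasDerivAt Q (q s) s)
    (hstep : ∀ s ∈ Ioc 0 T, ∀ k : ℝ, 0 < k → ‖Y s‖ ≤ ‖Y s - k • Y' s‖ + k * q s) :
    ‖Y T‖ ≤ ‖Y 0‖ + (Q T - Q 0) := by
  have hmaps : MapsTo (fun x => T - x) (Icc 0 T) (Icc 0 T) := fun x hx =>
    ⟨by linarith [hx.2], by linarith [hx.1]⟩
  have key := image_le_of_liminf_slope_right_le_deriv_boundary (a := 0) (b := T)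
    (f := fun x => -‖Y (T - x)‖) (B := fun x => -‖Y T‖ + (Q T - Q (T - x)))
    (B' := fun x => q (T - x)) ?_ (by simp) ?_ ?_ ?_ (right_mem_Icc.2 hT)
  · simp only [sub_self] at key
    linarith
  · exact ((hc.comp (by fun_prop) hmaps).norm).neg
  · have hQc : Continuous Q := continuous_iff_continuousAt.2 fun s => (hQ s).continuousAt
    fun_prop
  · intro x _
    have h1 : HasDerivAt (fun x => Q (T - x)) (-q (T - x)) x := by
      simpa using HasDerivAt.comp_const_sub (f := Q) T x (hQ (T - x))
    have h2 := (h1.const_sub (Q T)).const_add (-‖Y T‖)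
    simpa using h2.hasDerivWithinAt
  · intro x hx r hr
    have hs : T - x ∈ Ioc 0 T := ⟨by linarith [hx.2], by linarith [hx.1]⟩
    -- the error of the backward Euler step is `o(k)`
    have hlim : Tendsto (fun k : ℝ => ‖k⁻¹ • (Y (T - x + -k) - Y (T - x) - (-k) • Y' (T - x))‖)
        (𝓝[>] 0) (𝓝 0) := by
      have h1 := hasDerivAt_iff_tendsto.1 (hd _ hs)
      have h2 : Tendsto (fun k : ℝ => T - x - k) (𝓝[>] 0) (𝓝 (T - x)) := by
        have : Tendsto (fun k : ℝ => T - x - k) (𝓝 0) (𝓝 (T - x - 0)) := by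
          exact (continuous_const.sub continuous_id).tendsto _
        rw [sub_zero] at this
        exact this.mono_left nhdsWithin_le_nhds
      refine (h1.comp h2).congr' ?_
      filter_upwards [self_mem_nhdsWithin] with k hk
      have hk' : (0 : ℝ) < k := hk
      simp only [Function.comp, norm_smul, norm_inv, Real.norm_eq_abs, sub_sub_cancel_left, abs_neg]
      rw [← sub_eq_add_neg (T - x) k]
    have hev := hlim.eventually (gt_mem_nhds (sub_pos.2 hr))
    have hmap : Tendsto (fun z : ℝ => z - x) (𝓝[>] x) (𝓝[>] 0) := by
      refine tendsto_nhdsWithin_iff.2 ⟨?_, ?_⟩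
      · have : Tendsto (fun z : ℝ => z - x) (𝓝 x) (𝓝 (x - x)) :=
          (continuous_id.sub continuous_const).tendsto _
        rw [sub_self] at this
        exact this.mono_left nhdsWithin_le_nhds
      · filter_upwards [self_mem_nhdsWithin] with z hz
        exact sub_pos.2 (mem_Ioi.1 hz)
    refine Eventually.frequently ?_
    filter_upwards [hmap.eventually hev, self_mem_nhdsWithin] with z hz1 hz
    have hk : 0 < z - x := sub_pos.2 hz
    rw [slope_def_field, div_lt_iff₀ hk]
    have h1 := hstep _ hs (z - x) hk
    rw [norm_smul, norm_inv, Real.norm_eq_abs, abs_of_pos hk, inv_mul_lt_iff₀ hk] at hz1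
    have e1 : T - x + -(z - x) = T - z := by ring
    rw [e1] at hz1
    have h2 : ‖Y (T - x) - (z - x) • Y' (T - x)‖ ≤ ‖Y (T - z)‖ +
        ‖Y (T - z) - Y (T - x) - -(z - x) • Y' (T - x)‖ := by
      have := norm_sub_le (Y (T - z)) (Y (T - z) - Y (T - x) - -(z - x) • Y' (T - x))
      refine le_trans (le_of_eq ?_) this
      congr 1
      rw [neg_smul]
      abel
    nlinarith

/-- An operator that is onto and bounded below has a bounded inverse. -/
theorem exists_inverse {G : Submodule ℝ (X × X)} {lam : ℝ} (hlam : 0 < lam)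
    (hG : ∀ p ∈ G, lam * ‖p.1‖ ≤ ‖lam • p.1 - p.2‖)
    (hsurj : ∀ f : X, ∃ v : X, (v, lam • v - f) ∈ G) :
    ∃ R : X →L[ℝ] X, (∀ f v, R f = v ↔ (v, lam • v - f) ∈ G) ∧ ∀ f, lam * ‖R f‖ ≤ ‖f‖ := by
  choose r hr using hsurj
  have hle : ∀ f v, (v, lam • v - f) ∈ G → lam * ‖v‖ ≤ ‖f‖ := by
    intro f v h
    simpa using hG _ h
  have huniq : ∀ f v w, (v, lam • v - f) ∈ G → (w, lam • w - f) ∈ G → v = w := by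
    intro f v w hv hw
    have h := G.sub_mem hv hw
    have h2 := hle 0 (v - w) (by
      convert h using 1
      ext <;> simp [smul_sub])
    rw [norm_zero] at h2
    have : ‖v - w‖ ≤ 0 := by
      by_contra hcon
      push Not at hcon
      nlinarith
    exact sub_eq_zero.1 (norm_le_zero_iff.1 this)
  let L : X →ₗ[ℝ] X :=
    { toFun := r
      map_add' := fun f g => by
        refine huniq (f + g) _ _ (hr _) ?_
        convert G.add_mem (hr f) (hr g) using 1
        ext <;> simp [smul_add]
        abel
      map_smul' := fun c f => by
        refine huniq (c • f) _ _ (hr _) ?_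
        convert G.smul_mem c (hr f) using 1
        ext <;> simp [smul_sub, smul_comm c lam] }
  refine ⟨L.mkContinuous lam⁻¹ fun f => ?_, fun f v => ⟨?_, fun h => ?_⟩, fun f => hle f _ (hr f)⟩
  · rw [inv_mul_eq_div, le_div_iff₀ hlam, mul_comm]
    exact hle f _ (hr f)
  · rintro rfl
    exact hr f
  · exact huniq f _ _ (hr f) h

/-- A dissipative operator `G` for which `lam I - G` is onto for all large `lam` is maximal
dissipative: the Neumann series at `lam₀` reaches down to every `lam` in `(0, lam₀]`. -/
theorem IsMaxDissipative.of_eventually [CompleteSpace X] {G : Submodule ℝ (X × X)}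
    (hle : ∀ p ∈ G, ∀ lam : ℝ, 0 < lam → lam * ‖p.1‖ ≤ ‖lam • p.1 - p.2‖)
    (hev : ∀ᶠ lam : ℝ in atTop, ∀ f : X, ∃ v : X, (v, lam • v - f) ∈ G) :
    IsMaxDissipative G := by
  refine ⟨hle, fun lam hlam f => ?_⟩
  obtain ⟨mu, hmu, hsurj⟩ := ((eventually_ge_atTop lam).and hev).exists
  have hmu0 : 0 < mu := hlam.trans_le hmu
  obtain ⟨R, hR, hRn⟩ := exists_inverse hmu0 (fun p hp => hle p hp mu hmu0) hsurj
  have hnorm : ‖(mu - lam) • R‖ < 1 := by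
    refine lt_of_le_of_lt (ContinuousLinearMap.opNorm_le_bound _ (M := (mu - lam) / mu)
      (div_nonneg (by linarith) hmu0.le) fun g => ?_) ((div_lt_one hmu0).2 (by linarith))
    rw [smul_apply, norm_smul, Real.norm_eq_abs, abs_of_nonneg (by linarith),
      div_mul_eq_mul_div, mul_div_assoc]
    refine mul_le_mul_of_nonneg_left ?_ (by linarith)
    rw [le_div_iff₀ hmu0, mul_comm]
    exact hRn g
  set U := Units.oneSub ((mu - lam) • R) hnorm
  set g := (↑U⁻¹ : X →L[ℝ] X) f with hg
  have h1 : g - (mu - lam) • R g = f := by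
    have : ((U : X →L[ℝ] X) * (↑U⁻¹ : X →L[ℝ] X)) f = f := by simp
    simpa [U] using this
  refine ⟨R g, ?_⟩
  have h2 := (hR g (R g)).1 rfl
  convert h2 using 2
  rw [← h1, sub_smul]
  abel

/-- The resolvent of a maximal dissipative operator, and `0` for `lam ≤ 0`. -/
noncomputable def IsMaxDissipative.resolvent {G : Submodule ℝ (X × X)} (hG : IsMaxDissipative G)
    (lam : ℝ) : X →L[ℝ] X :=
  open Classical in if h : 0 < lam then
    (exists_inverse h (fun p hp => hG.norm_le p hp lam h) (hG.exists_mem lam h)).choose else 0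

namespace IsMaxDissipative

variable {G : Submodule ℝ (X × X)} (hG : IsMaxDissipative G) {lam : ℝ}
include hG

theorem resolvent_eq_iff (hlam : 0 < lam) {f v : X} :
    hG.resolvent lam f = v ↔ (v, lam • v - f) ∈ G := by
  rw [resolvent, dif_pos hlam]
  exact (exists_inverse hlam (fun p hp => hG.norm_le p hp lam hlam)
    (hG.exists_mem lam hlam)).choose_spec.1 f v

theorem norm_resolvent_le (hlam : 0 < lam) (f : X) : lam * ‖hG.resolvent lam f‖ ≤ ‖f‖ := by
  rw [resolvent, dif_pos hlam]
  exact (exists_inverse hlam (fun p hp => hG.norm_le p hp lam hlam)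
    (hG.exists_mem lam hlam)).choose_spec.2 f

theorem resolvent_mem (hlam : 0 < lam) (f : X) :
    (hG.resolvent lam f, lam • hG.resolvent lam f - f) ∈ G :=
  (hG.resolvent_eq_iff hlam).1 rfl

theorem resolvent_apply (hlam : 0 < lam) {p : X × X} (hp : p ∈ G) :
    hG.resolvent lam (lam • p.1 - p.2) = p.1 := by
  rw [hG.resolvent_eq_iff hlam]
  simpa using hp

theorem mem_iff {p : X × X} : p ∈ G ↔ hG.resolvent 1 (p.1 - p.2) = p.1 := by
  rw [hG.resolvent_eq_iff one_pos]
  simp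

theorem isClosed : IsClosed (G : Set (X × X)) := by
  have : (G : Set (X × X)) = {p | hG.resolvent 1 (p.1 - p.2) = p.1} := by
    ext p
    exact hG.mem_iff
  rw [this]
  exact isClosed_eq (by fun_prop) (by fun_prop)

theorem resolvent_sub_resolvent {mu : ℝ} (hlam : 0 < lam) (hmu : 0 < mu) (f : X) :
    hG.resolvent lam f - hG.resolvent mu f
      = (mu - lam) • hG.resolvent lam (hG.resolvent mu f) := by
  have h := hG.resolvent_apply hlam (hG.resolvent_mem hmu f)
  simp only [map_sub, map_smul] at h ⊢
  rw [sub_smul, ← h]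
  simp only [h]
  have h' := h
  rw [← sub_eq_zero] at h' ⊢
  rw [← h']
  abel

theorem resolvent_comm {mu : ℝ} (hlam : 0 < lam) (hmu : 0 < mu) (f : X) :
    hG.resolvent lam (hG.resolvent mu f) = hG.resolvent mu (hG.resolvent lam f) := by
  rcases eq_or_ne lam mu with rfl | hne
  · rfl
  · have h1 := hG.resolvent_sub_resolvent hlam hmu f
    have h2 := hG.resolvent_sub_resolvent hmu hlam f
    rw [← neg_sub, h1, ← neg_smul, neg_sub] at h2
    exact smul_right_injective X (sub_ne_zero.2 hne) h2

/-- `lam (lam I - G)⁻¹` tends strongly to the identity if the domain is dense. -/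
theorem tendsto_smul_resolvent (hdense : Dense (Prod.fst '' (G : Set (X × X)))) (x : X) :
    Tendsto (fun r : ℝ => r • hG.resolvent r x) atTop (𝓝 x) := by
  rw [Metric.tendsto_atTop]
  intro e he
  obtain ⟨_, ⟨p, hp, rfl⟩, hpe⟩ := Metric.mem_closure_iff.1 (hdense x) (e / 3) (by positivity)
  refine ⟨max 1 (3 * (‖p.2‖ + 1) / e), fun r hr => ?_⟩
  have hr0 : 0 < r := lt_of_lt_of_le one_pos ((le_max_left _ _).trans hr)
  have hr1 : 3 * (‖p.2‖ + 1) / e ≤ r := (le_max_right _ _).trans hr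
  have h1 : r • hG.resolvent r p.1 - p.1 = hG.resolvent r p.2 := by
    have := hG.resolvent_apply hr0 hp
    rw [map_sub, map_smul] at this
    rw [sub_eq_iff_eq_add, add_comm, ← sub_eq_iff_eq_add]
    exact this
  have h2 : ‖hG.resolvent r p.2‖ < e / 3 := by
    have := hG.norm_resolvent_le hr0 p.2
    rw [div_le_iff₀ he] at hr1
    by_contra hcon
    push Not at hcon
    nlinarith [mul_le_mul_of_nonneg_left hcon hr0.le]
  have h3 : ‖r • hG.resolvent r (x - p.1)‖ < e / 3 := by
    rw [norm_smul, Real.norm_eq_abs, abs_of_pos hr0]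
    refine lt_of_le_of_lt (hG.norm_resolvent_le hr0 _) ?_
    rwa [← dist_eq_norm]
  rw [dist_eq_norm]
  have h4 : r • hG.resolvent r x - x
      = r • hG.resolvent r (x - p.1) + hG.resolvent r p.2 - (x - p.1) := by
    rw [← h1, map_sub, smul_sub]
    abel
  rw [dist_eq_norm] at hpe
  rw [h4]
  calc _ ≤ ‖r • hG.resolvent r (x - p.1)‖ + ‖hG.resolvent r p.2‖ + ‖x - p.1‖ :=
        (norm_sub_le _ _).trans (add_le_add_left (norm_add_le _ _) _)
    _ < e := by linarith

end IsMaxDissipative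

end Dissipative

/-! ### Mild solutions of evolution equations -/

section Mild

variable {X : Type*} [NormedAddCommGroup X] [NormedSpace ℝ X] [CompleteSpace X]

theorem hasDerivAt_integral_of_continuousOn_Ici {z : ℝ → X} (hz : ContinuousOn z (Ici 0)) {s : ℝ}
    (hs : 0 < s) : HasDerivAt (fun t => ∫ r in (0 : ℝ)..t, z r) (z s) s := by
  have hnhds : Ici (0 : ℝ) ∈ 𝓝 s := Ici_mem_nhds hs
  refine intervalIntegral.integral_hasDerivAt_right ?_ ?_ (hz.continuousAt hnhds)
  · refine (hz.mono ?_).intervalIntegrable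
    rw [uIcc_of_le hs.le]
    exact fun x hx => hx.1
  · exact (hz.stronglyMeasurableAtFilter_nhdsWithin measurableSet_Ici s).filter_mono
      (by rw [nhdsWithin_eq_nhds.2 hnhds])

omit [NormedSpace ℝ X] [CompleteSpace X] in
theorem intervalIntegrable_of_continuousOn_Ici {z : ℝ → X} (hz : ContinuousOn z (Ici 0)) {t : ℝ}
    (ht : 0 ≤ t) : IntervalIntegrable z volume 0 t := by
  refine (hz.mono ?_).intervalIntegrable
  rw [uIcc_of_le ht]
  exact fun x hx => hx.1

namespace IsMaxDissipative

variable {G : Submodule ℝ (X × X)} (hG : IsMaxDissipative G)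

section

/-- The Yosida approximation `r (r (r I - G)⁻¹ - I)` of a maximal dissipative operator. -/
noncomputable def yosida (r : ℝ) : X →L[ℝ] X := r • (r • hG.resolvent r - 1)

omit [CompleteSpace X]
include hG

/-- On the regularised vector `r (r I - G)⁻¹ x` the operator takes the value of its Yosida
approximation at `x`. -/
theorem smul_resolvent_yosida_mem {r : ℝ} (hr : 0 < r) (x : X) :
    (r • hG.resolvent r x, hG.yosida r x) ∈ G := by
  have := G.smul_mem r (hG.resolvent_mem hr x)
  simpa [yosida] using this

theorem yosida_commute {r s : ℝ} (hr : 0 < r) (hs : 0 < s) :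
    Commute (hG.yosida r) (hG.yosida s) := by
  have h : Commute (hG.resolvent r) (hG.resolvent s) := by
    ext x
    exact hG.resolvent_comm hr hs x
  have h1 : Commute (r • hG.resolvent r - 1) (s • hG.resolvent s - 1) :=
    (((h.smul_left r).smul_right s).sub_left (Commute.one_left _)).sub_right (Commute.one_right _)
  exact (h1.smul_left r).smul_right s

theorem yosida_apply {r : ℝ} (hr : 0 < r) {p : X × X} (hp : p ∈ G) :
    hG.yosida r p.1 = r • hG.resolvent r p.2 := by
  have := hG.resolvent_apply hr hp
  rw [map_sub, map_smul, sub_eq_iff_eq_add] at this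
  simp only [yosida, smul_apply, sub_apply, one_apply_eq_self]
  rw [this, add_sub_cancel_left]

end

include hG

/-- Exponential decay of the mild solutions of `z' = G z - c z + h` for an exponentially decaying
`h`. The curve is regularised by `J = r (r I - G)⁻¹`, which makes it a strong solution. -/
theorem norm_le_of_mild (hdense : Dense (Prod.fst '' (G : Set (X × X)))) {c b H : ℝ} (hbc : b < c)
    {z h : ℝ → X} (hz : ContinuousOn z (Ici 0)) (hh : ContinuousOn h (Ici 0))
    (hH : ∀ t, 0 ≤ t → ‖h t‖ ≤ H * Real.exp (-b * t))
    (heq : ∀ t, 0 ≤ t → ∃ f : X, (∫ s in (0 : ℝ)..t, z s, f) ∈ G ∧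
      z t = z 0 + (f - c • (∫ s in (0 : ℝ)..t, z s) + ∫ s in (0 : ℝ)..t, h s))
    {t : ℝ} (ht : 0 ≤ t) :
    ‖z t‖ ≤ Real.exp (-c * t) * ‖z 0‖ + H / (c - b) * Real.exp (-b * t) := by
  have hcb : 0 < c - b := sub_pos.2 hbc
  have hH0 : 0 ≤ H := by simpa using (norm_nonneg _).trans (hH 0 le_rfl)
  have main : ∀ r : ℝ, 0 < r → Real.exp (c * t) * ‖r • hG.resolvent r (z t)‖
      ≤ ‖z 0‖ + H / (c - b) * Real.exp ((c - b) * t) := by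
    intro r hr
    set J : X →L[ℝ] X := r • hG.resolvent r with hJ
    set A : X →L[ℝ] X := hG.yosida r with hA
    have hJn : ∀ x, ‖J x‖ ≤ ‖x‖ := fun x => by
      rw [hJ, smul_apply, norm_smul, Real.norm_eq_abs, abs_of_pos hr]
      exact hG.norm_resolvent_le hr x
    have hJA : ∀ x, (J x, A x) ∈ G := hG.smul_resolvent_yosida_mem hr
    have hAf : ∀ x f, (x, f) ∈ G → J f = A x := fun x f hx => (hG.yosida_apply hr hx).symm
    set y : ℝ → X := fun s => J (z 0) + (A (∫ s in (0 : ℝ)..s, z s)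
      - c • J (∫ s in (0 : ℝ)..s, z s) + J (∫ s in (0 : ℝ)..s, h s)) with hy
    have hyz : ∀ s, 0 ≤ s → J (z s) = y s := by
      intro s hs
      obtain ⟨f, hf, hzf⟩ := heq s hs
      rw [hzf, hy]
      simp only [map_add, map_sub, map_smul, hAf _ _ hf]
    have hyd : ∀ s, 0 < s → HasDerivAt y (A (z s) - c • J (z s) + J (h s)) s := by
      intro s hs
      have h1 := hasDerivAt_integral_of_continuousOn_Ici hz hs
      have h2 := hasDerivAt_integral_of_continuousOn_Ici hh hs
      have hJd : ∀ L : X →L[ℝ] X, HasDerivAt (fun s => L (∫ s in (0 : ℝ)..s, z s)) (L (z s)) s :=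
        fun L => L.hasFDerivAt.comp_hasDerivAt s h1
      have h3 : HasDerivAt (fun s => J (∫ s in (0 : ℝ)..s, h s)) (J (h s)) s :=
        J.hasFDerivAt.comp_hasDerivAt s h2
      exact (((hJd A).sub ((hJd J).const_smul c)).add h3).const_add _
    have hexp : ∀ s, HasDerivAt (fun s : ℝ => Real.exp (c * s)) (Real.exp (c * s) * c) s := by
      intro s
      simpa using ((hasDerivAt_id s).const_mul c).exp
    -- multiplied by `exp (c s)`, the curve solves `Y' = A Y + exp (c s) J h`, without damping
    have key := norm_le_of_backward_step (Y := fun s => Real.exp (c * s) • y s)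
      (Y' := fun s => Real.exp (c * s) • (A (z s) + J (h s)))
      (Q := fun s => H / (c - b) * Real.exp ((c - b) * s))
      (q := fun s => H * Real.exp ((c - b) * s)) ht ?_ ?_ ?_ ?_
    · have hy0 : y 0 = J (z 0) := (hyz 0 le_rfl).symm
      simp only [mul_zero, Real.exp_zero, one_smul, norm_smul, Real.norm_eq_abs, Real.abs_exp,
        mul_one] at key
      rw [← hyz t ht, hy0] at key
      have h1 := hJn (z 0)
      have h2 : 0 ≤ H / (c - b) := by positivity
      have e1 : r • hG.resolvent r (z t) = J (z t) := rfl
      rw [e1]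
      linarith
    · have : ContinuousOn y (Icc 0 t) := by
        refine ContinuousOn.congr (f := fun s => J (z s)) ?_ fun s hs => (hyz s hs.1).symm
        exact J.continuous.comp_continuousOn (hz.mono fun s hs => hs.1)
      exact (by fun_prop : Continuous fun s : ℝ => Real.exp (c * s)).continuousOn.smul this
    · intro s hs
      refine ((hexp s).smul (hyd s hs.1)).congr_deriv ?_
      rw [← hyz s hs.1.le, mul_smul, ← smul_add]
      congr 1
      abel
    · intro s
      have h1 : HasDerivAt (fun s : ℝ => Real.exp ((c - b) * s))
          (Real.exp ((c - b) * s) * (c - b)) s := by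
        simpa using ((hasDerivAt_id s).const_mul (c - b)).exp
      refine (h1.const_mul (H / (c - b))).congr_deriv ?_
      field_simp
    · intro s hs k hk
      rw [← hyz s hs.1.le]
      have e : ∀ x : X, ‖Real.exp (c * s) • x‖ = Real.exp (c * s) * ‖x‖ := fun x => by
        rw [norm_smul, Real.norm_eq_abs, Real.abs_exp]
      have h1 : ‖J (z s)‖ ≤ ‖J (z s) - k • A (z s)‖ := by
        have := hG.norm_le _ (hJA (z s)) k⁻¹ (by positivity)
        have e2 : J (z s) - k • A (z s) = k • (k⁻¹ • J (z s) - A (z s)) := by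
          rw [smul_sub, smul_smul, mul_inv_cancel₀ hk.ne', one_smul]
        rw [e2, norm_smul, Real.norm_eq_abs, abs_of_pos hk]
        rw [inv_mul_le_iff₀ hk] at this
        exact this
      have h2 : ‖J (h s)‖ ≤ H * Real.exp (-b * s) := (hJn _).trans (hH s hs.1.le)
      have h3 : Real.exp (c * s) * (H * Real.exp (-b * s)) = H * Real.exp ((c - b) * s) := by
        rw [mul_left_comm, ← Real.exp_add]
        ring_nf
      have h4 : J (z s) - k • A (z s) = (J (z s) - k • (A (z s) + J (h s))) + k • J (h s) := by
        rw [smul_add]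
        abel
      have h5 : ‖J (z s)‖ ≤ ‖J (z s) - k • (A (z s) + J (h s))‖ + k * (H * Real.exp (-b * s)) := by
        calc _ ≤ _ := h1
          _ ≤ _ := by
            rw [h4]
            refine (norm_add_le _ _).trans ?_
            rw [norm_smul k, Real.norm_eq_abs, abs_of_pos hk]
            gcongr
      have e3 : Real.exp (c * s) • J (z s) - k • Real.exp (c * s) • (A (z s) + J (h s))
          = Real.exp (c * s) • (J (z s) - k • (A (z s) + J (h s))) := by
        rw [smul_sub, smul_comm]
      rw [e3, e, e, ← h3]
      have := mul_le_mul_of_nonneg_left h5 (Real.exp_pos (c * s)).le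
      nlinarith
  -- as `r → ∞` the regularisation disappears
  have hlim := (((hG.tendsto_smul_resolvent hdense (z t)).norm).const_mul (Real.exp (c * t)))
  have hle := le_of_tendsto hlim (by
    filter_upwards [eventually_gt_atTop 0] with r hr using main r hr)
  have h1 : ‖z t‖ = Real.exp (-c * t) * (Real.exp (c * t) * ‖z t‖) := by
    rw [← mul_assoc, ← Real.exp_add]
    simp
  rw [h1]
  refine (mul_le_mul_of_nonneg_left hle (Real.exp_pos _).le).trans (le_of_eq ?_)
  rw [mul_add, mul_left_comm, ← Real.exp_add]
  ring_nf

end IsMaxDissipative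

/-- Two commuting bounded operators whose exponentials are contractions generate flows that differ by
at most `t ‖a x - b x‖`. -/
theorem norm_exp_sub_exp_le {a b : X →L[ℝ] X} (hab : Commute a b)
    (ha : ∀ t : ℝ, 0 ≤ t → ∀ x, ‖NormedSpace.exp (t • a) x‖ ≤ ‖x‖)
    (hb : ∀ t : ℝ, 0 ≤ t → ∀ x, ‖NormedSpace.exp (t • b) x‖ ≤ ‖x‖) {t : ℝ} (ht : 0 ≤ t) (x : X) :
    ‖NormedSpace.exp (t • a) x - NormedSpace.exp (t • b) x‖ ≤ ‖a x - b x‖ * t := by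
  let _ : NormedAlgebra ℚ (X →L[ℝ] X) := NormedAlgebra.restrictScalars ℚ ℝ _
  set F : ℝ → (X →L[ℝ] X) := fun s => NormedSpace.exp (s • a) * NormedSpace.exp ((t - s) • b)
  have hF : ∀ s, HasDerivAt F
      (NormedSpace.exp (s • a) * (NormedSpace.exp ((t - s) • b) * (a - b))) s := by
    intro s
    have h1 := hasDerivAt_exp_smul_const a s
    have h2 : HasDerivAt (fun s : ℝ => NormedSpace.exp ((t - s) • b))
        (-(NormedSpace.exp ((t - s) • b) * b)) s := by
      exact HasDerivAt.comp_const_sub (f := fun u : ℝ => NormedSpace.exp (u • b)) t s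
        (hasDerivAt_exp_smul_const b (t - s))
    refine (h1.mul h2).congr_deriv ?_
    have hc : Commute a (NormedSpace.exp ((t - s) • b)) := (hab.smul_right (t - s)).exp_right
    rw [mul_assoc, hc.eq, mul_sub, mul_neg, ← sub_eq_add_neg, mul_sub]
  -- `F` interpolates between `exp (t b)` and `exp (t a)`
  have := norm_image_sub_le_of_norm_deriv_le_segment' (f := fun s => F s x)
    (f' := fun s => (NormedSpace.exp (s • a) * (NormedSpace.exp ((t - s) • b) * (a - b))) x)
    (a := 0) (b := t) (C := ‖a x - b x‖) ?_ ?_ t (right_mem_Icc.2 ht)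
  · simpa [F] using this
  · intro s _
    exact ((ContinuousLinearMap.apply ℝ X x).hasFDerivAt.comp_hasDerivAt s (hF s)).hasDerivWithinAt
  · intro s hs
    exact (ha s hs.1 _).trans (hb _ (by linarith [hs.2]) _)

namespace IsMaxDissipative

variable {G : Submodule ℝ (X × X)} (hG : IsMaxDissipative G)

include hG

theorem norm_exp_yosida_le {r : ℝ} (hr : 0 < r) {t : ℝ} (ht : 0 ≤ t) (x : X) :
    ‖NormedSpace.exp (t • hG.yosida r) x‖ ≤ ‖x‖ := by
  let _ : NormedAlgebra ℚ (X →L[ℝ] X) := NormedAlgebra.restrictScalars ℚ ℝ _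
  set A := hG.yosida r with hA
  have hd : ∀ s, HasDerivAt (fun s : ℝ => NormedSpace.exp (s • A) x)
      (A (NormedSpace.exp (s • A) x)) s := fun s =>
    ((ContinuousLinearMap.apply ℝ X x).hasFDerivAt.comp_hasDerivAt s
      (hasDerivAt_exp_smul_const' A s))
  have key := norm_le_of_backward_step (Y := fun s => NormedSpace.exp (s • A) x)
    (Y' := fun s => A (NormedSpace.exp (s • A) x)) (Q := fun _ => 0) (q := fun _ => 0) ht
    (fun s _ => (hd s).continuousAt.continuousWithinAt) (fun s _ => hd s)
    (fun s => hasDerivAt_const s 0) ?_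
  · simpa using key
  · intro s _ k hk
    simp only [mul_zero, add_zero]
    set y := NormedSpace.exp (s • A) x
    -- `(1 + k r) y = (y - k A y) + k r J y` and `J` is a contraction
    have h1 : (1 + k * r) • y = (y - k • A y) + (k * r) • (r • hG.resolvent r y) := by
      simp only [hA, yosida, smul_apply, sub_apply,
        one_apply_eq_self]
      module
    have h2 : ‖r • hG.resolvent r y‖ ≤ ‖y‖ := by
      rw [norm_smul, Real.norm_eq_abs, abs_of_pos hr]
      exact hG.norm_resolvent_le hr y
    have h3 := congrArg norm h1
    rw [norm_smul, Real.norm_eq_abs, abs_of_pos (by positivity)] at h3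
    have h4 := norm_add_le (y - k • A y) ((k * r) • (r • hG.resolvent r y))
    rw [norm_smul (k * r), Real.norm_eq_abs, abs_of_pos (by positivity)] at h4
    have h5 := mul_le_mul_of_nonneg_left h2 (by positivity : 0 ≤ k * r)
    linarith

/-- Existence of mild solutions of `z' = G z` (the Hille–Yosida theorem): the exponentials of the
Yosida approximations converge, locally uniformly in time. -/
theorem exists_mild (hdense : Dense (Prod.fst '' (G : Set (X × X)))) (x : X) :
    ∃ z : ℝ → X, ContinuousOn z (Ici 0) ∧
      ∀ t, 0 ≤ t → (∫ s in (0 : ℝ)..t, z s, z t - x) ∈ G := by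
  let _ : NormedAlgebra ℚ (X →L[ℝ] X) := NormedAlgebra.restrictScalars ℚ ℝ _
  set A : ℕ → (X →L[ℝ] X) := fun n => hG.yosida (n + 1) with hA
  have hpos : ∀ n : ℕ, (0 : ℝ) < n + 1 := fun n => by positivity
  have hnat : Tendsto (fun n : ℕ => (n : ℝ) + 1) atTop atTop :=
    tendsto_atTop_add_const_right _ _ tendsto_natCast_atTop_atTop
  have hJ : ∀ x, Tendsto (fun n : ℕ => ((n : ℝ) + 1) • hG.resolvent (n + 1) x) atTop (𝓝 x) :=
    fun x => (hG.tendsto_smul_resolvent hdense x).comp hnat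
  have hcontr : ∀ (n : ℕ) (t : ℝ), 0 ≤ t → ∀ x, ‖NormedSpace.exp (t • A n) x‖ ≤ ‖x‖ :=
    fun n t ht x => hG.norm_exp_yosida_le (hpos n) ht x
  have hdom : ∀ p ∈ G, Tendsto (fun n => A n p.1) atTop (𝓝 p.2) := by
    intro p hp
    exact (hJ p.2).congr fun n => (hG.yosida_apply (hpos n) hp).symm
  have hcauchy : ∀ T : ℝ, UniformCauchySeqOn (fun n t => NormedSpace.exp (t • A n) x) atTop
      (Icc 0 T) := by
    intro T
    rw [Metric.uniformCauchySeqOn_iff]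
    intro e he
    obtain ⟨_, ⟨p, hp, rfl⟩, hpe⟩ := Metric.mem_closure_iff.1 (hdense x) (e / 3) (by positivity)
    obtain ⟨N, hN⟩ := Metric.cauchySeq_iff.1 (hdom p hp).cauchySeq (e / (3 * (|T| + 1)))
      (by positivity)
    refine ⟨N, fun m hm n hn t ht => ?_⟩
    have h1 := norm_exp_sub_exp_le (hG.yosida_commute (hpos m) (hpos n)) (hcontr m) (hcontr n)
      ht.1 p.1
    have h2 := hN m hm n hn
    rw [dist_eq_norm] at h2 hpe ⊢
    have h3 : ‖A m p.1 - A n p.1‖ * t ≤ e / 3 := by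
      have ht' : t ≤ |T| + 1 := by linarith [ht.2, le_abs_self T]
      calc _ ≤ e / (3 * (|T| + 1)) * (|T| + 1) := by gcongr; exact ht.1
        _ = e / 3 := by field_simp
    have h4 := hcontr m t ht.1 (x - p.1)
    have h5 := hcontr n t ht.1 (x - p.1)
    have e1 : NormedSpace.exp (t • A m) x - NormedSpace.exp (t • A n) x
        = NormedSpace.exp (t • A m) (x - p.1)
          + (NormedSpace.exp (t • A m) p.1 - NormedSpace.exp (t • A n) p.1)
          - NormedSpace.exp (t • A n) (x - p.1) := by
      rw [map_sub, map_sub]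
      abel
    rw [e1]
    refine lt_of_le_of_lt ((norm_sub_le _ _).trans
      (add_le_add_left (norm_add_le _ _) _)) ?_
    have h6 : ‖NormedSpace.exp (t • A m) p.1 - NormedSpace.exp (t • A n) p.1‖ ≤ e / 3 := h1.trans h3
    linarith
  have hlim : ∀ t : ℝ, ∃ y, 0 ≤ t → Tendsto (fun n => NormedSpace.exp (t • A n) x) atTop (𝓝 y) := by
    intro t
    by_cases ht : 0 ≤ t
    · obtain ⟨y, hy⟩ := cauchySeq_tendsto_of_complete
        ((hcauchy t).cauchySeq (right_mem_Icc.2 ht))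
      exact ⟨y, fun _ => hy⟩
    · exact ⟨0, fun h => absurd h ht⟩
  choose z hz using hlim
  have hdn : ∀ n s, HasDerivAt (fun s : ℝ => NormedSpace.exp (s • A n) x)
      (A n (NormedSpace.exp (s • A n) x)) s := fun n s =>
    ((ContinuousLinearMap.apply ℝ X x).hasFDerivAt.comp_hasDerivAt s
      (hasDerivAt_exp_smul_const' (A n) s))
  have hcn : ∀ n, Continuous (fun s : ℝ => NormedSpace.exp (s • A n) x) := fun n =>
    continuous_iff_continuousAt.2 fun s => (hdn n s).continuousAt
  refine ⟨z, ?_, ?_⟩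
  · intro t ht
    have hunif := (hcauchy (t + 1)).tendstoUniformlyOn_of_tendsto fun s hs => hz s hs.1
    have hc := hunif.continuousOn (Frequently.of_forall fun n => (hcn n).continuousOn)
    have hmem : Icc 0 (t + 1) ∈ 𝓝[Ici 0] t := by
      rw [← Ici_inter_Iic]
      exact inter_mem self_mem_nhdsWithin (mem_nhdsWithin_of_mem_nhds (Iic_mem_nhds (by linarith)))
    exact (hc t ⟨ht, by linarith⟩).mono_of_mem_nhdsWithin hmem
  · intro t ht
    have hint : Tendsto (fun n => ∫ s in (0 : ℝ)..t, NormedSpace.exp (s • A n) x) atTop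
        (𝓝 (∫ s in (0 : ℝ)..t, z s)) := by
      refine intervalIntegral.tendsto_integral_filter_of_dominated_convergence (fun _ => ‖x‖) ?_ ?_
        intervalIntegrable_const ?_
      · exact Eventually.of_forall fun n => (hcn n).aestronglyMeasurable
      · refine Eventually.of_forall fun n => Eventually.of_forall fun s hs => ?_
        rw [uIoc_of_le ht] at hs
        exact hcontr n s hs.1.le x
      · refine Eventually.of_forall fun s hs => ?_
        rw [uIoc_of_le ht] at hs
        exact hz s hs.1.le
    have hmem : ∀ n : ℕ, (((n : ℝ) + 1) • hG.resolvent (n + 1)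
        (∫ s in (0 : ℝ)..t, NormedSpace.exp (s • A n) x), NormedSpace.exp (t • A n) x - x) ∈ G := by
      intro n
      have h1 := intervalIntegral.integral_eq_sub_of_hasDerivAt (a := 0) (b := t)
        (fun s _ => hdn n s) (((A n).continuous.comp (hcn n)).intervalIntegrable _ _)
      rw [(A n).intervalIntegral_comp_comm ((hcn n).intervalIntegrable _ _)] at h1
      have h2 := hG.smul_resolvent_yosida_mem (hpos n)
        (∫ s in (0 : ℝ)..t, NormedSpace.exp (s • A n) x)
      have h3 : hG.yosida (n + 1) = A n := rfl
      rw [h3, h1] at h2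
      simpa using h2
    have hlimJ : Tendsto (fun n : ℕ => ((n : ℝ) + 1) • hG.resolvent (n + 1)
        (∫ s in (0 : ℝ)..t, NormedSpace.exp (s • A n) x)) atTop (𝓝 (∫ s in (0 : ℝ)..t, z s)) := by
      have h1 : Tendsto (fun n : ℕ => ((n : ℝ) + 1) • hG.resolvent (n + 1)
          ((∫ s in (0 : ℝ)..t, NormedSpace.exp (s • A n) x) - ∫ s in (0 : ℝ)..t, z s)) atTop
          (𝓝 0) := by
        have h0 := (tendsto_iff_norm_sub_tendsto_zero.1 hint)
        refine squeeze_zero_norm (fun n => ?_) h0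
        rw [norm_smul, Real.norm_eq_abs, abs_of_pos (hpos n)]
        exact hG.norm_resolvent_le (hpos n) _
      have h2 := h1.add (hJ (∫ s in (0 : ℝ)..t, z s))
      rw [zero_add] at h2
      refine h2.congr fun n => ?_
      rw [map_sub, smul_sub]
      abel
    exact hG.isClosed.mem_of_tendsto (hlimJ.prodMk_nhds ((hz t ht).sub_const x))
      (Eventually.of_forall hmem)

end IsMaxDissipative

end Mild

/-! ### Strongly continuous contraction semigroups and their generators -/

section Semigroup

variable {X : Type*} [NormedAddCommGroup X] [NormedSpace ℝ X]

/-- A strongly continuous semigroup of linear contractions. Only the times `t ≥ 0` matter. -/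
structure IsContractionSemigroup (T : ℝ → X → X) : Prop where
  map_add : ∀ t, 0 ≤ t → ∀ x y, T t (x + y) = T t x + T t y
  map_smul : ∀ t, 0 ≤ t → ∀ (c : ℝ) (x : X), T t (c • x) = c • T t x
  norm_le : ∀ t, 0 ≤ t → ∀ x, ‖T t x‖ ≤ ‖x‖
  zero : ∀ x, T 0 x = x
  add : ∀ s t, 0 ≤ s → 0 ≤ t → ∀ x, T (s + t) x = T s (T t x)
  tendsto : ∀ x, Tendsto (fun t => T t x) (𝓝[>] 0) (𝓝 x)

namespace IsContractionSemigroup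

variable {T : ℝ → X → X} (hT : IsContractionSemigroup T)

/-- The member at time `t ≥ 0` of a contraction semigroup, as a bounded operator. -/
noncomputable def toCLM (t : ℝ) (ht : 0 ≤ t) : X →L[ℝ] X :=
  LinearMap.mkContinuous
    { toFun := T t, map_add' := hT.map_add t ht, map_smul' := hT.map_smul t ht } 1
    fun x => by simpa using hT.norm_le t ht x

@[simp]
theorem toCLM_apply (t : ℝ) (ht : 0 ≤ t) (x : X) : hT.toCLM t ht x = T t x := rfl

include hT in
theorem continuousOn (x : X) : ContinuousOn (fun t => T t x) (Ici 0) := by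
  have hbound : ∀ s t, 0 ≤ s → 0 ≤ t → dist (T s x) (T t x) ≤ ‖T |s - t| x - x‖ := by
    have : ∀ s t, 0 ≤ s → s ≤ t → ‖T t x - T s x‖ ≤ ‖T |s - t| x - x‖ := by
      intro s t hs hst
      have h1 : T t x = T s (T (t - s) x) := by
        rw [← hT.add s (t - s) hs (by linarith)]
        congr 1
        ring
      rw [abs_of_nonpos (by linarith), neg_sub, h1]
      have := hT.norm_le s hs (T (t - s) x - x)
      rwa [← hT.toCLM_apply s hs, _root_.map_sub] at this
    intro s t hs ht
    rw [dist_eq_norm]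
    rcases le_total s t with h | h
    · rw [norm_sub_rev]
      exact this s t hs h
    · rw [abs_sub_comm]
      exact this t s ht h
  intro t ht
  rw [ContinuousWithinAt, tendsto_iff_dist_tendsto_zero]
  have h0 : Tendsto (fun r => ‖T r x - x‖) (𝓝[≥] 0) (𝓝 0) := by
    rw [← tendsto_iff_norm_sub_tendsto_zero, ← Ioi_union_left, nhdsWithin_union]
    refine (hT.tendsto x).sup ?_
    rw [nhdsWithin_singleton]
    have := hT.zero x
    exact (tendsto_pure_nhds (fun t => T t x) 0).mono_right (by rw [this])
  have h1 : Tendsto (fun s => |s - t|) (𝓝[Ici 0] t) (𝓝[≥] 0) := by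
    refine tendsto_nhdsWithin_iff.2 ⟨?_, Eventually.of_forall fun s => mem_Ici.2 (abs_nonneg _)⟩
    have : Tendsto (fun s => |s - t|) (𝓝 t) (𝓝 |t - t|) :=
      (by fun_prop : Continuous fun s : ℝ => |s - t|).tendsto t
    rw [sub_self, abs_zero] at this
    exact this.mono_left nhdsWithin_le_nhds
  refine squeeze_zero' (Eventually.of_forall fun s => dist_nonneg) ?_ (h0.comp h1)
  filter_upwards [self_mem_nhdsWithin] with s hs
  exact hbound s t hs ht

/-- The graph of the generator of a contraction semigroup. -/
def generator : Submodule ℝ (X × X) where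
  carrier := {p | Tendsto (fun t : ℝ => t⁻¹ • (T t p.1 - p.1)) (𝓝[>] 0) (𝓝 p.2)}
  add_mem' := by
    intro p q hp hq
    refine (Tendsto.add hp hq).congr' ?_
    filter_upwards [self_mem_nhdsWithin] with t ht
    rw [Prod.fst_add, hT.map_add t (le_of_lt ht), ← smul_add]
    congr 1
    abel
  zero_mem' := by
    refine tendsto_const_nhds.congr' ?_
    filter_upwards [self_mem_nhdsWithin] with t ht
    have h0 : T t 0 = 0 := by
      rw [← hT.toCLM_apply t (le_of_lt ht), _root_.map_zero]
    simp [h0]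
  smul_mem' := by
    intro c p hp
    refine (Tendsto.const_smul hp c).congr' ?_
    filter_upwards [self_mem_nhdsWithin] with t ht
    rw [Prod.smul_fst, hT.map_smul t (le_of_lt ht), ← smul_sub, smul_comm]

theorem mem_generator {p : X × X} :
    p ∈ hT.generator ↔ Tendsto (fun t : ℝ => t⁻¹ • (T t p.1 - p.1)) (𝓝[>] 0) (𝓝 p.2) := Iff.rfl

/-- The sum of two generators of contraction semigroups is dissipative on the intersection of their
domains: `‖(lam + 2/t) x - (T t x + S t x)/t‖ ≥ lam ‖x‖`. -/
theorem norm_le_of_mem_of_mem {S : ℝ → X → X} (hS : IsContractionSemigroup S) {x a b : X}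
    (ha : (x, a) ∈ hT.generator) (hb : (x, b) ∈ hS.generator) {lam : ℝ} (hlam : 0 < lam) :
    lam * ‖x‖ ≤ ‖lam • x - (a + b)‖ := by
  have hlim := ((hT.mem_generator.1 ha).add (hS.mem_generator.1 hb)).const_sub (lam • x)
  refine ge_of_tendsto hlim.norm ?_
  filter_upwards [self_mem_nhdsWithin] with t ht
  have ht0 : (0 : ℝ) < t := ht
  have e : lam • x - (t⁻¹ • (T t x - x) + t⁻¹ • (S t x - x))
      = (lam + 2 * t⁻¹) • x - (t⁻¹ • T t x + t⁻¹ • S t x) := by module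
  rw [e]
  have h1 := norm_sub_norm_le ((lam + 2 * t⁻¹) • x) (t⁻¹ • T t x + t⁻¹ • S t x)
  have h2 := norm_add_le (t⁻¹ • T t x) (t⁻¹ • S t x)
  have hti : 0 < t⁻¹ := inv_pos.2 ht0
  rw [norm_smul, norm_smul, Real.norm_eq_abs, abs_of_pos hti] at h2
  rw [norm_smul, Real.norm_eq_abs, abs_of_pos (by positivity)] at h1
  have h3 := mul_le_mul_of_nonneg_left (hT.norm_le t ht0.le x) hti.le
  have h4 := mul_le_mul_of_nonneg_left (hS.norm_le t ht0.le x) hti.le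
  nlinarith

variable [CompleteSpace X]

omit [CompleteSpace X] in
include hT in
theorem integrableOn_exp_smul {lam : ℝ} (hlam : 0 < lam) (x : X) :
    IntegrableOn (fun t => Real.exp (-lam * t) • T t x) (Ioi 0) := by
  have hc : ContinuousOn (fun t => Real.exp (-lam * t) • T t x) (Ioi 0) :=
    (by fun_prop : Continuous fun t : ℝ => Real.exp (-lam * t)).continuousOn.smul
      ((hT.continuousOn x).mono Ioi_subset_Ici_self)
  refine Integrable.mono' ((exp_neg_integrableOn_Ioi 0 hlam).mul_const ‖x‖)
    (hc.aestronglyMeasurable measurableSet_Ioi) ?_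
  refine (ae_restrict_iff' measurableSet_Ioi).2 (Eventually.of_forall fun t ht => ?_)
  rw [norm_smul, Real.norm_eq_abs, Real.abs_exp]
  exact mul_le_mul_of_nonneg_left (hT.norm_le t (le_of_lt ht) x) (Real.exp_pos _).le

/-- The Laplace transform of a contraction semigroup is the resolvent of its generator. -/
theorem laplace_mem_generator {lam : ℝ} (hlam : 0 < lam) (x : X) :
    (∫ t in Ioi (0 : ℝ), Real.exp (-lam * t) • T t x,
      lam • (∫ t in Ioi (0 : ℝ), Real.exp (-lam * t) • T t x) - x) ∈ hT.generator := by
  set F : ℝ → X := fun t => Real.exp (-lam * t) • T t x with hF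
  set R : X := ∫ t in Ioi (0 : ℝ), F t with hR
  have hFi := hT.integrableOn_exp_smul hlam x
  have hFc : ContinuousOn F (Ici 0) :=
    (by fun_prop : Continuous fun t : ℝ => Real.exp (-lam * t)).continuousOn.smul
      (hT.continuousOn x)
  have hshift : ∀ h, 0 ≤ h → T h R = Real.exp (lam * h) • (R - ∫ t in (0 : ℝ)..h, F t) := by
    intro h hh
    have h1 : R - ∫ t in (0 : ℝ)..h, F t = ∫ t in Ioi h, F t := by
      rw [← intervalIntegral.integral_Ioi_sub_Ioi hFi hh]
      abel
    have h2 : ∫ t in Ioi h, F t = ∫ t in Ioi (0 : ℝ), F (t + h) := by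
      have := (measurePreserving_add_right volume h).setIntegral_preimage_emb
        (measurableEmbedding_addRight h) F (Ioi h)
      rw [← this]
      simp
    rw [h1, h2, ← integral_smul, ← hT.toCLM_apply h hh, hR,
      ← ContinuousLinearMap.integral_comp_comm _ hFi]
    refine setIntegral_congr_fun measurableSet_Ioi fun t ht => ?_
    have ht0 : (0 : ℝ) ≤ t := le_of_lt ht
    simp only [hF, _root_.map_smul, toCLM_apply]
    rw [← hT.add h t hh ht0, smul_smul, ← Real.exp_add, add_comm h t]
    congr 2
    ring
  have hd : HasDerivWithinAt (fun h : ℝ => Real.exp (lam * h) • (R - ∫ t in (0 : ℝ)..h, F t))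
      (lam • R - x) (Ioi 0) 0 := by
    have h1 : HasDerivWithinAt (fun h : ℝ => ∫ t in (0 : ℝ)..h, F t) (F 0) (Ici 0) 0 := by
      refine intervalIntegral.integral_hasDerivWithinAt_right (by simp) ?_ ?_ (t := Ioi 0)
      · exact (hFc.mono Ioi_subset_Ici_self).stronglyMeasurableAtFilter_nhdsWithin
          measurableSet_Ioi 0
      · exact (hFc 0 self_mem_Ici).mono Ioi_subset_Ici_self
    have h2 : HasDerivAt (fun h : ℝ => Real.exp (lam * h)) lam 0 := by
      simpa using ((hasDerivAt_id (0 : ℝ)).const_mul lam).exp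
    have h3 := (h2.hasDerivWithinAt (s := Ici 0)).smul (h1.const_sub R)
    refine (h3.mono Ioi_subset_Ici_self).congr_deriv ?_
    simp [hF, hT.zero]
    abel
  rw [hasDerivWithinAt_iff_tendsto_slope' self_notMem_Ioi] at hd
  refine hd.congr' ?_
  filter_upwards [self_mem_nhdsWithin] with h hh
  simp [slope_def_module, hshift h (le_of_lt hh)]

/-- The generator is dissipative and, by the Laplace transform, onto after a shift: the necessity
part of the Hille–Yosida theorem. -/
theorem isMaxDissipative : IsMaxDissipative hT.generator where
  norm_le := by
    rintro ⟨x, a⟩ hp lam hlam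
    have hid : IsContractionSemigroup (fun (_ : ℝ) (x : X) => x) :=
      ⟨fun _ _ _ _ => rfl, fun _ _ _ _ => rfl, fun _ _ _ => le_rfl, fun _ => rfl,
        fun _ _ _ _ _ => rfl, fun _ => tendsto_const_nhds⟩
    have := hT.norm_le_of_mem_of_mem hid hp (b := 0) (by simp [mem_generator]) hlam
    simpa using this
  exists_mem lam hlam x := ⟨_, hT.laplace_mem_generator hlam x⟩

theorem resolvent_eq {lam : ℝ} (hlam : 0 < lam) (x : X) :
    hT.isMaxDissipative.resolvent lam x = ∫ t in Ioi (0 : ℝ), Real.exp (-lam * t) • T t x :=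
  (hT.isMaxDissipative.resolvent_eq_iff hlam).2 (hT.laplace_mem_generator hlam x)

/-- The domain of the generator contains the averages `∫₀ʰ T s x ds`. -/
theorem dense_domain : Dense (Prod.fst '' (hT.generator : Set (X × X))) := by
  intro x
  have hc := hT.continuousOn x
  have hii : ∀ a b : ℝ, 0 ≤ a → 0 ≤ b → IntervalIntegrable (fun t => T t x) volume a b :=
    fun a b ha hb => (hc.mono fun s hs => (le_min ha hb).trans hs.1).intervalIntegrable
  have h0 : HasDerivWithinAt (fun h : ℝ => ∫ t in (0 : ℝ)..h, T t x) x (Ici 0) 0 := by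
    have := intervalIntegral.integral_hasDerivWithinAt_right (a := 0) (b := 0)
      (f := fun t => T t x) (s := Ici 0) (by simp)
      ((hc.mono Ioi_subset_Ici_self).stronglyMeasurableAtFilter_nhdsWithin measurableSet_Ioi 0)
      ((hc 0 self_mem_Ici).mono Ioi_subset_Ici_self)
    simpa [hT.zero] using this
  have hmem : ∀ h, 0 < h → (∫ t in (0 : ℝ)..h, T t x, T h x - x) ∈ hT.generator := by
    intro h hh
    have h1 : HasDerivAt (fun k : ℝ => ∫ t in (0 : ℝ)..(h + k), T t x) (T h x) 0 := by
      have := hasDerivAt_integral_of_continuousOn_Ici hc hh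
      have h2 := HasDerivAt.comp_const_add (f := fun u => ∫ t in (0 : ℝ)..u, T t x) h 0
        (by simpa using this)
      simpa using h2
    have hd : HasDerivWithinAt (fun k : ℝ => (∫ t in (0 : ℝ)..(h + k), T t x)
        - ∫ t in (0 : ℝ)..k, T t x) (T h x - x) (Ioi 0) 0 :=
      (h1.hasDerivWithinAt.sub h0).mono Ioi_subset_Ici_self
    rw [hasDerivWithinAt_iff_tendsto_slope' self_notMem_Ioi] at hd
    refine hd.congr' ?_
    filter_upwards [self_mem_nhdsWithin] with k hk
    have hk0 : (0 : ℝ) ≤ k := le_of_lt hk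
    have e1 : T k (∫ t in (0 : ℝ)..h, T t x) = ∫ t in k..(h + k), T t x := by
      rw [← hT.toCLM_apply k hk0, ← ContinuousLinearMap.intervalIntegral_comp_comm _
        (hii 0 h le_rfl hh.le)]
      have : ∫ t in k..(h + k), T t x = ∫ t in (0 : ℝ)..h, T (t + k) x := by
        rw [intervalIntegral.integral_comp_add_right (fun t => T t x) k, zero_add]
      rw [this]
      refine intervalIntegral.integral_congr fun t ht => ?_
      rw [uIcc_of_le hh.le] at ht
      simp only [toCLM_apply]
      rw [← hT.add k t hk0 ht.1, add_comm]
    simp only [slope_def_module, sub_zero, add_zero, intervalIntegral.integral_same, e1]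
    rw [← intervalIntegral.integral_add_adjacent_intervals (hii 0 k le_rfl hk0)
      (hii k (h + k) hk0 (by positivity))]
    congr 1
    abel
  have hlim := (hasDerivWithinAt_iff_tendsto_slope' self_notMem_Ioi).1 (h0.mono Ioi_subset_Ici_self)
  refine mem_closure_of_tendsto hlim ?_
  filter_upwards [self_mem_nhdsWithin] with h hh
  refine ⟨_, hT.generator.smul_mem h⁻¹ (hmem h hh), ?_⟩
  simp [slope_def_module]

end IsContractionSemigroup

end Semigroup

/-! ### Perturbation of a generator by a generator -/

section Perturbation

variable {X : Type*} [NormedAddCommGroup X] [NormedSpace ℝ X] [CompleteSpace X]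

theorem integrableOn_rpow_mul_exp {lam : ℝ} (hlam : 0 < lam) (c d : ℝ) :
    IntegrableOn (fun t => Real.exp (-lam * t) * (c * t ^ (-(1 / 2) : ℝ) + d)) (Ioi 0) := by
  have h1 : IntegrableOn (fun t : ℝ => t ^ (-(1 / 2) : ℝ) * Real.exp (-lam * t)) (Ioi 0) := by
    simpa using integrableOn_rpow_mul_exp_neg_mul_rpow (p := 1) (s := -(1 / 2)) (by norm_num)
      one_pos hlam
  have h2 := (h1.const_mul c).add ((exp_neg_integrableOn_Ioi 0 hlam).const_mul d)
  refine h2.congr (Eventually.of_forall fun t => ?_)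
  simp only [Pi.add_apply]
  ring

/-- The Laplace transform of an integrable singularity vanishes at infinity. -/
theorem tendsto_integral_rpow_mul_exp (c d : ℝ) :
    Tendsto (fun lam : ℝ => ∫ t in Ioi (0 : ℝ), Real.exp (-lam * t) * (c * t ^ (-(1 / 2) : ℝ) + d))
      atTop (𝓝 0) := by
  have hval : ∀ lam : ℝ, 0 < lam →
      ∫ t in Ioi (0 : ℝ), Real.exp (-lam * t) * (c * t ^ (-(1 / 2) : ℝ) + d)
        = c * ((lam⁻¹) ^ (1 / 2 : ℝ) * Real.Gamma (1 / 2)) + d * lam⁻¹ := by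
    intro lam hlam
    have e1 := Real.integral_rpow_mul_exp_neg_mul_Ioi (a := 1 / 2) (by norm_num) hlam
    have e2 := Real.integral_rpow_mul_exp_neg_mul_Ioi (a := 1) one_pos hlam
    have i1 : IntegrableOn (fun t : ℝ => t ^ ((1 / 2 : ℝ) - 1) * Real.exp (-(lam * t))) (Ioi 0) := by
      refine (integrableOn_rpow_mul_exp hlam 1 0).congr (Eventually.of_forall fun t => ?_)
      norm_num
      ring
    have i2 : IntegrableOn (fun t : ℝ => t ^ ((1 : ℝ) - 1) * Real.exp (-(lam * t))) (Ioi 0) := by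
      refine (integrableOn_rpow_mul_exp hlam 0 1).congr (Eventually.of_forall fun t => ?_)
      norm_num
    rw [one_div] at e2
    rw [one_div lam] at e1
    rw [Real.Gamma_one, Real.rpow_one, mul_one] at e2
    rw [← e1, ← e2, ← integral_const_mul, ← integral_const_mul,
      ← integral_add (i1.const_mul c) (i2.const_mul d)]
    congr 1 with t
    norm_num
    ring
  have hlim : Tendsto (fun lam : ℝ => c * ((lam⁻¹) ^ (1 / 2 : ℝ) * Real.Gamma (1 / 2)) + d * lam⁻¹)
      atTop (𝓝 (c * (0 * Real.Gamma (1 / 2)) + d * 0)) := by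
    have h0 := tendsto_inv_atTop_zero (𝕜 := ℝ)
    have h1 : Tendsto (fun lam : ℝ => (lam⁻¹) ^ (1 / 2 : ℝ)) atTop (𝓝 0) := by
      have := h0.rpow_const (p := 1 / 2) (Or.inr (by norm_num))
      rwa [Real.zero_rpow (by norm_num)] at this
    exact ((h1.mul_const _).const_mul c).add (h0.const_mul d)
  simp only [zero_mul, mul_zero, add_zero] at hlim
  refine hlim.congr' ?_
  filter_upwards [eventually_gt_atTop 0] with lam hlam
  exact (hval lam hlam).symm

/-- The graph of the sum of two operators, on the intersection of the domains. -/
def sumGraph (A B : Submodule ℝ (X × X)) : Submodule ℝ (X × X) where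
  carrier := {p | ∃ a b : X, (p.1, a) ∈ A ∧ (p.1, b) ∈ B ∧ p.2 = a + b}
  add_mem' := by
    rintro p q ⟨a, b, ha, hb, hp⟩ ⟨a', b', ha', hb', hq⟩
    refine ⟨a + a', b + b', A.add_mem ha ha', B.add_mem hb hb', ?_⟩
    rw [Prod.snd_add, hp, hq]
    abel
  zero_mem' := ⟨0, 0, A.zero_mem, B.zero_mem, by simp⟩
  smul_mem' := by
    rintro c p ⟨a, b, ha, hb, hp⟩
    exact ⟨c • a, c • b, A.smul_mem c ha, B.smul_mem c hb, by rw [Prod.smul_snd, hp, smul_add]⟩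

namespace IsContractionSemigroup

variable {T S : ℝ → X → X} (hT : IsContractionSemigroup T) (hS : IsContractionSemigroup S)

/-- If `B T(t)` is bounded with an integrable singularity at `t = 0`, then `B (lam I - A)⁻¹` is
bounded by the Laplace transform of the singularity. -/
theorem exists_resolvent_mem {c d : ℝ}
    (hrel : ∀ t, 0 < t → ∀ x, ∃ k, (T t x, k) ∈ hS.generator ∧
      ‖k‖ ≤ (c * t ^ (-(1 / 2) : ℝ) + d) * ‖x‖) {lam : ℝ} (hlam : 0 < lam) (x : X) :
    ∃ b, (hT.isMaxDissipative.resolvent lam x, b) ∈ hS.generator ∧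
      ‖b‖ ≤ (∫ t in Ioi (0 : ℝ), Real.exp (-lam * t) * (c * t ^ (-(1 / 2) : ℝ) + d)) * ‖x‖ := by
  have hex : ∀ t, ∃ k, 0 < t → (T t x, k) ∈ hS.generator ∧
      ‖k‖ ≤ (c * t ^ (-(1 / 2) : ℝ) + d) * ‖x‖ := by
    intro t
    by_cases ht : 0 < t
    · obtain ⟨k, hk⟩ := hrel t ht x
      exact ⟨k, fun _ => hk⟩
    · exact ⟨0, fun h => absurd h ht⟩
  choose k hk using hex
  -- `k` is a pointwise limit of continuous curves
  have hmeas : AEStronglyMeasurable k (volume.restrict (Ioi 0)) := by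
    have hn : Tendsto (fun n : ℕ => 1 / ((n : ℝ) + 1)) atTop (𝓝[>] 0) :=
      tendsto_nhdsWithin_iff.2 ⟨tendsto_one_div_add_atTop_nhds_zero_nat,
        Eventually.of_forall fun n => mem_Ioi.2 (by positivity)⟩
    refine aestronglyMeasurable_of_tendsto_ae atTop (f := fun (n : ℕ) t =>
      (1 / ((n : ℝ) + 1))⁻¹ • (S (1 / ((n : ℝ) + 1)) (T t x) - T t x)) (fun n => ?_) ?_
    · have hpos : (0 : ℝ) ≤ 1 / ((n : ℝ) + 1) := by positivity
      have hc : ContinuousOn (fun t => T t x) (Ioi 0) :=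
        (hT.continuousOn x).mono Ioi_subset_Ici_self
      have h1 := (hS.toCLM _ hpos).continuous.comp_continuousOn hc
      exact ((h1.sub hc).const_smul _).aestronglyMeasurable measurableSet_Ioi
    · refine (ae_restrict_iff' measurableSet_Ioi).2 (Eventually.of_forall fun t ht => ?_)
      exact (hS.mem_generator.1 (hk t ht).1).comp hn
  have hle : ∀ t ∈ Ioi (0 : ℝ), ‖Real.exp (-lam * t) • k t‖
      ≤ Real.exp (-lam * t) * (c * t ^ (-(1 / 2) : ℝ) + d) * ‖x‖ := by
    intro t ht
    rw [norm_smul, Real.norm_eq_abs, Real.abs_exp, mul_assoc]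
    exact mul_le_mul_of_nonneg_left (hk t ht).2 (Real.exp_pos _).le
  have hbi := (integrableOn_rpow_mul_exp hlam c d).mul_const ‖x‖
  have hki : IntegrableOn (fun t => Real.exp (-lam * t) • k t) (Ioi 0) :=
    Integrable.mono' hbi ((by fun_prop : Continuous fun t : ℝ =>
      Real.exp (-lam * t)).aestronglyMeasurable.smul hmeas)
      ((ae_restrict_iff' measurableSet_Ioi).2 (Eventually.of_forall hle))
  refine ⟨∫ t in Ioi (0 : ℝ), Real.exp (-lam * t) • k t, ?_, ?_⟩
  · -- the resolvent of `B`, a bounded operator, encodes membership in the closed graph of `B`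
    have hTi := hT.integrableOn_exp_smul hlam x
    rw [hS.isMaxDissipative.mem_iff, hT.resolvent_eq hlam]
    simp only
    rw [← integral_sub hTi hki]
    refine (ContinuousLinearMap.integral_comp_comm (hS.isMaxDissipative.resolvent 1)
      (hTi.sub hki)).symm.trans ?_
    refine setIntegral_congr_fun measurableSet_Ioi fun t ht => ?_
    have := hS.isMaxDissipative.mem_iff.1 (hk t ht).1
    simp only [Pi.sub_apply] at this ⊢
    rw [← smul_sub, _root_.map_smul, this]
  · rw [← integral_mul_const]
    exact norm_integral_le_of_norm_le hbi
      ((ae_restrict_iff' measurableSet_Ioi).2 (Eventually.of_forall hle))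

/-- Relatively bounded perturbation: if `B T(t)` has an integrable singularity at `t = 0`, then the
sum of the generators, on the intersection of their domains, is maximal dissipative. -/
theorem isMaxDissipative_sumGraph {c d : ℝ}
    (hrel : ∀ t, 0 < t → ∀ x, ∃ k, (T t x, k) ∈ hS.generator ∧
      ‖k‖ ≤ (c * t ^ (-(1 / 2) : ℝ) + d) * ‖x‖) :
    IsMaxDissipative (sumGraph hT.generator hS.generator) := by
  refine IsMaxDissipative.of_eventually ?_ ?_
  · rintro ⟨x, y⟩ ⟨a, b, ha, hb, hy⟩ lam hlam
    simp only at hy ha hb ⊢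
    rw [hy]
    exact hT.norm_le_of_mem_of_mem hS ha hb hlam
  · filter_upwards [eventually_gt_atTop 0,
      (tendsto_integral_rpow_mul_exp c d).eventually (gt_mem_nhds one_pos)] with lam hlam hq f
    set q := ∫ t in Ioi (0 : ℝ), Real.exp (-lam * t) * (c * t ^ (-(1 / 2) : ℝ) + d) with hqdef
    choose K hK using fun x => hT.exists_resolvent_mem hS hrel hlam x
    have huniq : ∀ {x a b : X}, (x, a) ∈ hS.generator → (x, b) ∈ hS.generator → a = b :=
      fun ha hb => tendsto_nhds_unique ha hb
    let L : X →L[ℝ] X := LinearMap.mkContinuous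
      { toFun := K
        map_add' := fun x y => huniq (hK (x + y)).1 (by
          have := hS.generator.add_mem (hK x).1 (hK y).1
          rwa [Prod.mk_add_mk, ← _root_.map_add] at this)
        map_smul' := fun r x => huniq (hK (r • x)).1 (by
          have := hS.generator.smul_mem r (hK x).1
          rwa [Prod.smul_mk, ← _root_.map_smul] at this) } q fun x => (hK x).2
    have hL : ‖L‖ < 1 := by
      have h1 : ‖L‖ ≤ max q 0 := LinearMap.mkContinuous_norm_le' _ _
      exact lt_of_le_of_lt h1 (max_lt hq one_pos)
    -- `(lam I - A - B) (lam I - A)⁻¹ = I - L`, where `L = B (lam I - A)⁻¹`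
    set U := Units.oneSub L hL
    set g := (↑U⁻¹ : X →L[ℝ] X) f with hg
    have h1 : g - K g = f := by
      have : ((U : X →L[ℝ] X) * (↑U⁻¹ : X →L[ℝ] X)) f = f := by simp
      have h2 : g - L g = f := by simpa [U] using this
      exact h2
    refine ⟨hT.isMaxDissipative.resolvent lam g, _, _,
      hT.isMaxDissipative.resolvent_mem hlam g, (hK g).1, ?_⟩
    simp only
    rw [← h1]
    abel

theorem dense_domain_sumGraph {c d : ℝ}
    (hrel : ∀ t, 0 < t → ∀ x, ∃ k, (T t x, k) ∈ hS.generator ∧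
      ‖k‖ ≤ (c * t ^ (-(1 / 2) : ℝ) + d) * ‖x‖) :
    Dense (Prod.fst '' (sumGraph hT.generator hS.generator : Set (X × X))) := by
  refine hT.dense_domain.mono ?_
  rintro _ ⟨p, hp, rfl⟩
  obtain ⟨b, hb, -⟩ := hT.exists_resolvent_mem hS hrel one_pos ((1 : ℝ) • p.1 - p.2)
  rw [hT.isMaxDissipative.resolvent_apply one_pos hp] at hb
  exact ⟨(p.1, p.2 + b), ⟨p.2, b, hp, hb, rfl⟩, rfl⟩

end IsContractionSemigroup

end Perturbation

/-! ### The flow of an admissible speed field -/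

theorem norm_le_of_single_le (L : Plane →L[ℝ] Plane) {m0 m1 : ℝ}
    (h0 : ‖L (EuclideanSpace.single 0 1)‖ ≤ m0) (h1 : ‖L (EuclideanSpace.single 1 1)‖ ≤ m1) :
    ‖L‖ ≤ m0 + m1 := by
  have hm0 : 0 ≤ m0 := (norm_nonneg _).trans h0
  have hm1 : 0 ≤ m1 := (norm_nonneg _).trans h1
  refine ContinuousLinearMap.opNorm_le_bound _ (by positivity) fun v => ?_
  have hv : v = v 0 • EuclideanSpace.single (0 : Fin 2) (1 : ℝ)
      + v 1 • EuclideanSpace.single (1 : Fin 2) (1 : ℝ) := by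
    ext i
    fin_cases i <;> simp
  have e0 : ‖v 0‖ ≤ ‖v‖ := PiLp.norm_apply_le v 0
  have e1 : ‖v 1‖ ≤ ‖v‖ := PiLp.norm_apply_le v 1
  conv_lhs => rw [hv]
  rw [map_add, map_smul, map_smul]
  calc _ ≤ _ := norm_add_le _ _
    _ ≤ ‖v‖ * m0 + ‖v‖ * m1 := by
        rw [norm_smul, norm_smul]
        gcongr
    _ = _ := by ring

namespace IsAdmissibleSpeed

variable {C : Plane → Plane} (hC : IsAdmissibleSpeed C)
include hC

theorem hasFDerivAt (x : Plane) : HasFDerivAt C (fderiv ℝ C x) x :=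
  (hC.contDiff.differentiable (by norm_num) x).hasFDerivAt

theorem continuous : Continuous C := hC.contDiff.continuous

theorem uniformContinuous_fderiv : UniformContinuous (fderiv ℝ C) := by
  rw [Metric.uniformContinuous_iff]
  intro e he
  obtain ⟨d0, hd0, h0⟩ := Metric.uniformContinuous_iff.1 (hC.partialDeriv_uniformContinuous 0)
    (e / 3) (by positivity)
  obtain ⟨d1, hd1, h1⟩ := Metric.uniformContinuous_iff.1 (hC.partialDeriv_uniformContinuous 1)
    (e / 3) (by positivity)
  refine ⟨min d0 d1, lt_min hd0 hd1, fun x y hxy => ?_⟩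
  have a0 := h0 (hxy.trans_le (min_le_left _ _))
  have a1 := h1 (hxy.trans_le (min_le_right _ _))
  rw [dist_eq_norm] at a0 a1 ⊢
  have := norm_le_of_single_le (fderiv ℝ C x - fderiv ℝ C y) (m0 := e / 3) (m1 := e / 3)
    (by simpa [partialDeriv] using a0.le) (by simpa [partialDeriv] using a1.le)
  linarith

theorem continuous_divergence : Continuous (divergence C) := by
  have h : ∀ i : Fin 2, Continuous fun x => partialDeriv C i x i := fun i => by
    have := (hC.partialDeriv_uniformContinuous i).continuous
    fun_prop
  exact continuous_finsetSum _ fun i _ => h i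

theorem exists_abs_divergence_le : ∃ M : ℝ, 0 ≤ M ∧ ∀ x, |divergence C x| ≤ M := by
  choose M hM using hC.partialDeriv_bounded
  have hM0 : ∀ i, 0 ≤ M i := fun i => (norm_nonneg _).trans (hM i 0)
  refine ⟨∑ i, M i, Finset.sum_nonneg fun i _ => hM0 i, fun x => ?_⟩
  refine (Finset.abs_sum_le_sum_abs _ _).trans (Finset.sum_le_sum fun i _ => ?_)
  exact (PiLp.norm_apply_le (partialDeriv C i x) i).trans (hM i x)

theorem neg : IsAdmissibleSpeed (fun x => -C x) := by
  have h : ∀ i x, partialDeriv (fun x => -C x) i x = -partialDeriv C i x := by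
    intro i x
    simp [partialDeriv, fderiv_fun_neg]
  refine ⟨?_, hC.uniformContinuous.neg, hC.contDiff.neg, fun i => ?_, fun i => ?_⟩
  · simpa using hC.bounded
  · simpa [h] using hC.partialDeriv_bounded i
  · simpa [funext (h i)] using (hC.partialDeriv_uniformContinuous i).neg

/-- The flow of `-C` is the flow of `C` run backwards. -/
theorem flow_neg (t : ℝ) (z : Plane) : flow (fun x => -C x) t z = flow C (-t) z := by
  refine (IsTrajectory.eq_flow hC.neg (γ := fun t => flow C (-t) z) ⟨?_, fun s => ?_⟩ t).symm
  · simpa using (flow_isTrajectory hC z).1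
  · simpa [Function.comp_def] using
      ((flow_isTrajectory hC z).2 (-s)).scomp s (hasDerivAt_neg s)

theorem flow_zero (z : Plane) : flow C 0 z = z := (flow_isTrajectory hC z).1

theorem hasDerivAt_flow (z : Plane) (t : ℝ) :
    HasDerivAt (fun t => flow C t z) (C (flow C t z)) t := (flow_isTrajectory hC z).2 t

theorem flow_add (s t : ℝ) (z : Plane) : flow C (t + s) z = flow C t (flow C s z) := by
  refine IsTrajectory.eq_flow hC (γ := fun t => flow C (t + s) z) ⟨by simp, fun r => ?_⟩ t
  exact HasDerivAt.comp_add_const r s (hC.hasDerivAt_flow z (r + s))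

theorem flow_neg_flow (t : ℝ) (z : Plane) : flow C (-t) (flow C t z) = z := by
  rw [← hC.flow_add, neg_add_cancel, hC.flow_zero]

theorem dist_flow_le_of_nonneg {K : NNReal} (hK : LipschitzWith K C) {t : ℝ} (ht : 0 ≤ t)
    (x z : Plane) : dist (flow C t x) (flow C t z) ≤ dist x z * Real.exp (K * t) := by
  have hc : ∀ x, Continuous fun t => flow C t x := fun x =>
    continuous_iff_continuousAt.2 fun t => (hC.hasDerivAt_flow x t).continuousAt
  have := dist_le_of_trajectories_ODE (v := fun _ => C) (f := fun t => flow C t x)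
    (g := fun t => flow C t z) (a := 0) (b := t) (δ := dist x z) (fun _ => hK)
    (hc x).continuousOn (fun s _ => (hC.hasDerivAt_flow x s).hasDerivWithinAt)
    (hc z).continuousOn (fun s _ => (hC.hasDerivAt_flow z s).hasDerivWithinAt)
    (by simp [hC.flow_zero]) t (right_mem_Icc.2 ht)
  simpa using this

theorem dist_flow_le {K : NNReal} (hK : LipschitzWith K C) (t : ℝ) (x z : Plane) :
    dist (flow C t x) (flow C t z) ≤ dist x z * Real.exp (K * |t|) := by
  rcases le_total 0 t with ht | ht
  · rw [abs_of_nonneg ht]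
    exact hC.dist_flow_le_of_nonneg hK ht x z
  · rw [abs_of_nonpos ht]
    have := hC.neg.dist_flow_le_of_nonneg (K := K) hK.neg (neg_nonneg.2 ht) x z
    simpa [hC.flow_neg] using this

theorem dist_flow_flow_le {M : ℝ} (hM : ∀ x, ‖C x‖ ≤ M) (s t : ℝ) (x : Plane) :
    dist (flow C s x) (flow C t x) ≤ M * |s - t| := by
  rw [dist_eq_norm]
  exact Convex.norm_image_sub_le_of_norm_hasDerivWithin_le (s := univ)
    (fun r _ => (hC.hasDerivAt_flow x r).hasDerivWithinAt) (fun r _ => hM _) convex_univ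
    (mem_univ t) (mem_univ s)

theorem continuous_flow : Continuous fun p : ℝ × Plane => flow C p.1 p.2 := by
  obtain ⟨K, hK⟩ := hC.exists_lipschitzWith
  obtain ⟨M, hM⟩ := hC.bounded
  refine continuous_iff_continuousAt.2 fun ⟨t, x⟩ => ?_
  rw [ContinuousAt, tendsto_iff_dist_tendsto_zero]
  have hlim : Tendsto (fun p : ℝ × Plane => dist p.2 x * Real.exp (K * |p.1|) + M * |p.1 - t|)
      (𝓝 (t, x)) (𝓝 (dist x x * Real.exp (K * |t|) + M * |t - t|)) :=
    (by fun_prop : Continuous fun p : ℝ × Plane =>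
      dist p.2 x * Real.exp (K * |p.1|) + M * |p.1 - t|).tendsto (t, x)
  simp only [dist_self, sub_self, abs_zero, zero_mul, mul_zero, add_zero] at hlim
  refine squeeze_zero (fun _ => dist_nonneg) (fun p => ?_) hlim
  exact (dist_triangle _ (flow C p.1 x) _).trans
    (add_le_add (hC.dist_flow_le hK _ _ _) (hC.dist_flow_flow_le hM _ _ _))

end IsAdmissibleSpeed

/-- Liouville's formula in the plane: the determinant of a solution of `M' = D M`, `M(0) = I`, is the
exponential of the integral of the trace of `D`. -/
theorem det_eq_exp_integral_trace {D M : ℝ → Plane →L[ℝ] Plane} {a : ℝ} (hD : Continuous D)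
    (hM0 : M 0 = 1) (hM : ∀ t ∈ Icc 0 a, HasDerivWithinAt M (D t * M t) (Icc 0 a) t) {t : ℝ}
    (ht : t ∈ Icc 0 a) :
    (M t).det = Real.exp (∫ s in (0 : ℝ)..t, ∑ i : Fin 2, D s (EuclideanSpace.single i 1) i) := by
  set e : Fin 2 → Plane := fun i => EuclideanSpace.single i 1 with he
  set tr : ℝ → ℝ := fun s => ∑ i : Fin 2, D s (e i) i with htr
  have hdet : ∀ L : Plane →L[ℝ] Plane, L.det = L (e 0) 0 * L (e 1) 1 - L (e 1) 0 * L (e 0) 1 := by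
    intro L
    rw [ContinuousLinearMap.det, ← LinearMap.det_toMatrix (EuclideanSpace.basisFun (Fin 2) ℝ).toBasis,
      Matrix.det_fin_two]
    simp [LinearMap.toMatrix_apply, he]
  have hentry : ∀ i j : Fin 2, ∀ s ∈ Icc 0 a, HasDerivWithinAt (fun s => M s (e j) i)
      (D s (e 0) i * M s (e j) 0 + D s (e 1) i * M s (e j) 1) (Icc 0 a) s := by
    intro i j s hs
    have h1 := ((EuclideanSpace.proj (𝕜 := ℝ) i).comp
      (ContinuousLinearMap.apply ℝ Plane (e j))).hasFDerivAt.comp_hasDerivWithinAt s (hM s hs)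
    refine h1.congr_deriv ?_
    have hv : M s (e j) = M s (e j) 0 • e 0 + M s (e j) 1 • e 1 := by
      ext k
      fin_cases k <;> simp [he]
    change D s (M s (e j)) i = _
    conv_lhs => rw [hv]
    simp
    ring
  have htrc : Continuous tr := by
    refine continuous_finsetSum _ fun i _ => ?_
    exact (((EuclideanSpace.proj (𝕜 := ℝ) i).comp
      (ContinuousLinearMap.apply ℝ Plane (e i))).continuous.comp hD)
  have hI : ∀ s, HasDerivAt (fun s => Real.exp (-∫ r in (0 : ℝ)..s, tr r))
      (Real.exp (-∫ r in (0 : ℝ)..s, tr r) * -tr s) s := fun s =>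
    (intervalIntegral.integral_hasDerivAt_right (htrc.intervalIntegrable _ _)
      htrc.aestronglyMeasurable.stronglyMeasurableAtFilter htrc.continuousAt).neg.exp
  have hq : ∀ s ∈ Icc 0 a, HasDerivWithinAt
      (fun s => (M s).det * Real.exp (-∫ r in (0 : ℝ)..s, tr r)) 0 (Icc 0 a) s := by
    intro s hs
    simp only [hdet]
    have h1 := ((((hentry 0 0 s hs).mul (hentry 1 1 s hs)).sub
      ((hentry 0 1 s hs).mul (hentry 1 0 s hs))).mul ((hI s).hasDerivWithinAt (s := Icc 0 a)))
    refine h1.congr_deriv ?_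
    simp only [htr, Fin.sum_univ_two, Pi.mul_apply, Pi.sub_apply]
    ring
  have hconst := constant_of_has_deriv_right_zero (fun s hs => (hq s hs).continuousWithinAt)
    (fun s hs => ((hq s (Ico_subset_Icc_self hs)).mono_of_mem_nhdsWithin
      (Icc_mem_nhdsGE_of_mem hs))) t ht
  have h0 : (M 0).det = 1 := by
    rw [hM0]
    simp [hdet, he]
  simp only [h0, intervalIntegral.integral_same, neg_zero, Real.exp_zero, mul_one] at hconst
  rw [Real.exp_neg, mul_inv_eq_one₀ (Real.exp_pos _).ne'] at hconst
  exact hconst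

namespace IsAdmissibleSpeed

variable {C : Plane → Plane} (hC : IsAdmissibleSpeed C)
include hC

/-- For short times the flow is differentiable in the initial point; its derivative solves the
variational equation, so its determinant is given by Liouville's formula. -/
theorem exists_hasFDerivAt_flow : ∃ a : ℝ, 0 < a ∧ ∀ t ∈ Icc 0 a, ∀ x, ∃ L : Plane →L[ℝ] Plane,
    HasFDerivAt (flow C t) L x ∧
      L.det = Real.exp (∫ s in (0 : ℝ)..t, divergence C (flow C s x)) := by
  obtain ⟨K, hK⟩ := hC.exists_lipschitzWith
  have hDK : ∀ x, ‖fderiv ℝ C x‖ ≤ K := fun x => norm_fderiv_le_of_lipschitz ℝ hK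
  -- so short that the variational equation stays in the unit ball around the identity
  set a : ℝ := 1 / (2 * (K + 1)) with ha
  have ha0 : 0 < a := by positivity
  refine ⟨a, ha0, fun t ht x => ?_⟩
  set D : ℝ → Plane →L[ℝ] Plane := fun s => fderiv ℝ C (flow C s x) with hD
  have hflowc : ∀ x, Continuous fun s => flow C s x := fun x =>
    hC.continuous_flow.comp (by fun_prop : Continuous fun s : ℝ => (s, x))
  have hDc : Continuous D := hC.uniformContinuous_fderiv.continuous.comp (hflowc x)
  have hpl : IsPicardLindelof (fun s (M : Plane →L[ℝ] Plane) => D s * M) (tmin := 0) (tmax := a)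
      ⟨0, left_mem_Icc.2 ha0.le⟩ 1 1 0 (2 * K) K :=
    { lipschitzOnWith := fun s _ => (LipschitzWith.of_dist_le_mul fun M N => by
        rw [dist_eq_norm, dist_eq_norm, ← mul_sub]
        exact (norm_mul_le _ _).trans
          (mul_le_mul_of_nonneg_right (hDK _) (norm_nonneg _))).lipschitzOnWith
      continuousOn := fun M _ => (hDc.mul continuous_const).continuousOn
      norm_le := fun s _ M hM => by
        have h1 : ‖M‖ ≤ 2 := by
          have h2 : ‖M - 1‖ ≤ 1 := by simpa [dist_eq_norm] using hM
          have h3 : ‖(1 : Plane →L[ℝ] Plane)‖ ≤ 1 := ContinuousLinearMap.norm_id_le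
          have h4 := norm_add_le (M - 1) 1
          rw [sub_add_cancel] at h4
          linarith
        calc _ ≤ ‖D s‖ * ‖M‖ := norm_mul_le _ _
          _ ≤ K * 2 := mul_le_mul (hDK _) h1 (norm_nonneg _) K.2
          _ = _ := by push_cast; ring
      mul_max_le := by
        simp only [sub_zero, NNReal.coe_mul, NNReal.coe_ofNat, NNReal.coe_one,
          NNReal.coe_zero, sub_self, max_eq_left ha0.le]
        rw [ha, mul_one_div, div_le_one (by positivity)]
        linarith }
  obtain ⟨M, hM0, hM⟩ := hpl.exists_eq_forall_mem_Icc_hasDerivWithinAt₀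
  refine ⟨M t, ?_, det_eq_exp_integral_trace hDc hM0 hM ht⟩
  rw [hasFDerivAt_iff_isLittleO_nhds_zero, Asymptotics.isLittleO_iff]
  intro e he
  set B : ℝ := Real.exp (K * a) with hB
  have hB0 : 0 < B := Real.exp_pos _
  -- by Grönwall, an error `η ‖C'(X)‖` of linearisation is amplified by at most `B * (B * a)`
  set eta : ℝ := e / (B * (B * a)) with heta
  have heta0 : 0 < eta := by positivity
  obtain ⟨d, hd, hd'⟩ := Metric.uniformContinuous_iff.1 hC.uniformContinuous_fderiv eta heta0
  filter_upwards [Metric.ball_mem_nhds (0 : Plane) (div_pos hd hB0)] with h hh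
  rw [mem_ball_zero_iff, lt_div_iff₀ hB0] at hh
  have hclose : ∀ s ∈ Icc 0 a, ‖flow C s (x + h) - flow C s x‖ ≤ ‖h‖ * B := by
    intro s hs
    have := hC.dist_flow_le_of_nonneg hK hs.1 (x + h) x
    rw [dist_eq_norm, dist_eq_norm, add_sub_cancel_left] at this
    refine this.trans ?_
    rw [hB]
    gcongr
    exact hs.2
  set r : ℝ → Plane := fun s => flow C s (x + h) - flow C s x - M s h with hr
  have hrd : ∀ s ∈ Icc 0 a, HasDerivWithinAt r
      (C (flow C s (x + h)) - C (flow C s x) - D s (M s h)) (Icc 0 a) s := fun s hs =>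
    ((hC.hasDerivAt_flow (x + h) s).hasDerivWithinAt.sub
      (hC.hasDerivAt_flow x s).hasDerivWithinAt).sub
      ((ContinuousLinearMap.apply ℝ Plane h).hasFDerivAt.comp_hasDerivWithinAt s (hM s hs))
  have key := norm_le_gronwallBound_of_norm_deriv_right_le (f := r)
    (f' := fun s => C (flow C s (x + h)) - C (flow C s x) - D s (M s h)) (a := 0) (b := a)
    (δ := 0) (K := K) (ε := eta * (‖h‖ * B)) (fun s hs => (hrd s hs).continuousWithinAt)
    (fun s hs => (hrd s (Ico_subset_Icc_self hs)).mono_of_mem_nhdsWithin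
      (Icc_mem_nhdsGE_of_mem hs)) ?_ ?_ t ht
  · refine key.trans ?_
    have h1 : gronwallBound 0 K (eta * (‖h‖ * B)) (t - 0) ≤ eta * (‖h‖ * B) * (a * B) := by
      rcases eq_or_ne (K : ℝ) 0 with hK0 | hK0
      · rw [hK0, gronwallBound_K0]
        simp only [zero_add, sub_zero]
        have hB1 : 1 ≤ B := Real.one_le_exp (by positivity)
        gcongr
        nlinarith [ht.2, ht.1]
      · rw [gronwallBound_of_K_ne_0 hK0]
        have hKpos : (0 : ℝ) < K := lt_of_le_of_ne K.2 (Ne.symm hK0)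
        simp only [zero_mul, zero_add, sub_zero]
        rw [div_mul_eq_mul_div, mul_div_assoc]
        refine mul_le_mul_of_nonneg_left ?_ (by positivity)
        rw [div_le_iff₀ hKpos]
        -- `exp u - 1 ≤ u exp u`
        have h2 := Real.add_one_le_exp (-(K * a))
        have h3 : Real.exp (K * t) ≤ B := Real.exp_le_exp.2 (by gcongr; exact ht.2)
        have h4 : B * Real.exp (-(K * a)) = 1 := by rw [hB, ← Real.exp_add]; simp
        nlinarith
    refine h1.trans (le_of_eq ?_)
    rw [heta]
    field_simp
  · simp [hr, hC.flow_zero, hM0]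
  · intro s hs
    have hs' := Ico_subset_Icc_self hs
    have hlin : ‖C (flow C s (x + h)) - C (flow C s x) - D s (flow C s (x + h) - flow C s x)‖
        ≤ eta * ‖flow C s (x + h) - flow C s x‖ := by
      refine (convex_ball (flow C s x) d).norm_image_sub_le_of_norm_hasFDerivWithin_le'
        (f' := fderiv ℝ C) (fun w _ => (hC.hasFDerivAt w).hasFDerivWithinAt) (fun w hw => ?_)
        (Metric.mem_ball_self hd) ?_
      · rw [← dist_eq_norm]
        exact (hd' hw).le
      · rw [Metric.mem_ball, dist_eq_norm]
        exact (hclose s hs').trans_lt hh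
    have e1 : C (flow C s (x + h)) - C (flow C s x) - D s (M s h)
        = D s (r s) + (C (flow C s (x + h)) - C (flow C s x)
          - D s (flow C s (x + h) - flow C s x)) := by
      simp only [hr, map_sub]
      abel
    rw [e1]
    refine (norm_add_le _ _).trans (add_le_add ?_ ?_)
    · exact ((D s).le_opNorm _).trans (mul_le_mul_of_nonneg_right (hDK _) (norm_nonneg _))
    · exact hlin.trans (mul_le_mul_of_nonneg_left (hclose s hs') heta0.le)

end IsAdmissibleSpeed

/-! ### Integrable functions and their classes in `L¹(ℝ²)` -/

theorem toL1_eq {f : Plane → ℝ} (hf : Integrable f) : toL1 f = hf.toL1 f := by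
  rw [toL1, dif_pos hf]

theorem coeFn_toL1 {f : Plane → ℝ} (hf : Integrable f) : toL1 f =ᵐ[volume] f := by
  rw [toL1_eq hf]
  exact hf.coeFn_toL1

theorem toL1_congr {f g : Plane → ℝ} (hf : Integrable f) (h : f =ᵐ[volume] g) :
    toL1 f = toL1 g := by
  rw [toL1_eq hf, toL1_eq (hf.congr h)]
  exact (Integrable.toL1_eq_toL1_iff _ _ _ _).2 h

theorem toL1_coeFn (v : L1) : toL1 v = v := by
  rw [toL1_eq (L1.integrable_coeFn v), Integrable.toL1_coeFn]

theorem toL1_add {f g : Plane → ℝ} (hf : Integrable f) (hg : Integrable g) :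
    toL1 (fun x => f x + g x) = toL1 f + toL1 g := by
  rw [toL1_eq hf, toL1_eq hg]
  exact toL1_eq (hf.add hg)

theorem toL1_smul {f : Plane → ℝ} (hf : Integrable f) (c : ℝ) :
    toL1 (fun x => c * f x) = c • toL1 f := by
  rw [toL1_eq hf, toL1_eq (hf.const_mul c)]
  exact Integrable.toL1_smul f hf c

theorem toL1_sub {f g : Plane → ℝ} (hf : Integrable f) (hg : Integrable g) :
    toL1 (fun x => f x - g x) = toL1 f - toL1 g := by
  rw [toL1_eq hf, toL1_eq hg]
  exact toL1_eq (hf.sub hg)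

theorem norm_toL1 {f : Plane → ℝ} (hf : Integrable f) : ‖toL1 f‖ = ∫ x, ‖f x‖ := by
  rw [toL1_eq hf, L1.norm_eq_integral_norm]
  exact integral_congr_ae (hf.coeFn_toL1.fun_comp norm)

theorem enorm_toL1 {f : Plane → ℝ} (hf : Integrable f) : ‖toL1 f‖ₑ = ∫⁻ x, ‖f x‖ₑ := by
  rw [toL1_eq hf, Integrable.enorm_toL1]

theorem norm_toL1_sub {f g : Plane → ℝ} (hf : Integrable f) (hg : Integrable g) :
    ‖toL1 f - toL1 g‖ = ∫ x, ‖f x - g x‖ := by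
  rw [← toL1_sub hf hg]
  exact norm_toL1 (hf.sub hg)

theorem enorm_toL1_sub {f g : Plane → ℝ} (hf : Integrable f) (hg : Integrable g) :
    ‖toL1 f - toL1 g‖ₑ = ∫⁻ x, ‖f x - g x‖ₑ := by
  rw [← toL1_sub hf hg]
  exact enorm_toL1 (hf.sub hg)

theorem mass_toL1 {f : Plane → ℝ} (hf : Integrable f) : mass (toL1 f) = ∫ x, f x :=
  integral_congr_ae (coeFn_toL1 hf)

/-! ### The convection semigroup -/

/-- The Jacobian determinant of the backward flow `x ↦ Π(-t)x`, see `lintegral_jacobian_mul`. -/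
noncomputable def jacobian (C : Plane → Plane) (t : ℝ) (x : Plane) : ℝ :=
  Real.exp (-∫ s in (0 : ℝ)..t, divergence C (flow C (-s) x))

/-- The function transported by the flow for the time `t`, with its mass preserved. -/
noncomputable def transport (C : Plane → Plane) (t : ℝ) (v : Plane → ℝ) (x : Plane) : ℝ :=
  jacobian C t x * v (flow C (-t) x)

theorem jacobian_pos (C : Plane → Plane) (t : ℝ) (x : Plane) : 0 < jacobian C t x := Real.exp_pos _

namespace IsAdmissibleSpeed

variable {C : Plane → Plane} (hC : IsAdmissibleSpeed C)
include hC

theorem continuous_divergence_flow_neg :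
    Continuous fun p : Plane × ℝ => divergence C (flow C (-p.2) p.1) :=
  hC.continuous_divergence.comp (hC.continuous_flow.comp (by fun_prop : Continuous
    fun p : Plane × ℝ => (-p.2, p.1)))

theorem continuous_jacobian : Continuous fun p : ℝ × Plane => jacobian C p.1 p.2 := by
  refine (Continuous.neg ?_).rexp
  refine intervalIntegral.continuous_parametric_intervalIntegral_of_continuous
    (f := fun (p : ℝ × Plane) s => divergence C (flow C (-s) p.2)) ?_ continuous_fst
  exact hC.continuous_divergence_flow_neg.comp (by fun_prop : Continuous
    fun q : (ℝ × Plane) × ℝ => (q.1.2, q.2))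

theorem jacobian_add (s t : ℝ) (x : Plane) :
    jacobian C (s + t) x = jacobian C s x * jacobian C t (flow C (-s) x) := by
  have hc : ∀ z, Continuous fun r => divergence C (flow C (-r) z) := fun z =>
    hC.continuous_divergence_flow_neg.comp (by fun_prop : Continuous fun r : ℝ => (z, r))
  rw [jacobian, jacobian, jacobian, ← Real.exp_add, ← neg_add]
  congr 2
  rw [← intervalIntegral.integral_add_adjacent_intervals ((hc x).intervalIntegrable 0 s)
    ((hc x).intervalIntegrable s (s + t))]
  congr 1
  have := intervalIntegral.integral_comp_add_right (a := 0) (b := t)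
    (fun r => divergence C (flow C (-r) x)) s
  rw [zero_add, add_comm t s] at this
  rw [← this]
  refine intervalIntegral.integral_congr fun r _ => ?_
  rw [neg_add, hC.flow_add]

omit hC in
theorem jacobian_zero (x : Plane) : jacobian C 0 x = 1 := by simp [jacobian]

theorem transport_zero (v : Plane → ℝ) : transport C 0 v = v := by
  ext x
  simp [transport, jacobian_zero, hC.flow_zero]

theorem transport_add (s t : ℝ) (v : Plane → ℝ) :
    transport C (s + t) v = transport C s (transport C t v) := by
  ext x
  rw [transport, transport, transport, hC.jacobian_add, mul_assoc, ← hC.flow_add, add_comm s t,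
    neg_add]

/-- Change of variables along the backward flow. For short times this is the transformation formula
with Liouville's determinant; longer times are divided into short ones. -/
theorem lintegral_jacobian_mul {t : ℝ} (ht : 0 ≤ t) (g : Plane → ENNReal) :
    ∫⁻ x, ENNReal.ofReal (jacobian C t x) * g (flow C (-t) x) = ∫⁻ x, g x := by
  obtain ⟨a, ha, hflow⟩ := hC.neg.exists_hasFDerivAt_flow
  have hsmall : ∀ t ∈ Icc 0 a, ∀ g : Plane → ENNReal,
      ∫⁻ x, ENNReal.ofReal (jacobian C t x) * g (flow C (-t) x) = ∫⁻ x, g x := by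
    intro t ht g
    choose L hL hdet using hflow t ht
    have hfl : flow (fun x => -C x) t = flow C (-t) := funext (hC.flow_neg t)
    have hinj : InjOn (flow C (-t)) univ := by
      intro x _ z _ h
      have := congrArg (flow C t) h
      have e := hC.flow_neg_flow (-t)
      rw [neg_neg] at e
      rwa [e, e] at this
    have himage : flow C (-t) '' univ = univ := by
      rw [image_univ]
      exact Function.Surjective.range_eq fun z => ⟨flow C t z, hC.flow_neg_flow t z⟩
    have hdet' : ∀ x, |(L x).det| = jacobian C t x := by
      intro x
      rw [hdet, Real.abs_exp, jacobian, ← intervalIntegral.integral_neg]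
      congr 1
      refine intervalIntegral.integral_congr fun s _ => ?_
      simp only [hC.flow_neg]
      simp [divergence, partialDeriv, fderiv_fun_neg]
    have := lintegral_image_eq_lintegral_abs_det_fderiv_mul volume MeasurableSet.univ
      (fun x _ => (hfl ▸ hL x).hasFDerivWithinAt) hinj g
    rw [himage] at this
    simp only [Measure.restrict_univ, hdet'] at this
    exact this.symm
  have hiter : ∀ s ∈ Icc 0 a, ∀ n : ℕ, ∀ g : Plane → ENNReal,
      ∫⁻ x, ENNReal.ofReal (jacobian C (n * s) x) * g (flow C (-(n * s)) x) = ∫⁻ x, g x := by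
    intro s hs n
    induction n with
    | zero => intro g; simp [jacobian_zero, hC.flow_zero]
    | succ n ih =>
      intro g
      rw [← hsmall s hs g, ← ih fun x => ENNReal.ofReal (jacobian C s x) * g (flow C (-s) x)]
      refine lintegral_congr fun x => ?_
      have e : ((n + 1 : ℕ) : ℝ) * s = n * s + s := by push_cast; ring
      have e' : -((n : ℝ) * s + s) = -s + -(n * s) := by ring
      rw [e, hC.jacobian_add, e', hC.flow_add, ENNReal.ofReal_mul (jacobian_pos _ _ _).le, mul_assoc]
  obtain ⟨n, hn⟩ := exists_nat_gt (t / a)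
  have hn0 : (0 : ℝ) < n := lt_of_le_of_lt (by positivity) hn
  have := hiter (t / n) ⟨by positivity, by
    rw [div_le_iff₀ hn0]
    rw [div_lt_iff₀ ha] at hn
    linarith⟩ n g
  rwa [mul_div_cancel₀ _ hn0.ne'] at this

theorem continuous_flow_neg (t : ℝ) : Continuous (flow C (-t)) :=
  hC.continuous_flow.comp (by fun_prop : Continuous fun x : Plane => (-t, x))

theorem continuous_jacobian_right (t : ℝ) : Continuous (jacobian C t) :=
  hC.continuous_jacobian.comp (by fun_prop : Continuous fun x : Plane => (t, x))

theorem quasiMeasurePreserving_flow {t : ℝ} (ht : 0 ≤ t) :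
    Measure.QuasiMeasurePreserving (flow C (-t)) volume volume := by
  refine ⟨(hC.continuous_flow_neg t).measurable, Measure.AbsolutelyContinuous.mk fun s hs h0 => ?_⟩
  rw [Measure.map_apply (hC.continuous_flow_neg t).measurable hs]
  have h := hC.lintegral_jacobian_mul ht (s.indicator 1)
  rw [lintegral_indicator_one hs, h0, lintegral_eq_zero_iff] at h
  · rw [measure_eq_zero_iff_ae_notMem]
    filter_upwards [h] with x hx hxs
    simp only [Pi.zero_apply, mul_eq_zero, ENNReal.ofReal_eq_zero, not_le.2 (jacobian_pos C t x),
      false_or] at hx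
    rw [indicator_of_mem (show flow C (-t) x ∈ s from hxs)] at hx
    exact one_ne_zero hx
  · exact (hC.continuous_jacobian_right t).measurable.ennreal_ofReal.mul
      ((measurable_one.indicator hs).comp (hC.continuous_flow_neg t).measurable)

theorem transport_congr {t : ℝ} (ht : 0 ≤ t) {v w : Plane → ℝ} (h : v =ᵐ[volume] w) :
    transport C t v =ᵐ[volume] transport C t w := by
  filter_upwards [(hC.quasiMeasurePreserving_flow ht).ae_eq_comp h] with x hx
  simp only [Function.comp] at hx
  rw [transport, transport, hx]

theorem lintegral_enorm_transport {t : ℝ} (ht : 0 ≤ t) (v : Plane → ℝ) :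
    ∫⁻ x, ‖transport C t v x‖ₑ = ∫⁻ x, ‖v x‖ₑ := by
  rw [← hC.lintegral_jacobian_mul ht fun x => ‖v x‖ₑ]
  refine lintegral_congr fun x => ?_
  rw [transport, enorm_mul, Real.enorm_of_nonneg (jacobian_pos _ _ _).le]

theorem integrable_transport {t : ℝ} (ht : 0 ≤ t) {v : Plane → ℝ} (hv : Integrable v) :
    Integrable (transport C t v) := by
  refine ⟨(hC.continuous_jacobian_right t).aestronglyMeasurable.mul
    (hv.aestronglyMeasurable.comp_quasiMeasurePreserving (hC.quasiMeasurePreserving_flow ht)), ?_⟩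
  rw [HasFiniteIntegral, hC.lintegral_enorm_transport ht]
  exact hv.2

theorem integral_transport {t : ℝ} (ht : 0 ≤ t) {v : Plane → ℝ} (hv : Integrable v) :
    ∫ x, transport C t v x = ∫ x, v x := by
  rw [integral_eq_lintegral_pos_part_sub_lintegral_neg_part (hC.integrable_transport ht hv),
    integral_eq_lintegral_pos_part_sub_lintegral_neg_part hv,
    ← hC.lintegral_jacobian_mul ht fun x => ENNReal.ofReal (v x),
    ← hC.lintegral_jacobian_mul ht fun x => ENNReal.ofReal (-v x)]
  simp only [transport, ← mul_neg, ENNReal.ofReal_mul (jacobian_pos _ _ _).le]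

theorem convectionSemigroup_toL1 {t : ℝ} (ht : 0 ≤ t) {v : Plane → ℝ} (hv : Integrable v) :
    convectionSemigroup C t (toL1 v) = toL1 (transport C t v) :=
  toL1_congr (hC.integrable_transport ht (L1.integrable_coeFn _))
    (hC.transport_congr ht (coeFn_toL1 hv))

theorem norm_convectionSemigroup {t : ℝ} (ht : 0 ≤ t) (v : L1) :
    ‖convectionSemigroup C t v‖ = ‖v‖ := by
  have hv := L1.integrable_coeFn v
  conv_lhs => rw [← toL1_coeFn v]
  conv_rhs => rw [← toL1_coeFn v]
  rw [hC.convectionSemigroup_toL1 ht hv, ← toReal_enorm, ← toReal_enorm,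
    enorm_toL1 (hC.integrable_transport ht hv), enorm_toL1 hv, hC.lintegral_enorm_transport ht]

theorem mass_convectionSemigroup {t : ℝ} (ht : 0 ≤ t) (v : L1) :
    mass (convectionSemigroup C t v) = mass v := by
  have hv := L1.integrable_coeFn v
  conv_lhs => rw [← toL1_coeFn v]
  rw [hC.convectionSemigroup_toL1 ht hv, mass_toL1 (hC.integrable_transport ht hv),
    hC.integral_transport ht hv]
  rfl

theorem continuous_transport {v : Plane → ℝ} (hv : Continuous v) :
    Continuous fun p : ℝ × Plane => transport C p.1 v p.2 :=
  hC.continuous_jacobian.mul (hv.comp (hC.continuous_flow.comp (by fun_prop : Continuous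
    fun p : ℝ × Plane => (-p.1, p.2))))

theorem tendsto_convectionSemigroup_of_hasCompactSupport {g : Plane → ℝ} (hg : Continuous g)
    (hgs : HasCompactSupport g) :
    Tendsto (fun t => convectionSemigroup C t (toL1 g)) (𝓝[>] 0) (𝓝 (toL1 g)) := by
  obtain ⟨M, hM⟩ := hC.bounded
  have hM0 : 0 ≤ M := (norm_nonneg _).trans (hM 0)
  have hgi : Integrable g := hg.integrable_of_hasCompactSupport hgs
  set k := Metric.cthickening M (tsupport g) with hk
  have hkc : IsCompact k := hgs.isCompact.cthickening
  -- the flow moves points by at most `M` during the unit time interval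
  have hsupp : ∀ t x, t ∈ Icc (0 : ℝ) 1 → x ∉ k → ‖transport C t g x - g x‖ = 0 := by
    intro t x ht hx
    have h1 : g x = 0 := by
      by_contra h
      exact hx (Metric.self_subset_cthickening _ (subset_tsupport g h))
    have h2 : g (flow C (-t) x) = 0 := by
      by_contra h
      refine hx (Metric.mem_cthickening_of_dist_le x _ M _ (subset_tsupport g h) ?_)
      have := hC.dist_flow_flow_le hM 0 (-t) x
      rw [hC.flow_zero, sub_neg_eq_add, zero_add, abs_of_nonneg ht.1] at this
      nlinarith [ht.2]
    rw [transport, h1, h2]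
    simp
  have hcont : ContinuousOn (fun t => ∫ x, ‖transport C t g x - g x‖) (Icc 0 1) := by
    refine continuousOn_integral_of_compact_support hkc ?_ hsupp
    exact ((hC.continuous_transport hg).sub (hg.comp continuous_snd)).norm.continuousOn
  have h0 := hcont 0 ⟨le_rfl, zero_le_one⟩
  rw [ContinuousWithinAt, hC.transport_zero] at h0
  simp only [sub_self, norm_zero, integral_zero] at h0
  rw [tendsto_iff_norm_sub_tendsto_zero]
  have hmono : 𝓝[>] (0 : ℝ) ≤ 𝓝[Icc 0 1] 0 := by
    rw [← nhdsWithin_Ioo_eq_nhdsGT one_pos]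
    exact nhdsWithin_mono _ Ioo_subset_Icc_self
  refine (h0.mono_left hmono).congr' ?_
  filter_upwards [self_mem_nhdsWithin] with t ht
  have ht0 : (0 : ℝ) ≤ t := le_of_lt ht
  rw [hC.convectionSemigroup_toL1 ht0 hgi,
    norm_toL1_sub (hC.integrable_transport ht0 hgi) hgi]

end IsAdmissibleSpeed

/-- Strong continuity of a family of linear contractions of `L¹` follows from strong continuity on
the continuous functions of compact support. -/
theorem tendsto_of_hasCompactSupport {T : ℝ → L1 → L1}
    (hadd : ∀ t, 0 ≤ t → ∀ v w, T t (v + w) = T t v + T t w)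
    (hle : ∀ t, 0 ≤ t → ∀ v, ‖T t v‖ ≤ ‖v‖)
    (hc : ∀ g : Plane → ℝ, Continuous g → HasCompactSupport g →
      Tendsto (fun t => T t (toL1 g)) (𝓝[>] 0) (𝓝 (toL1 g))) (v : L1) :
    Tendsto (fun t => T t v) (𝓝[>] 0) (𝓝 v) := by
  rw [Metric.tendsto_nhds]
  intro e he
  have hv := L1.integrable_coeFn v
  obtain ⟨g, hgs, hgv, hg, hgi⟩ := hv.exists_hasCompactSupport_integral_sub_le
    (show (0 : ℝ) < e / 4 by positivity)
  have hnorm : ‖v - toL1 g‖ ≤ e / 4 := by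
    conv_lhs => rw [← toL1_coeFn v]
    rw [norm_toL1_sub hv hgi]
    exact hgv
  filter_upwards [(Metric.tendsto_nhds.1 (hc g hg hgs)) (e / 4) (by positivity),
    self_mem_nhdsWithin] with t ht ht0
  have ht0' : (0 : ℝ) ≤ t := le_of_lt ht0
  have e1 : T t v = T t (v - toL1 g) + T t (toL1 g) := by
    rw [← hadd t ht0', sub_add_cancel]
  rw [dist_eq_norm] at ht ⊢
  have e2 : T t v - v = T t (v - toL1 g) + (T t (toL1 g) - toL1 g) - (v - toL1 g) := by
    rw [e1]
    abel
  rw [e2]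
  have h1 := norm_sub_le (T t (v - toL1 g) + (T t (toL1 g) - toL1 g)) (v - toL1 g)
  have h2 := norm_add_le (T t (v - toL1 g)) (T t (toL1 g) - toL1 g)
  have h3 := hle t ht0' (v - toL1 g)
  linarith

namespace IsAdmissibleSpeed

variable {C : Plane → Plane} (hC : IsAdmissibleSpeed C)
include hC

theorem convectionSemigroup_add {t : ℝ} (ht : 0 ≤ t) (v w : L1) :
    convectionSemigroup C t (v + w) = convectionSemigroup C t v + convectionSemigroup C t w := by
  have hv := L1.integrable_coeFn v
  have hw := L1.integrable_coeFn w
  conv_lhs => rw [← toL1_coeFn v, ← toL1_coeFn w]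
  rw [← toL1_add hv hw]
  refine (hC.convectionSemigroup_toL1 ht (hv.add hw)).trans ?_
  refine Eq.trans ?_ (toL1_add (hC.integrable_transport ht hv) (hC.integrable_transport ht hw))
  congr 1
  ext x
  exact mul_add _ _ _

theorem isContractionSemigroup_convection : IsContractionSemigroup (convectionSemigroup C) where
  map_add t ht v w := hC.convectionSemigroup_add ht v w
  map_smul t ht c v := by
    have hv := L1.integrable_coeFn v
    conv_lhs => rw [← toL1_coeFn v]
    rw [← toL1_smul hv, hC.convectionSemigroup_toL1 ht (hv.const_mul c)]
    refine Eq.trans ?_ (toL1_smul (hC.integrable_transport ht hv) c)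
    congr 1
    ext x
    rw [transport, transport, mul_left_comm]
  norm_le t ht v := (hC.norm_convectionSemigroup ht v).le
  zero v := by
    conv_lhs => rw [← toL1_coeFn v]
    rw [hC.convectionSemigroup_toL1 le_rfl (L1.integrable_coeFn v), hC.transport_zero, toL1_coeFn]
  add s t hs ht v := by
    have hv := L1.integrable_coeFn v
    rw [← toL1_coeFn v, hC.convectionSemigroup_toL1 ht hv,
      hC.convectionSemigroup_toL1 hs (hC.integrable_transport ht hv),
      hC.convectionSemigroup_toL1 (add_nonneg hs ht) hv, hC.transport_add]
  tendsto := tendsto_of_hasCompactSupport (fun _ ht v w => hC.convectionSemigroup_add ht v w)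
    (fun _ ht v => (hC.norm_convectionSemigroup ht v).le)
    fun _ hg hgs => hC.tendsto_convectionSemigroup_of_hasCompactSupport hg hgs

/-- The transport equation along the flow: `d/ds S(s)v = S(s)(-div (v C))`. -/
theorem hasDerivAt_transport {v : Plane → ℝ} (hv : Differentiable ℝ v) (x : Plane) (s : ℝ) :
    HasDerivAt (fun s => transport C s v x)
      (transport C s (fun z => -(divergence C z * v z + fderiv ℝ v z (C z))) x) s := by
  have hc : Continuous fun r => divergence C (flow C (-r) x) :=
    hC.continuous_divergence_flow_neg.comp (by fun_prop : Continuous fun r : ℝ => (x, r))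
  have h1 : HasDerivAt (fun s => jacobian C s x)
      (jacobian C s x * -divergence C (flow C (-s) x)) s :=
    (intervalIntegral.integral_hasDerivAt_right (hc.intervalIntegrable _ _)
      hc.aestronglyMeasurable.stronglyMeasurableAtFilter hc.continuousAt).neg.exp
  have h2 : HasDerivAt (fun s => flow C (-s) x) (-C (flow C (-s) x)) s := by
    simpa [Function.comp_def] using (hC.hasDerivAt_flow x (-s)).scomp s (hasDerivAt_neg s)
  have h3 := (hv (flow C (-s) x)).hasFDerivAt.comp_hasDerivAt s h2
  refine (h1.mul h3).congr_deriv ?_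
  simp only [transport, Function.comp, map_neg]
  ring

/-- A differentiable function `v` lies in the domain of the generator `B` of the convection
semigroup, with `B v = -div (v C)`, if both are integrable and the latter is continuous: along the
flow, `S(h)v - v` is the time integral of `S(s)(B v)`. -/
theorem mem_generator_convection {v k : Plane → ℝ} (hv : Differentiable ℝ v)
    (hk : ∀ x, k x = -(divergence C x * v x + fderiv ℝ v x (C x))) (hkc : Continuous k)
    (hvi : Integrable v) (hki : Integrable k) :
    (toL1 v, toL1 k) ∈ hC.isContractionSemigroup_convection.generator := by
  have hS := hC.isContractionSemigroup_convection
  rw [hS.mem_generator, Metric.tendsto_nhds]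
  intro e he
  have hlim := hS.tendsto (toL1 k)
  rw [Metric.tendsto_nhds] at hlim
  have hev := hlim (e / 2) (by positivity)
  rw [eventually_nhdsWithin_iff, Metric.eventually_nhds_iff] at hev
  obtain ⟨d, hd, hd'⟩ := hev
  have hmem : Ioo (0 : ℝ) d ∈ 𝓝[>] 0 := Ioo_mem_nhdsGT hd
  filter_upwards [hmem] with h hh
  have hh0 : 0 < h := hh.1
  have hkeq : k = fun z => -(divergence C z * v z + fderiv ℝ v z (C z)) := funext hk
  have htk := hC.continuous_transport hkc
  have hdi : Integrable (fun x => transport C h v x - v x) :=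
    (hC.integrable_transport hh0.le hvi).sub hvi
  have hφi : Integrable (fun x => h⁻¹ * (transport C h v x - v x) - k x) :=
    (hdi.const_mul _).sub hki
  have heq : h⁻¹ • (convectionSemigroup C h (toL1 v) - toL1 v) - toL1 k
      = toL1 (fun x => h⁻¹ * (transport C h v x - v x) - k x) := by
    rw [toL1_sub (hdi.const_mul _) hki, toL1_smul hdi,
      toL1_sub (hC.integrable_transport hh0.le hvi) hvi, hC.convectionSemigroup_toL1 hh0.le hvi]
  have hpt : ∀ x, h⁻¹ * (transport C h v x - v x) - k x
      = h⁻¹ * ∫ s in (0 : ℝ)..h, (transport C s k x - k x) := by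
    intro x
    have hcx : Continuous fun s => transport C s k x :=
      htk.comp (by fun_prop : Continuous fun s : ℝ => (s, x))
    have h1 := intervalIntegral.integral_eq_sub_of_hasDerivAt (a := 0) (b := h)
      (fun s _ => hkeq ▸ hC.hasDerivAt_transport hv x s) (hcx.intervalIntegrable _ _)
    rw [hC.transport_zero] at h1
    rw [intervalIntegral.integral_sub (hcx.intervalIntegrable _ _) intervalIntegrable_const, h1]
    simp only [intervalIntegral.integral_const, sub_zero, smul_eq_mul]
    field_simp
  have hle : ‖toL1 (fun x => h⁻¹ * (transport C h v x - v x) - k x)‖ₑ ≤ ENNReal.ofReal (e / 2) := by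
    rw [enorm_toL1 hφi]
    calc ∫⁻ x, ‖h⁻¹ * (transport C h v x - v x) - k x‖ₑ
        ≤ ∫⁻ x, ENNReal.ofReal h⁻¹ * ∫⁻ s in Ioc 0 h, ‖transport C s k x - k x‖ₑ := by
          refine lintegral_mono fun x => ?_
          rw [hpt, enorm_mul, Real.enorm_of_nonneg (by positivity),
            intervalIntegral.integral_of_le hh0.le]
          exact mul_le_mul_right (enorm_integral_le_lintegral_enorm _) _
      _ = ENNReal.ofReal h⁻¹ * ∫⁻ s in Ioc 0 h, ∫⁻ x, ‖transport C s k x - k x‖ₑ := by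
          have hm : Measurable (Function.uncurry fun (x : Plane) (s : ℝ) =>
              ‖transport C s k x - k x‖ₑ) :=
            ((htk.comp continuous_swap).sub (hkc.comp continuous_fst)).measurable.enorm
          rw [← lintegral_lintegral_swap hm.aemeasurable]
          exact lintegral_const_mul _ hm.lintegral_prod_right'
      _ ≤ ENNReal.ofReal h⁻¹ * ∫⁻ _ in Ioc 0 h, ENNReal.ofReal (e / 2) := by
          refine mul_le_mul_right (setLIntegral_mono' measurableSet_Ioc fun s hs => ?_) _
          have hs0 : 0 ≤ s := hs.1.le
          rw [← enorm_toL1_sub (hC.integrable_transport hs0 hki) hki,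
            ← hC.convectionSemigroup_toL1 hs0 hki]
          have := hd' (y := s) (by
            rw [Real.dist_eq, sub_zero, abs_of_pos hs.1]
            exact hs.2.trans_lt hh.2) hs.1
          rw [dist_eq_norm] at this
          rw [← ofReal_norm]
          exact ENNReal.ofReal_le_ofReal this.le
      _ = ENNReal.ofReal (e / 2) := by
          rw [setLIntegral_const, Real.volume_Ioc, sub_zero, mul_left_comm, mul_comm,
            ← ENNReal.ofReal_mul (by positivity), inv_mul_cancel₀ hh0.ne', ENNReal.ofReal_one,
            one_mul]
  rw [dist_eq_norm, heq]
  rw [← ofReal_norm, ENNReal.ofReal_le_ofReal_iff (by positivity)] at hle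
  linarith

end IsAdmissibleSpeed

/-! ### The heat kernel -/

theorem integral_exp_neg_mul_sq_norm {b : ℝ} (hb : 0 < b) :
    ∫ x : Plane, Real.exp (-b * ‖x‖ ^ 2) = Real.pi / b := by
  rw [GaussianFourier.integral_rexp_neg_mul_sq_norm hb]
  simp

theorem integrable_exp_neg_mul_sq_norm {b : ℝ} (hb : 0 < b) :
    Integrable fun x : Plane => Real.exp (-b * ‖x‖ ^ 2) := by
  refine Integrable.of_integral_ne_zero ?_
  rw [integral_exp_neg_mul_sq_norm hb]
  positivity

section HeatKernel

variable {ε t : ℝ}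

theorem heatKernel_eq (ε t : ℝ) (x : Plane) :
    heatKernel ε t x = 1 / (4 * Real.pi * ε ^ 2 * t)
      * Real.exp (-(1 / (4 * ε ^ 2 * t)) * ‖x‖ ^ 2) := by
  rw [heatKernel]
  congr 2
  ring

theorem continuous_heatKernel (ε t : ℝ) : Continuous (heatKernel ε t) := by
  unfold heatKernel
  fun_prop

theorem heatKernel_nonneg (ht : 0 ≤ t) (x : Plane) : 0 ≤ heatKernel ε t x := by
  rw [heatKernel]
  positivity

theorem integrable_heatKernel (hε : 0 < ε) (ht : 0 < t) : Integrable (heatKernel ε t) := by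
  simp only [funext (heatKernel_eq ε t)]
  exact (integrable_exp_neg_mul_sq_norm (by positivity)).const_mul _

theorem integral_heatKernel (hε : 0 < ε) (ht : 0 < t) : ∫ x, heatKernel ε t x = 1 := by
  simp only [heatKernel_eq ε t]
  rw [integral_const_mul, integral_exp_neg_mul_sq_norm (by positivity)]
  field_simp

theorem heatKernel_le (ht : 0 ≤ t) (x : Plane) :
    heatKernel ε t x ≤ 1 / (4 * Real.pi * ε ^ 2 * t) := by
  rw [heatKernel]
  refine mul_le_of_le_one_right (by positivity) (Real.exp_le_one_iff.2 ?_)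
  rw [neg_nonpos]
  positivity

/-- The semigroup law of the heat kernel, by completing the square. -/
theorem integral_heatKernel_mul_heatKernel (hε : 0 < ε) {s : ℝ} (hs : 0 < s) (ht : 0 < t)
    (x : Plane) :
    ∫ z, heatKernel ε s (x - z) * heatKernel ε t z = heatKernel ε (s + t) x := by
  have hsq : ∀ z : Plane, heatKernel ε s (x - z) * heatKernel ε t z
      = 1 / (4 * Real.pi * ε ^ 2 * s) * (1 / (4 * Real.pi * ε ^ 2 * t))
        * Real.exp (-(1 / (4 * ε ^ 2 * (s + t))) * ‖x‖ ^ 2)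
        * Real.exp (-((s + t) / (4 * ε ^ 2 * s * t)) * ‖z - (t / (s + t)) • x‖ ^ 2) := by
    intro z
    rw [heatKernel_eq, heatKernel_eq, mul_mul_mul_comm, ← Real.exp_add, mul_assoc _ (Real.exp _),
      ← Real.exp_add]
    congr 2
    rw [norm_sub_sq_real, norm_sub_sq_real, norm_smul, inner_smul_right, real_inner_comm x z,
      mul_pow, Real.norm_eq_abs, sq_abs]
    field_simp
    ring
  simp only [hsq]
  rw [integral_const_mul, integral_sub_right_eq_self (fun z : Plane =>
    Real.exp (-((s + t) / (4 * ε ^ 2 * s * t)) * ‖z‖ ^ 2)),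
    integral_exp_neg_mul_sq_norm (by positivity), heatKernel_eq]
  field_simp

/-- The Gaussian factor is split in two, one half gives the kernel at twice the time. -/
theorem heatKernel_eq_two_mul (hε : 0 < ε) (ht : 0 < t) (x : Plane) :
    heatKernel ε t x = 2 * Real.exp (-(‖x‖ ^ 2 / (8 * ε ^ 2 * t))) * heatKernel ε (2 * t) x := by
  rw [heatKernel, heatKernel, mul_mul_mul_comm, ← Real.exp_add]
  congr 1
  · field_simp
  · congr 1
    field_simp
    ring

/-- The derivative of the heat kernel. -/
noncomputable def heatKernelDeriv (ε t : ℝ) (x : Plane) : Plane →L[ℝ] ℝ :=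
  (-(heatKernel ε t x / (2 * ε ^ 2 * t))) • innerSL ℝ x

theorem hasFDerivAt_heatKernel (hε : 0 < ε) (ht : 0 < t) (x : Plane) :
    HasFDerivAt (heatKernel ε t) (heatKernelDeriv ε t x) x := by
  have h1 := (hasStrictFDerivAt_norm_sq x).hasFDerivAt
  have h2 := ((h1.const_mul (-(1 / (4 * ε ^ 2 * t)))).exp).const_mul (1 / (4 * Real.pi * ε ^ 2 * t))
  have e : heatKernel ε t = fun x => 1 / (4 * Real.pi * ε ^ 2 * t)
      * Real.exp (-(1 / (4 * ε ^ 2 * t)) * ‖x‖ ^ 2) := funext (heatKernel_eq ε t)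
  rw [e]
  refine h2.congr_fderiv ?_
  ext v
  simp only [heatKernelDeriv, heatKernel_eq, smul_apply, smul_eq_mul, nsmul_eq_mul,
    Nat.cast_ofNat, innerSL_apply_apply]
  field_simp
  norm_num

theorem continuous_heatKernelDeriv (ε t : ℝ) : Continuous (heatKernelDeriv ε t) := by
  have := continuous_heatKernel ε t
  unfold heatKernelDeriv
  exact (this.div_const _).neg.smul (innerSL ℝ).continuous

/-- The gradient of the heat kernel is of order `t ^ (-1/2)`, at the price of doubling the time in
the Gaussian. -/
theorem norm_heatKernelDeriv_le (hε : 0 < ε) (ht : 0 < t) (x : Plane) :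
    ‖heatKernelDeriv ε t x‖ ≤ 3 / (ε * √t) * heatKernel ε (2 * t) x := by
  have hK := heatKernel_nonneg (ε := ε) (by positivity : 0 ≤ 2 * t) x
  rw [heatKernelDeriv, norm_smul, innerSL_apply_norm, norm_neg, norm_div, Real.norm_eq_abs,
    Real.norm_eq_abs, abs_of_nonneg (heatKernel_nonneg ht.le x), abs_of_pos (by positivity),
    heatKernel_eq_two_mul hε ht]
  set q := ε * √t with hq
  have hq0 : 0 < q := by positivity
  have hqa : ε ^ 2 * t = q ^ 2 := by rw [hq, mul_pow, Real.sq_sqrt ht.le]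
  have e8 : 8 * ε ^ 2 * t = 8 * q ^ 2 := by rw [← hqa]; ring
  have e2 : 2 * ε ^ 2 * t = 2 * q ^ 2 := by rw [← hqa]; ring
  rw [e8, e2]
  -- `y exp (-y²/8) ≤ 3` for `y = ‖x‖ / q`
  set y := ‖x‖ / q with hy
  have hxy : ‖x‖ = y * q := by rw [hy]; field_simp
  have hexp : y * Real.exp (-(y ^ 2 / 8)) ≤ 3 := by
    have h1 := Real.add_one_le_exp (y ^ 2 / 8)
    rw [Real.exp_neg, ← div_eq_mul_inv, div_le_iff₀ (Real.exp_pos _)]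
    nlinarith [sq_nonneg (y - 4 / 3)]
  rw [hxy]
  have e : (y * q) ^ 2 / (8 * q ^ 2) = y ^ 2 / 8 := by field_simp
  rw [e]
  calc _ = (y * Real.exp (-(y ^ 2 / 8))) * (heatKernel ε (2 * t) x / q) := by field_simp
    _ ≤ 3 * (heatKernel ε (2 * t) x / q) := mul_le_mul_of_nonneg_right hexp (by positivity)
    _ = _ := by ring

/-- The convolution of a function with the heat kernel. -/
noncomputable def heatConv (ε t : ℝ) (v : Plane → ℝ) (x : Plane) : ℝ :=
  ∫ z, heatKernel ε t (x - z) * v z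

theorem heatConv_congr {v w : Plane → ℝ} (h : v =ᵐ[volume] w) : heatConv ε t v = heatConv ε t w := by
  ext x
  refine integral_congr_ae ?_
  filter_upwards [h] with z hz
  rw [hz]

theorem heatConv_eq_convolution (v : Plane → ℝ) :
    heatConv ε t v = convolution v (heatKernel ε t) (ContinuousLinearMap.mul ℝ ℝ) volume := by
  ext x
  rw [heatConv, convolution_def]
  refine integral_congr_ae (Eventually.of_forall fun z => ?_)
  exact mul_comm _ _

variable (hε : 0 < ε) (ht : 0 < t) {v : Plane → ℝ} (hv : Integrable v)
include hε ht hv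

theorem integrable_heatConv : Integrable (heatConv ε t v) := by
  rw [heatConv_eq_convolution]
  exact hv.integrable_convolution _ (integrable_heatKernel hε ht)

theorem integral_heatConv : ∫ x, heatConv ε t v x = ∫ x, v x := by
  rw [heatConv_eq_convolution, integral_convolution _ hv (integrable_heatKernel hε ht),
    integral_heatKernel hε ht]
  simp

omit hε in
theorem integrable_heatKernel_mul (x : Plane) :
    Integrable fun z => heatKernel ε t (x - z) * v z := by
  refine hv.bdd_mul (c := 1 / (4 * Real.pi * ε ^ 2 * t))
    ((continuous_heatKernel ε t).comp (by fun_prop)).aestronglyMeasurable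
    (Eventually.of_forall fun z => ?_)
  rw [Real.norm_eq_abs, abs_of_nonneg (heatKernel_nonneg ht.le _)]
  exact heatKernel_le ht.le _

omit hε hv in
theorem abs_heatConv_le (v : Plane → ℝ) (x : Plane) :
    |heatConv ε t v x| ≤ heatConv ε t (fun z => |v z|) x := by
  refine (abs_integral_le_integral_abs).trans (le_of_eq ?_)
  refine integral_congr_ae (Eventually.of_forall fun z => ?_)
  simp only
  rw [abs_mul, abs_of_nonneg (heatKernel_nonneg ht.le _)]

theorem norm_toL1_heatConv_le : ‖toL1 (heatConv ε t v)‖ ≤ ‖toL1 v‖ := by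
  have hi := integrable_heatConv hε ht hv
  rw [norm_toL1 hi, norm_toL1 hv]
  calc _ ≤ ∫ x, heatConv ε t (fun z => |v z|) x :=
        integral_mono hi.norm (integrable_heatConv hε ht hv.abs) (abs_heatConv_le ht v)
    _ = _ := integral_heatConv hε ht hv.abs

theorem heatConv_heatConv {s : ℝ} (hs : 0 < s) :
    heatConv ε s (heatConv ε t v) = heatConv ε (s + t) v := by
  ext x
  have hint : Integrable (fun p : Plane × Plane =>
      heatKernel ε s (x - p.1) * (heatKernel ε t (p.1 - p.2) * v p.2)) (volume.prod volume) := by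
    have h1 := hv.convolution_integrand (ContinuousLinearMap.mul ℝ ℝ) (integrable_heatKernel hε ht)
    have h2 := h1.bdd_mul (f := fun p : Plane × Plane => heatKernel ε s (x - p.1))
      (c := 1 / (4 * Real.pi * ε ^ 2 * s))
      ((continuous_heatKernel ε s).comp (by fun_prop)).aestronglyMeasurable
      (Eventually.of_forall fun p => by
        rw [Real.norm_eq_abs, abs_of_nonneg (heatKernel_nonneg hs.le _)]
        exact heatKernel_le hs.le _)
    refine h2.congr (Eventually.of_forall fun p => ?_)
    simp only [ContinuousLinearMap.mul_apply']
    ring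
  simp only [heatConv, ← integral_const_mul]
  rw [integral_integral_swap hint]
  refine integral_congr_ae (Eventually.of_forall fun w => ?_)
  simp only [← mul_assoc]
  rw [integral_mul_const, ← integral_heatKernel_mul_heatKernel hε hs ht]
  congr 1
  refine Eq.trans ?_ (integral_sub_right_eq_self
    (fun z => heatKernel ε s (x - w - z) * heatKernel ε t z) w)
  simp only [sub_sub_sub_cancel_right]

/-- Differentiation under the integral sign. -/
theorem hasFDerivAt_heatConv (x : Plane) :
    HasFDerivAt (heatConv ε t v) (∫ z, v z • heatKernelDeriv ε t (x - z)) x := by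
  have hB : ∀ x, ‖heatKernelDeriv ε t x‖
      ≤ 3 / (ε * √t) * (1 / (4 * Real.pi * ε ^ 2 * (2 * t))) := fun x =>
    (norm_heatKernelDeriv_le hε ht x).trans
      (mul_le_mul_of_nonneg_left (heatKernel_le (by positivity) x) (by positivity))
  refine hasFDerivAt_integral_of_dominated_of_fderiv_le (𝕜 := ℝ) (s := univ)
    (F := fun x z => heatKernel ε t (x - z) * v z)
    (F' := fun x z => v z • heatKernelDeriv ε t (x - z))
    (bound := fun z => |v z| * (3 / (ε * √t) * (1 / (4 * Real.pi * ε ^ 2 * (2 * t))))) univ_mem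
    (Eventually.of_forall fun w => (integrable_heatKernel_mul ht hv w).aestronglyMeasurable)
    (integrable_heatKernel_mul ht hv x) ?_ ?_ (hv.abs.mul_const _) ?_
  · exact hv.aestronglyMeasurable.smul
      ((continuous_heatKernelDeriv ε t).comp (by fun_prop)).aestronglyMeasurable
  · refine Eventually.of_forall fun z w _ => ?_
    rw [norm_smul, Real.norm_eq_abs]
    exact mul_le_mul_of_nonneg_left (hB _) (abs_nonneg _)
  · refine Eventually.of_forall fun z w _ => ?_
    have h1 := (hasFDerivAt_heatKernel hε ht (w - z)).comp w
      ((hasFDerivAt_id (𝕜 := ℝ) w).sub_const z)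
    simpa using h1.mul_const (v z)

theorem norm_fderiv_heatConv_le (x : Plane) :
    ‖fderiv ℝ (heatConv ε t v) x‖ ≤ 3 / (ε * √t) * heatConv ε (2 * t) (fun z => |v z|) x := by
  rw [(hasFDerivAt_heatConv hε ht hv x).fderiv, heatConv, ← integral_const_mul]
  refine norm_integral_le_of_norm_le
    ((integrable_heatKernel_mul (by positivity) hv.abs x).const_mul _)
    (Eventually.of_forall fun z => ?_)
  rw [norm_smul, Real.norm_eq_abs, mul_comm, ← mul_assoc]
  exact mul_le_mul_of_nonneg_right (norm_heatKernelDeriv_le hε ht _) (abs_nonneg _)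

theorem continuous_fderiv_heatConv : Continuous (fderiv ℝ (heatConv ε t v)) := by
  have e : fderiv ℝ (heatConv ε t v) = fun x => ∫ z, v z • heatKernelDeriv ε t (x - z) :=
    funext fun x => (hasFDerivAt_heatConv hε ht hv x).fderiv
  rw [e]
  refine continuous_of_dominated
    (bound := fun z => |v z| * (3 / (ε * √t) * (1 / (4 * Real.pi * ε ^ 2 * (2 * t)))))
    (fun x => hv.aestronglyMeasurable.smul
      ((continuous_heatKernelDeriv ε t).comp (by fun_prop)).aestronglyMeasurable)
    (fun x => Eventually.of_forall fun z => ?_) (hv.abs.mul_const _)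
    (Eventually.of_forall fun z => ?_)
  · rw [norm_smul, Real.norm_eq_abs]
    exact mul_le_mul_of_nonneg_left ((norm_heatKernelDeriv_le hε ht _).trans
      (mul_le_mul_of_nonneg_left (heatKernel_le (by positivity) _) (by positivity))) (abs_nonneg _)
  · have := (continuous_heatKernelDeriv ε t).comp (by fun_prop : Continuous fun x : Plane => x - z)
    exact this.const_smul (v z)

end HeatKernel

/-! ### The diffusion semigroup -/

/-- The `L¹` modulus of continuity of a continuous function of compact support tends to `0`. -/
theorem tendsto_integral_translate_sub {g : Plane → ℝ} (hg : Continuous g)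
    (hgs : HasCompactSupport g) :
    Tendsto (fun z => ∫ x, ‖g (x - z) - g x‖) (𝓝 0) (𝓝 0) := by
  have hk : IsCompact (Metric.cthickening 1 (tsupport g)) := hgs.isCompact.cthickening
  have hcont : ContinuousOn (fun z => ∫ x, ‖g (x - z) - g x‖) (Metric.closedBall 0 1) := by
    refine continuousOn_integral_of_compact_support hk (Continuous.continuousOn (by fun_prop)) ?_
    intro z x hz hx
    have h1 : g x = 0 := by
      by_contra h
      exact hx (Metric.self_subset_cthickening _ (subset_tsupport g h))
    have h2 : g (x - z) = 0 := by
      by_contra h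
      refine hx (Metric.mem_cthickening_of_dist_le x _ 1 _ (subset_tsupport g h) ?_)
      rw [dist_eq_norm, sub_sub_cancel]
      simpa using hz
    rw [h1, h2]
    simp
  have h0 := hcont.continuousAt (Metric.closedBall_mem_nhds 0 one_pos)
  simpa [ContinuousAt] using h0

section

variable {ε : ℝ} (hε : 0 < ε)
include hε

/-- The kernel concentrates at the origin: an `L¹` modulus of continuity that is at most `η` on the
ball of radius `d` and at most `2 ‖g‖` everywhere gives the bound `η` up to a Gaussian tail. -/
theorem integral_norm_heatConv_sub_le {t : ℝ} (ht : 0 < t) {g : Plane → ℝ} (hg : Continuous g)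
    (hgi : Integrable g) {d eta : ℝ} (hd : 0 < d) (heta : 0 ≤ eta)
    (hmod : ∀ z, ‖z‖ < d → ∫ x, ‖g (x - z) - g x‖ ≤ eta) :
    ∫ x, ‖heatConv ε t g x - g x‖
      ≤ eta + 4 * (∫ x, ‖g x‖) * Real.exp (-(d ^ 2 / (8 * ε ^ 2 * t))) := by
  set N := ∫ x, ‖g x‖ with hN
  have hN0 : 0 ≤ N := integral_nonneg fun x => norm_nonneg _
  set c := Real.exp (-(d ^ 2 / (8 * ε ^ 2 * t))) with hc
  have hc0 : 0 < c := Real.exp_pos _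
  have hci := integrable_heatConv hε ht hgi
  have hgz : ∀ z, Integrable fun x => ‖g (x - z) - g x‖ := fun z => by
    have : Integrable fun x => g (x - z) - g x := (hgi.comp_sub_right z).sub hgi
    exact this.norm
  have hω : ∀ z, ∫ x, ‖g (x - z) - g x‖ ≤ 2 * N := fun z => by
    calc _ ≤ ∫ x, (‖g (x - z)‖ + ‖g x‖) := integral_mono (hgz z)
          ((hgi.comp_sub_right z).norm.add hgi.norm) fun x => norm_sub_le _ _
      _ = 2 * N := by
          rw [integral_add (hgi.comp_sub_right z).norm hgi.norm,
            integral_sub_right_eq_self (fun x => ‖g x‖) z]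
          ring
  have hK2i := integrable_heatKernel hε (by positivity : 0 < 2 * t)
  have hbound : ∀ z, heatKernel ε t z * ∫ x, ‖g (x - z) - g x‖
      ≤ eta * heatKernel ε t z + 4 * N * c * heatKernel ε (2 * t) z := by
    intro z
    have hK := heatKernel_nonneg (ε := ε) ht.le z
    have hK2 := heatKernel_nonneg (ε := ε) (by positivity : 0 ≤ 2 * t) z
    rcases lt_or_ge ‖z‖ d with hz | hz
    · have := mul_le_mul_of_nonneg_left (hmod z hz) hK
      have h2 : 0 ≤ 4 * N * c * heatKernel ε (2 * t) z := by positivity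
      linarith
    · have h1 : heatKernel ε t z ≤ 2 * c * heatKernel ε (2 * t) z := by
        rw [heatKernel_eq_two_mul hε ht]
        have : Real.exp (-(‖z‖ ^ 2 / (8 * ε ^ 2 * t))) ≤ c := by
          rw [hc]
          gcongr
        gcongr
      have h2 := mul_le_mul h1 (hω z) (integral_nonneg fun x => norm_nonneg _) (by positivity)
      have h3 : 0 ≤ eta * heatKernel ε t z := by positivity
      linarith
  have hpt : ∀ x, heatConv ε t g x - g x = ∫ z, heatKernel ε t z * (g (x - z) - g x) := by
    intro x
    have hsymm : ∀ z, heatKernel ε t (x - (x - z)) * g (x - z) = heatKernel ε t z * g (x - z) := by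
      intro z
      rw [sub_sub_cancel]
    have h1 : heatConv ε t g x = ∫ z, heatKernel ε t z * g (x - z) := by
      rw [heatConv, ← integral_sub_left_eq_self _ volume x]
      simp only [hsymm]
    have h2 : Integrable fun z => heatKernel ε t z * g (x - z) := by
      have := (integrable_heatKernel_mul (ε := ε) ht hgi x).comp_sub_left x
      simpa only [hsymm] using this
    have h3 : g x = ∫ z, heatKernel ε t z * g x := by
      rw [integral_mul_const, integral_heatKernel hε ht, one_mul]
    rw [h1]
    conv_lhs => rw [h3]
    rw [← integral_sub h2 ((integrable_heatKernel hε ht).mul_const _)]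
    simp only [mul_sub]
  have hle : ∫⁻ x, ‖heatConv ε t g x - g x‖ₑ ≤ ENNReal.ofReal (eta + 4 * N * c) := by
    calc ∫⁻ x, ‖heatConv ε t g x - g x‖ₑ
        ≤ ∫⁻ x, ∫⁻ z, ‖heatKernel ε t z * (g (x - z) - g x)‖ₑ := by
          refine lintegral_mono fun x => ?_
          rw [hpt]
          exact enorm_integral_le_lintegral_enorm _
      _ = ∫⁻ z, ∫⁻ x, ‖heatKernel ε t z * (g (x - z) - g x)‖ₑ := by
          refine lintegral_lintegral_swap ?_
          have := continuous_heatKernel ε t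
          have h : Continuous fun p : Plane × Plane =>
              heatKernel ε t p.2 * (g (p.1 - p.2) - g p.1) := by fun_prop
          exact h.measurable.enorm.aemeasurable
      _ ≤ ∫⁻ z, ENNReal.ofReal (eta * heatKernel ε t z + 4 * N * c * heatKernel ε (2 * t) z) := by
          refine lintegral_mono fun z => ?_
          have h1 : Integrable fun x => heatKernel ε t z * (g (x - z) - g x) :=
            Integrable.const_mul ((hgi.comp_sub_right z).sub hgi) _
          rw [← ofReal_integral_norm_eq_lintegral_enorm h1]
          refine ENNReal.ofReal_le_ofReal ?_
          simp only [norm_mul]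
          rw [integral_const_mul, Real.norm_eq_abs, abs_of_nonneg (heatKernel_nonneg ht.le z)]
          exact hbound z
      _ = ENNReal.ofReal (eta + 4 * N * c) := by
          rw [← ofReal_integral_eq_lintegral_ofReal]
          · rw [integral_add ((integrable_heatKernel hε ht).const_mul _) (hK2i.const_mul _),
              integral_const_mul, integral_const_mul, integral_heatKernel hε ht,
              integral_heatKernel hε (by positivity), mul_one, mul_one]
          · exact ((integrable_heatKernel hε ht).const_mul _).add (hK2i.const_mul _)
          · refine Eventually.of_forall fun z => ?_
            have hK := heatKernel_nonneg (ε := ε) ht.le z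
            have hK2 := heatKernel_nonneg (ε := ε) (by positivity : 0 ≤ 2 * t) z
            simp only [Pi.zero_apply]
            positivity
  have hdi : Integrable fun x => heatConv ε t g x - g x := hci.sub hgi
  rw [← ofReal_integral_norm_eq_lintegral_enorm hdi, ENNReal.ofReal_le_ofReal_iff (by positivity)] at hle
  exact hle

omit hε in
theorem diffusionSemigroup_toL1 {t : ℝ} (ht : 0 < t) {v : Plane → ℝ} (hv : Integrable v) :
    diffusionSemigroup ε t (toL1 v) = toL1 (heatConv ε t v) := by
  rw [diffusionSemigroup, if_pos ht]
  exact congrArg toL1 (heatConv_congr (coeFn_toL1 hv))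

omit hε in
theorem diffusionSemigroup_zero (v : L1) : diffusionSemigroup ε 0 v = v := by
  rw [diffusionSemigroup, if_neg (lt_irrefl 0)]

theorem tendsto_diffusionSemigroup_of_hasCompactSupport {g : Plane → ℝ} (hg : Continuous g)
    (hgs : HasCompactSupport g) :
    Tendsto (fun t => diffusionSemigroup ε t (toL1 g)) (𝓝[>] 0) (𝓝 (toL1 g)) := by
  have hgi : Integrable g := hg.integrable_of_hasCompactSupport hgs
  rw [Metric.tendsto_nhds]
  intro e he
  obtain ⟨d, hd, hmod⟩ := Metric.tendsto_nhds_nhds.1 (tendsto_integral_translate_sub hg hgs)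
    (e / 2) (by positivity)
  have hmod' : ∀ z, ‖z‖ < d → ∫ x, ‖g (x - z) - g x‖ ≤ e / 2 := by
    intro z hz
    have := hmod (x := z) (by simpa using hz)
    rw [Real.dist_eq, sub_zero] at this
    exact (le_abs_self _).trans this.le
  have htail : Tendsto (fun t : ℝ => 4 * (∫ x, ‖g x‖) * Real.exp (-(d ^ 2 / (8 * ε ^ 2 * t))))
      (𝓝[>] 0) (𝓝 0) := by
    have h1 : Tendsto (fun t : ℝ => d ^ 2 / (8 * ε ^ 2) * t⁻¹) (𝓝[>] 0) atTop :=
      tendsto_inv_nhdsGT_zero.const_mul_atTop (by positivity)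
    have h2 := (Real.tendsto_exp_neg_atTop_nhds_zero.comp h1).const_mul (4 * ∫ x, ‖g x‖)
    rw [mul_zero] at h2
    refine h2.congr fun t => ?_
    simp only [Function.comp]
    congr 3
    rw [← div_eq_mul_inv, div_div]
  filter_upwards [htail.eventually (gt_mem_nhds (half_pos he)), self_mem_nhdsWithin] with t h1 ht
  have ht0 : 0 < t := ht
  rw [dist_eq_norm, diffusionSemigroup_toL1 ht0 hgi,
    norm_toL1_sub (integrable_heatConv hε ht0 hgi) hgi]
  have := integral_norm_heatConv_sub_le hε ht0 hg hgi hd (half_pos he).le hmod'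
  linarith

theorem norm_diffusionSemigroup_le {t : ℝ} (ht : 0 ≤ t) (v : L1) :
    ‖diffusionSemigroup ε t v‖ ≤ ‖v‖ := by
  rcases ht.eq_or_lt with rfl | ht
  · rw [diffusionSemigroup_zero]
  · have hv := L1.integrable_coeFn v
    conv_lhs => rw [← toL1_coeFn v]
    conv_rhs => rw [← toL1_coeFn v]
    rw [diffusionSemigroup_toL1 ht hv]
    exact norm_toL1_heatConv_le hε ht hv

theorem mass_diffusionSemigroup {t : ℝ} (ht : 0 ≤ t) (v : L1) :
    mass (diffusionSemigroup ε t v) = mass v := by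
  rcases ht.eq_or_lt with rfl | ht
  · rw [diffusionSemigroup_zero]
  · have hv := L1.integrable_coeFn v
    conv_lhs => rw [← toL1_coeFn v]
    rw [diffusionSemigroup_toL1 ht hv, mass_toL1 (integrable_heatConv hε ht hv),
      integral_heatConv hε ht hv]
    rfl

theorem diffusionSemigroup_add {t : ℝ} (ht : 0 ≤ t) (v w : L1) :
    diffusionSemigroup ε t (v + w) = diffusionSemigroup ε t v + diffusionSemigroup ε t w := by
  rcases ht.eq_or_lt with rfl | ht
  · simp only [diffusionSemigroup_zero]
  · have hv := L1.integrable_coeFn v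
    have hw := L1.integrable_coeFn w
    rw [← toL1_coeFn v, ← toL1_coeFn w, ← toL1_add hv hw, diffusionSemigroup_toL1 ht hv,
      diffusionSemigroup_toL1 ht hw]
    refine (diffusionSemigroup_toL1 ht (hv.add hw)).trans ?_
    rw [← toL1_add (integrable_heatConv hε ht hv) (integrable_heatConv hε ht hw)]
    congr 1
    ext x
    rw [heatConv, heatConv, heatConv, ← integral_add (integrable_heatKernel_mul ht hv x)
      (integrable_heatKernel_mul ht hw x)]
    simp only [Pi.add_apply, mul_add]

theorem isContractionSemigroup_diffusion : IsContractionSemigroup (diffusionSemigroup ε) where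
  map_add t ht v w := diffusionSemigroup_add hε ht v w
  map_smul t ht c v := by
    rcases ht.eq_or_lt with rfl | ht
    · simp only [diffusionSemigroup_zero]
    · have hv := L1.integrable_coeFn v
      rw [← toL1_coeFn v, ← toL1_smul hv, diffusionSemigroup_toL1 ht hv,
        diffusionSemigroup_toL1 ht (hv.const_mul c), ← toL1_smul (integrable_heatConv hε ht hv)]
      congr 1
      ext x
      rw [heatConv, heatConv, ← integral_const_mul]
      simp only [mul_left_comm]
  norm_le t ht v := norm_diffusionSemigroup_le hε ht v
  zero v := diffusionSemigroup_zero v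
  add s t hs ht v := by
    rcases hs.eq_or_lt with rfl | hs
    · rw [zero_add, diffusionSemigroup_zero]
    rcases ht.eq_or_lt with rfl | ht
    · rw [add_zero, diffusionSemigroup_zero]
    have hv := L1.integrable_coeFn v
    rw [← toL1_coeFn v, diffusionSemigroup_toL1 ht hv,
      diffusionSemigroup_toL1 hs (integrable_heatConv hε ht hv),
      diffusionSemigroup_toL1 (add_pos hs ht) hv, heatConv_heatConv hε ht hv hs]
  tendsto := tendsto_of_hasCompactSupport (fun _ ht v w => diffusionSemigroup_add hε ht v w)
    (fun _ ht v => norm_diffusionSemigroup_le hε ht v)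
    fun _ hg hgs => tendsto_diffusionSemigroup_of_hasCompactSupport hε hg hgs

/-- The diffusion semigroup maps into the domain of the generator of the convection semigroup, with
the singularity `t ^ (-1/2)` of the gradient of the heat kernel. -/
theorem exists_mem_generator_convection {C : Plane → Plane} (hC : IsAdmissibleSpeed C) :
    ∃ c d : ℝ, ∀ t, 0 < t → ∀ v : L1, ∃ k,
      (diffusionSemigroup ε t v, k) ∈ hC.isContractionSemigroup_convection.generator ∧
        ‖k‖ ≤ (c * t ^ (-(1 / 2) : ℝ) + d) * ‖v‖ := by
  obtain ⟨M, hM⟩ := hC.bounded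
  have hM0 : 0 ≤ M := (norm_nonneg _).trans (hM 0)
  obtain ⟨D, hD0, hD⟩ := hC.exists_abs_divergence_le
  refine ⟨M * (3 / ε), D, fun t ht v => ?_⟩
  have hv := L1.integrable_coeFn v
  set u := heatConv ε t v with hu
  have hud : Differentiable ℝ u := fun x => (hasFDerivAt_heatConv hε ht hv x).differentiableAt
  have hui : Integrable u := integrable_heatConv hε ht hv
  set k : Plane → ℝ := fun x => -(divergence C x * u x + fderiv ℝ u x (C x)) with hk
  have hkc : Continuous k := ((hC.continuous_divergence.mul hud.continuous).add
    ((continuous_fderiv_heatConv hε ht hv).clm_apply hC.continuous)).neg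
  have h2i := integrable_heatConv hε (by positivity : 0 < 2 * t) hv.abs
  have hkle : ∀ x, ‖k x‖ ≤ D * |u x|
      + M * (3 / (ε * √t)) * heatConv ε (2 * t) (fun z => |v z|) x := by
    intro x
    rw [hk, norm_neg]
    refine (norm_add_le _ _).trans (add_le_add ?_ ?_)
    · rw [norm_mul, Real.norm_eq_abs, Real.norm_eq_abs]
      exact mul_le_mul_of_nonneg_right (hD x) (abs_nonneg _)
    · calc _ ≤ ‖fderiv ℝ u x‖ * ‖C x‖ := (fderiv ℝ u x).le_opNorm _
        _ ≤ (3 / (ε * √t) * heatConv ε (2 * t) (fun z => |v z|) x) * M :=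
          mul_le_mul (norm_fderiv_heatConv_le hε ht hv x) (hM x) (norm_nonneg _)
            ((norm_nonneg _).trans (norm_fderiv_heatConv_le hε ht hv x))
        _ = _ := by ring
  have hbi : Integrable fun x => D * |u x|
      + M * (3 / (ε * √t)) * heatConv ε (2 * t) (fun z => |v z|) x :=
    (hui.abs.const_mul _).add (h2i.const_mul _)
  have hki : Integrable k := hbi.mono' hkc.aestronglyMeasurable (Eventually.of_forall hkle)
  refine ⟨toL1 k, ?_, ?_⟩
  · have := hC.mem_generator_convection hud (fun x => rfl) hkc hui hki
    rwa [← diffusionSemigroup_toL1 ht hv, toL1_coeFn] at this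
  · have hnu : ∫ x, |u x| ≤ ‖v‖ := by
      have := norm_toL1_heatConv_le hε ht hv
      rwa [norm_toL1 hui, toL1_coeFn] at this
    have hnv : ∫ x, heatConv ε (2 * t) (fun z => |v z|) x = ‖v‖ := by
      rw [integral_heatConv hε (by positivity) hv.abs, L1.norm_eq_integral_norm]
      rfl
    have hpow : t ^ (-(1 / 2) : ℝ) = 1 / √t := by
      rw [Real.rpow_neg ht.le, ← Real.sqrt_eq_rpow, one_div]
    rw [norm_toL1 hki, hpow]
    calc _ ≤ ∫ x, (D * |u x| + M * (3 / (ε * √t)) * heatConv ε (2 * t) (fun z => |v z|) x) :=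
          integral_mono hki.norm hbi hkle
      _ = D * (∫ x, |u x|) + M * (3 / (ε * √t)) * ‖v‖ := by
          rw [integral_add (hui.abs.const_mul _) (h2i.const_mul _), integral_const_mul,
            integral_const_mul, hnv]
      _ ≤ D * ‖v‖ + M * (3 / (ε * √t)) * ‖v‖ := by gcongr
      _ = _ := by field_simp; ring

end

/-! ### The operator of the return-to-home system -/

section System

variable {E : Type*} [NormedAddCommGroup E] [NormedSpace ℝ E]

/-- The state space `ℝ × E × E` with the sum norm, in which the system is dissipative: what one
compartment loses, another one gains. -/
abbrev SystemSpace (E : Type*) [NormedAddCommGroup E] : Type _ := WithLp 1 (ℝ × WithLp 1 (E × E))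

/-- The state `(u, v, w)`. -/
def SystemSpace.mk (u : ℝ) (v w : E) : SystemSpace E := WithLp.toLp 1 (u, WithLp.toLp 1 (v, w))

omit [NormedSpace ℝ E] in
theorem SystemSpace.norm_eq (x : SystemSpace E) :
    ‖x‖ = |x.fst| + (‖x.snd.fst‖ + ‖x.snd.snd‖) := by
  rw [WithLp.prod_norm_eq_of_L1, WithLp.prod_norm_eq_of_L1, Real.norm_eq_abs]

/-- The graph of `(u, v, w) ↦ (χ m(w) - γ u, G v - α v + γ u g, α v - χ w)`, where `m` is a linear
functional. -/
def systemGraph (G : Submodule ℝ (E × E)) (m : E →L[ℝ] ℝ) (g : E) (α γ χ : ℝ) :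
    Submodule ℝ (SystemSpace E × SystemSpace E) where
  carrier := {p | p.2.fst = χ * m p.1.snd.snd - γ * p.1.fst ∧
    (p.1.snd.fst, p.2.snd.fst + α • p.1.snd.fst - (γ * p.1.fst) • g) ∈ G ∧
    p.2.snd.snd = α • p.1.snd.fst - χ • p.1.snd.snd}
  add_mem' := by
    rintro p q ⟨hu, hv, hw⟩ ⟨hu', hv', hw'⟩
    refine ⟨?_, ?_, ?_⟩
    · simp only [Prod.fst_add, Prod.snd_add, WithLp.add_fst, WithLp.add_snd, map_add, hu, hu']
      ring
    · convert G.add_mem hv hv' using 1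
      ext
      · simp
      · simp only [Prod.fst_add, Prod.snd_add, WithLp.add_fst, WithLp.add_snd]
        module
    · simp only [Prod.fst_add, Prod.snd_add, WithLp.add_fst, WithLp.add_snd, hw, hw']
      module
  zero_mem' := by
    refine ⟨by simp, ?_, by simp⟩
    convert G.zero_mem using 1
    ext <;> simp
  smul_mem' := by
    rintro c p ⟨hu, hv, hw⟩
    refine ⟨?_, ?_, ?_⟩
    · simp only [Prod.smul_fst, Prod.smul_snd, WithLp.smul_fst, WithLp.smul_snd, map_smul, hu,
        smul_eq_mul]
      ring
    · convert G.smul_mem c hv using 1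
      ext
      · simp
      · simp only [Prod.smul_fst, Prod.smul_snd, WithLp.smul_fst, WithLp.smul_snd, smul_eq_mul]
        module
    · simp only [Prod.smul_fst, Prod.smul_snd, WithLp.smul_fst, WithLp.smul_snd, hw]
      module

variable {G : Submodule ℝ (E × E)} {m : E →L[ℝ] ℝ} {g : E} {α γ χ : ℝ}

/-- In the sum norm the three estimates of the compartments add up, because the gain terms
`χ ‖w‖`, `γ |u|` and `α ‖v‖` of one equation are the loss terms of another. The resolvent equation
reduces to a scalar one for `u`, because `G` does not change the mass. -/
theorem isMaxDissipative_systemGraph (hG : IsMaxDissipative G) (hm : ∀ v, |m v| ≤ ‖v‖)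
    (hmG : ∀ p ∈ G, m p.2 = 0) (hg : ‖g‖ ≤ 1) (hmg : m g = 1) (hα : 0 < α) (hγ : 0 < γ)
    (hχ : 0 < χ) : IsMaxDissipative (systemGraph G m g α γ χ) where
  norm_le := by
    rintro ⟨x, y⟩ ⟨hu, hv, hw⟩ lam hlam
    simp only at hu hv hw ⊢
    rw [SystemSpace.norm_eq, SystemSpace.norm_eq]
    simp only [WithLp.sub_fst, WithLp.sub_snd, WithLp.smul_fst, WithLp.smul_snd, smul_eq_mul]
    set u := x.fst
    set v := x.snd.fst
    set w := x.snd.snd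
    have h1 : (lam + γ) * |u| ≤ |lam * u - y.fst| + χ * ‖w‖ := by
      have e : (lam + γ) * u = (lam * u - y.fst) + χ * m w := by rw [hu]; ring
      calc (lam + γ) * |u| = |(lam * u - y.fst) + χ * m w| := by
            rw [← e, abs_mul, abs_of_pos (show 0 < lam + γ by positivity)]
        _ ≤ |lam * u - y.fst| + |χ * m w| := abs_add_le _ _
        _ ≤ _ := by
            rw [abs_mul, abs_of_pos hχ]
            gcongr
            exact hm w
    have h2 : (lam + α) * ‖v‖ ≤ ‖lam • v - y.snd.fst‖ + γ * |u| := by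
      have h := hG.norm_le _ hv (lam + α) (by positivity)
      have e : (lam + α) • v - (y.snd.fst + α • v - (γ * u) • g)
          = (lam • v - y.snd.fst) + (γ * u) • g := by module
      simp only [e] at h
      refine h.trans ((norm_add_le _ _).trans (add_le_add_right ?_ _))
      rw [norm_smul, Real.norm_eq_abs, abs_mul, abs_of_pos hγ]
      exact mul_le_of_le_one_right (by positivity) hg
    have h3 : (lam + χ) * ‖w‖ ≤ ‖lam • w - y.snd.snd‖ + α * ‖v‖ := by
      have e : (lam + χ) • w = (lam • w - y.snd.snd) + α • v := by rw [hw]; module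
      calc (lam + χ) * ‖w‖ = ‖(lam • w - y.snd.snd) + α • v‖ := by
            rw [← e, norm_smul, Real.norm_eq_abs, abs_of_pos (by positivity)]
        _ ≤ _ := by
            refine (norm_add_le _ _).trans (le_of_eq ?_)
            rw [norm_smul α, Real.norm_eq_abs, abs_of_pos hα]
    linarith
  exists_mem := by
    intro lam hlam f
    set D : ℝ := (lam + α) * (lam + χ) * (lam + γ) - α * γ * χ with hD
    have hD0 : 0 < D := by
      have : 0 < lam * (lam ^ 2 + lam * (α + γ + χ) + (α * γ + α * χ + γ * χ)) := by positivity
      rw [hD]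
      nlinarith
    -- `u` solves the scalar equation that remains when the masses of `v` and `w` are eliminated
    set u : ℝ := ((lam + α) * (lam + χ) * f.fst + χ * (lam + α) * m f.snd.snd
      + χ * α * m f.snd.fst) / D with hu
    have hα' : 0 < lam + α := by positivity
    have hχ' : 0 < lam + χ := by positivity
    obtain ⟨v, hvG⟩ : ∃ v, (v, (lam + α) • v - (f.snd.fst + (γ * u) • g)) ∈ G :=
      ⟨_, hG.resolvent_mem hα' _⟩
    have hmv : m v = (m f.snd.fst + γ * u) / (lam + α) := by
      have := hmG _ hvG
      simp only [map_sub, map_smul, map_add, smul_eq_mul, hmg, mul_one] at this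
      rw [eq_div_iff hα'.ne']
      linarith
    obtain ⟨w, hw⟩ : ∃ w, (lam + χ) • w = f.snd.snd + α • v :=
      ⟨(lam + χ)⁻¹ • (f.snd.snd + α • v), by rw [smul_smul, mul_inv_cancel₀ hχ'.ne', one_smul]⟩
    have hmw : m w = (m f.snd.snd + α * m v) / (lam + χ) := by
      have := congrArg m hw
      simp only [map_smul, map_add, smul_eq_mul] at this
      rw [eq_div_iff hχ'.ne']
      linarith
    refine ⟨SystemSpace.mk u v w, ?_, ?_, ?_⟩
    · simp only [SystemSpace.mk, WithLp.sub_fst, WithLp.smul_fst, smul_eq_mul,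
        hmw, hmv, WithLp.toLp_fst, WithLp.toLp_snd]
      have huD : u * D = (lam + α) * (lam + χ) * f.fst + χ * (lam + α) * m f.snd.snd
          + χ * α * m f.snd.fst := div_mul_cancel₀ _ hD0.ne'
      field_simp
      rw [hD] at huD
      linear_combination huD
    · simp only [SystemSpace.mk, WithLp.sub_fst, WithLp.sub_snd, WithLp.smul_fst, WithLp.smul_snd,
        WithLp.toLp_fst, WithLp.toLp_snd]
      convert hvG using 2
      module
    · simp only [SystemSpace.mk, WithLp.sub_snd, WithLp.smul_snd, WithLp.toLp_snd,
        WithLp.toLp_fst]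
      rw [eq_sub_of_add_eq hw.symm]
      module

theorem dense_domain_systemGraph (hdense : Dense (Prod.fst '' (G : Set (E × E)))) :
    Dense (Prod.fst '' (systemGraph G m g α γ χ : Set (SystemSpace E × SystemSpace E))) := by
  intro x
  have hc : Continuous fun v : E => SystemSpace.mk x.fst v x.snd.snd := by
    unfold SystemSpace.mk
    fun_prop
  have := map_mem_closure hc (hdense x.snd.fst)
    (t := Prod.fst '' (systemGraph G m g α γ χ : Set (SystemSpace E × SystemSpace E))) ?_
  · exact this
  · rintro _ ⟨p, hp, rfl⟩
    refine ⟨(SystemSpace.mk x.fst p.1 x.snd.snd, SystemSpace.mk (χ * m x.snd.snd - γ * x.fst)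
      (p.2 - α • p.1 + (γ * x.fst) • g) (α • p.1 - χ • x.snd.snd)), ⟨rfl, ?_, rfl⟩, rfl⟩
    have e : p.2 - α • p.1 + (γ * x.fst) • g + α • p.1 - (γ * x.fst) • g = p.2 := by abel
    simpa [SystemSpace.mk, e] using hp

/-- Mild solutions of the system exist. -/
theorem exists_mild_system [CompleteSpace E] (hG : IsMaxDissipative G)
    (hdense : Dense (Prod.fst '' (G : Set (E × E)))) (hm : ∀ v, |m v| ≤ ‖v‖)
    (hmG : ∀ p ∈ G, m p.2 = 0) (hg : ‖g‖ ≤ 1) (hmg : m g = 1) (hα : 0 < α) (hγ : 0 < γ)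
    (hχ : 0 < χ) (u₀ : ℝ) (v₀ w₀ : E) :
    ∃ (u : ℝ → ℝ) (v w : ℝ → E), ContinuousOn u (Ici 0) ∧ ContinuousOn v (Ici 0) ∧
      ContinuousOn w (Ici 0) ∧ ∀ t, 0 ≤ t →
        u t = u₀ + (χ * m (∫ s in (0 : ℝ)..t, w s) - γ * ∫ s in (0 : ℝ)..t, u s) ∧
        (∃ f, (∫ s in (0 : ℝ)..t, v s, f) ∈ G ∧ v t = v₀ + (f - α • (∫ s in (0 : ℝ)..t, v s)
          + (γ * ∫ s in (0 : ℝ)..t, u s) • g)) ∧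
        w t = w₀ + (α • (∫ s in (0 : ℝ)..t, v s) - χ • ∫ s in (0 : ℝ)..t, w s) := by
  obtain ⟨z, hz, hmem⟩ := (isMaxDissipative_systemGraph hG hm hmG hg hmg hα hγ hχ).exists_mild
    (dense_domain_systemGraph hdense) (SystemSpace.mk u₀ v₀ w₀)
  let P : SystemSpace E →L[ℝ] ℝ := WithLp.fstL 1 ℝ ℝ (WithLp 1 (E × E))
  let S : SystemSpace E →L[ℝ] WithLp 1 (E × E) := WithLp.sndL 1 ℝ ℝ (WithLp 1 (E × E))
  let Q : SystemSpace E →L[ℝ] E := (WithLp.fstL 1 ℝ E E).comp S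
  let R : SystemSpace E →L[ℝ] E := (WithLp.sndL 1 ℝ E E).comp S
  refine ⟨fun t => P (z t), fun t => Q (z t), fun t => R (z t), P.continuous.comp_continuousOn hz,
    Q.continuous.comp_continuousOn hz, R.continuous.comp_continuousOn hz, fun t ht => ?_⟩
  have hi := intervalIntegrable_of_continuousOn_Ici hz ht
  rw [P.intervalIntegral_comp_comm hi, Q.intervalIntegral_comp_comm hi,
    R.intervalIntegral_comp_comm hi]
  obtain ⟨h1, h2, h3⟩ := hmem t ht
  set I := ∫ s in (0 : ℝ)..t, z s
  refine ⟨?_, ⟨_, h2, ?_⟩, ?_⟩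
  · have : (z t).fst - u₀ = χ * m I.snd.snd - γ * I.fst := h1
    exact sub_eq_iff_eq_add'.1 this
  · have e : ((z t, I).1 - SystemSpace.mk u₀ v₀ w₀).snd.fst = (z t).snd.fst - v₀ := rfl
    simp only at e ⊢
    rw [e]
    change (z t).snd.fst = v₀ + ((z t).snd.fst - v₀ + α • I.snd.fst - (γ * I.fst) • g
      - α • I.snd.fst + (γ * I.fst) • g)
    abel
  · have : (z t).snd.snd - w₀ = α • I.snd.fst - χ • I.snd.snd := h3
    exact sub_eq_iff_eq_add'.1 this

end System

/-! ### The compartment model of the total masses -/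

section Compartments

variable {α γ χ : ℝ}

/-- Weighted variance bound: three numbers of weighted mean zero are controlled by their
differences. -/
theorem weighted_sq_le (hα : 0 < α) (hγ : 0 < γ) (hχ : 0 < χ) {p q r : ℝ} (h : p + q + r = 0) :
    1 / (1 / γ + 1 / α + 1 / χ) * (γ * p ^ 2 + α * q ^ 2 + χ * r ^ 2)
      ≤ (γ * p - α * q) ^ 2 + (α * q - χ * r) ^ 2 + (χ * r - γ * p) ^ 2 := by
  obtain ⟨x, hx, rfl⟩ : ∃ x, 0 < x ∧ γ = 1 / x := ⟨1 / γ, by positivity, by simp⟩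
  obtain ⟨y, hy, rfl⟩ : ∃ y, 0 < y ∧ α = 1 / y := ⟨1 / α, by positivity, by simp⟩
  obtain ⟨z, hz, rfl⟩ : ∃ z, 0 < z ∧ χ = 1 / z := ⟨1 / χ, by positivity, by simp⟩
  obtain ⟨a, rfl⟩ : ∃ a, p = x * a := ⟨p / x, by field_simp⟩
  obtain ⟨b, rfl⟩ : ∃ b, q = y * b := ⟨q / y, by field_simp⟩
  obtain ⟨c, rfl⟩ : ∃ c, r = z * c := ⟨r / z, by field_simp⟩
  have e1 : 1 / x * (x * a) = a := by field_simp
  have e2 : 1 / y * (y * b) = b := by field_simp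
  have e3 : 1 / z * (z * c) = c := by field_simp
  have e4 : 1 / x * (x * a) ^ 2 + 1 / y * (y * b) ^ 2 + 1 / z * (z * c) ^ 2
      = x * a ^ 2 + y * b ^ 2 + z * c ^ 2 := by field_simp
  rw [e1, e2, e3, e4, one_div_one_div, one_div_one_div, one_div_one_div, one_div_mul_eq_div,
    div_le_iff₀ (by positivity)]
  have hS : 0 < x + y + z := by positivity
  -- the variance identity; the square of the mean vanishes by `h`
  have key : (x + y + z) * (x * a ^ 2 + y * b ^ 2 + z * c ^ 2)
      = x * y * (a - b) ^ 2 + y * z * (b - c) ^ 2 + x * z * (c - a) ^ 2 := by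
    linear_combination (x * a + y * b + z * c) * h
  have hxy : x * y ≤ (x + y + z) * (x + y + z) := by nlinarith
  have hyz : y * z ≤ (x + y + z) * (x + y + z) := by nlinarith
  have hxz : x * z ≤ (x + y + z) * (x + y + z) := by nlinarith
  have h1 := mul_le_mul_of_nonneg_right hxy (sq_nonneg (a - b))
  have h2 := mul_le_mul_of_nonneg_right hyz (sq_nonneg (b - c))
  have h3 := mul_le_mul_of_nonneg_right hxz (sq_nonneg (c - a))
  have h4 : (x + y + z) * (x * a ^ 2 + y * b ^ 2 + z * c ^ 2)
      ≤ (x + y + z) * (((a - b) ^ 2 + (b - c) ^ 2 + (c - a) ^ 2) * (y + x + z)) := by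
    rw [key]
    linarith
  have h5 := le_of_mul_le_mul_left h4 hS
  linarith

/-- The masses of the three compartments decay if their sum is zero, by the Lyapunov function
`γ u² + α V² + χ W²`. -/
theorem compartments_decay (hα : 0 < α) (hγ : 0 < γ) (hχ : 0 < χ) {u V W : ℝ → ℝ}
    (hu : ContinuousOn u (Ici 0)) (hV : ContinuousOn V (Ici 0)) (hW : ContinuousOn W (Ici 0))
    (hu' : ∀ s, 0 < s → HasDerivAt u (χ * W s - γ * u s) s)
    (hV' : ∀ s, 0 < s → HasDerivAt V (γ * u s - α * V s) s)
    (hW' : ∀ s, 0 < s → HasDerivAt W (α * V s - χ * W s) s)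
    (hsum : ∀ s, 0 ≤ s → u s + V s + W s = 0) {t : ℝ} (ht : 0 ≤ t) :
    γ * u t ^ 2 + α * V t ^ 2 + χ * W t ^ 2
      ≤ Real.exp (-(1 / (1 / γ + 1 / α + 1 / χ)) * t)
        * (γ * u 0 ^ 2 + α * V 0 ^ 2 + χ * W 0 ^ 2) := by
  set τ := 1 / (1 / γ + 1 / α + 1 / χ) with hτ
  set F : ℝ → ℝ := fun s => γ * u s ^ 2 + α * V s ^ 2 + χ * W s ^ 2 with hF
  have hFc : ContinuousOn F (Ici 0) :=
    ((continuousOn_const.mul (hu.pow 2)).add (continuousOn_const.mul (hV.pow 2))).add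
      (continuousOn_const.mul (hW.pow 2))
  have hexp : ∀ s, HasDerivAt (fun s : ℝ => Real.exp (τ * s)) (Real.exp (τ * s) * τ) s := by
    intro s
    simpa using ((hasDerivAt_id s).const_mul τ).exp
  have hd : ∀ s, 0 < s → HasDerivAt (fun s => Real.exp (τ * s) * F s)
      (Real.exp (τ * s) * (τ * F s - ((γ * u s - α * V s) ^ 2 + (α * V s - χ * W s) ^ 2
        + (χ * W s - γ * u s) ^ 2))) s := by
    intro s hs
    have h1 := ((((hu' s hs).pow 2).const_mul γ).add (((hV' s hs).pow 2).const_mul α)).add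
      (((hW' s hs).pow 2).const_mul χ)
    refine ((hexp s).mul h1).congr_deriv ?_
    simp only [hF, Pi.add_apply, Pi.pow_apply]
    push_cast
    ring
  -- `F' = -(γ u - α V)² - (α V - χ W)² - (χ W - γ u)²`, because each flux leaves one
  -- compartment and enters the next
  have hanti : AntitoneOn (fun s => Real.exp (τ * s) * F s) (Ici 0) := by
    refine antitoneOn_of_deriv_nonpos (convex_Ici 0)
      ((by fun_prop : Continuous fun s : ℝ => Real.exp (τ * s)).continuousOn.mul hFc) ?_ ?_
    · rw [interior_Ici]
      exact fun s hs => (hd s hs).differentiableAt.differentiableWithinAt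
    · rw [interior_Ici]
      intro s hs
      rw [(hd s hs).deriv]
      refine mul_nonpos_of_nonneg_of_nonpos (Real.exp_pos _).le (sub_nonpos.2 ?_)
      exact weighted_sq_le hα hγ hχ (hsum s (le_of_lt hs))
  have h := hanti self_mem_Ici (mem_Ici.2 ht) ht
  simp only [mul_zero, Real.exp_zero, one_mul] at h
  rw [neg_mul, Real.exp_neg, inv_mul_eq_div, le_div_iff₀ (Real.exp_pos _), mul_comm]
  exact h

end Compartments

/-! ### Mild solutions of the system: conservation of mass and exponential decay -/

section MildSystem

variable {E : Type*} [NormedAddCommGroup E] [NormedSpace ℝ E]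

/-- Mild solutions of `u' = χ m(w) - γ u`, `v' = G v - α v + γ u g`, `w' = α v - χ w`, for an
operator given by its graph `G` and a functional `m` in the role of the total mass. -/
structure IsMildSystemSolution (G : Submodule ℝ (E × E)) (m : E →L[ℝ] ℝ) (g : E) (α γ χ : ℝ)
    (u₀ : ℝ) (v₀ w₀ : E) (u : ℝ → ℝ) (v w : ℝ → E) : Prop where
  continuousOn_u : ContinuousOn u (Ici 0)
  continuousOn_v : ContinuousOn v (Ici 0)
  continuousOn_w : ContinuousOn w (Ici 0)
  eq_u : ∀ t, 0 ≤ t → u t = u₀ + (χ * m (∫ s in (0 : ℝ)..t, w s) - γ * ∫ s in (0 : ℝ)..t, u s)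
  eq_v : ∀ t, 0 ≤ t → ∃ f : E, (∫ s in (0 : ℝ)..t, v s, f) ∈ G ∧
    v t = v₀ + (f - α • (∫ s in (0 : ℝ)..t, v s) + (γ * ∫ s in (0 : ℝ)..t, u s) • g)
  eq_w : ∀ t, 0 ≤ t → w t = w₀ + (α • (∫ s in (0 : ℝ)..t, v s) - χ • ∫ s in (0 : ℝ)..t, w s)

variable {G : Submodule ℝ (E × E)} {m : E →L[ℝ] ℝ} {g : E} {α γ χ : ℝ}

/-- The zero operator is maximal dissipative. It turns the equation for `w` into an instance of the
one for `v`. -/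
theorem isMaxDissipative_zero :
    IsMaxDissipative (Submodule.prod ⊤ ⊥ : Submodule ℝ (E × E)) where
  norm_le := by
    rintro ⟨x, y⟩ ⟨-, hy⟩ lam hlam
    rw [show y = 0 from hy, sub_zero, norm_smul, Real.norm_eq_abs, abs_of_pos hlam]
  exists_mem lam hlam f :=
    ⟨lam⁻¹ • f, trivial, by simp [smul_smul, mul_inv_cancel₀ hlam.ne']⟩

theorem dense_domain_zero :
    Dense (Prod.fst '' ((Submodule.prod ⊤ ⊥ : Submodule ℝ (E × E)) : Set (E × E))) := by
  refine dense_univ.mono fun x _ => ⟨(x, 0), ⟨trivial, by simp⟩, rfl⟩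

/-- A densely defined dissipative operator is single-valued. -/
theorem IsMaxDissipative.eq_zero_of_mem {G : Submodule ℝ (E × E)} (hG : IsMaxDissipative G)
    (hdense : Dense (Prod.fst '' (G : Set (E × E)))) [CompleteSpace E] {f : E}
    (hf : ((0 : E), f) ∈ G) : f = 0 := by
  have h1 : ∀ lam : ℝ, 0 < lam → lam • hG.resolvent lam f = 0 := by
    intro lam hlam
    have := hG.resolvent_apply hlam hf
    simp only [smul_zero, zero_sub, map_neg, neg_eq_zero] at this
    rw [this, smul_zero]
  refine tendsto_nhds_unique (hG.tendsto_smul_resolvent hdense f) ?_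
  refine tendsto_const_nhds.congr' ?_
  filter_upwards [eventually_gt_atTop 0] with lam hlam using (h1 lam hlam).symm

/-- An equilibrium is a mild solution. -/
theorem isMildSystemSolution_const [CompleteSpace E] {u₀ : ℝ} {v₀ w₀ f : E}
    (hu : χ * m w₀ - γ * u₀ = 0) (hf : (v₀, f) ∈ G) (hv : f - α • v₀ + (γ * u₀) • g = 0)
    (hw : α • v₀ - χ • w₀ = 0) :
    IsMildSystemSolution G m g α γ χ u₀ v₀ w₀ (fun _ => u₀) (fun _ => v₀) (fun _ => w₀) where
  continuousOn_u := continuousOn_const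
  continuousOn_v := continuousOn_const
  continuousOn_w := continuousOn_const
  eq_u t _ := by
    simp only [intervalIntegral.integral_const, sub_zero, map_smul, smul_eq_mul]
    linear_combination -t * hu
  eq_v t _ := by
    simp only [intervalIntegral.integral_const, sub_zero, smul_eq_mul]
    refine ⟨t • f, G.smul_mem t hf, ?_⟩
    have : t • f - α • t • v₀ + (γ * (t * u₀)) • g = t • (f - α • v₀ + (γ * u₀) • g) := by module
    rw [this, hv, smul_zero, add_zero]
  eq_w t _ := by
    simp only [intervalIntegral.integral_const, sub_zero]
    have : α • t • v₀ - χ • t • w₀ = t • (α • v₀ - χ • w₀) := by module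
    rw [this, hw, smul_zero, add_zero]

namespace IsMildSystemSolution

variable [CompleteSpace E] {u₀ : ℝ} {v₀ w₀ : E} {u : ℝ → ℝ} {v w : ℝ → E}

omit [CompleteSpace E] in
theorem sub {u₀' : ℝ} {v₀' w₀' : E} {u' : ℝ → ℝ} {v' w' : ℝ → E}
    (h : IsMildSystemSolution G m g α γ χ u₀ v₀ w₀ u v w)
    (h' : IsMildSystemSolution G m g α γ χ u₀' v₀' w₀' u' v' w') :
    IsMildSystemSolution G m g α γ χ (u₀ - u₀') (v₀ - v₀') (w₀ - w₀') (fun t => u t - u' t)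
      (fun t => v t - v' t) (fun t => w t - w' t) where
  continuousOn_u := h.continuousOn_u.sub h'.continuousOn_u
  continuousOn_v := h.continuousOn_v.sub h'.continuousOn_v
  continuousOn_w := h.continuousOn_w.sub h'.continuousOn_w
  eq_u t ht := by
    rw [intervalIntegral.integral_sub (intervalIntegrable_of_continuousOn_Ici h.continuousOn_u ht)
        (intervalIntegrable_of_continuousOn_Ici h'.continuousOn_u ht),
      intervalIntegral.integral_sub (intervalIntegrable_of_continuousOn_Ici h.continuousOn_w ht)
        (intervalIntegrable_of_continuousOn_Ici h'.continuousOn_w ht), h.eq_u t ht, h'.eq_u t ht,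
      map_sub]
    ring
  eq_v t ht := by
    obtain ⟨f, hf, e⟩ := h.eq_v t ht
    obtain ⟨f', hf', e'⟩ := h'.eq_v t ht
    rw [intervalIntegral.integral_sub (intervalIntegrable_of_continuousOn_Ici h.continuousOn_u ht)
        (intervalIntegrable_of_continuousOn_Ici h'.continuousOn_u ht),
      intervalIntegral.integral_sub (intervalIntegrable_of_continuousOn_Ici h.continuousOn_v ht)
        (intervalIntegrable_of_continuousOn_Ici h'.continuousOn_v ht), e, e']
    exact ⟨f - f', G.sub_mem hf hf', by module⟩
  eq_w t ht := by
    rw [intervalIntegral.integral_sub (intervalIntegrable_of_continuousOn_Ici h.continuousOn_v ht)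
        (intervalIntegrable_of_continuousOn_Ici h'.continuousOn_v ht),
      intervalIntegral.integral_sub (intervalIntegrable_of_continuousOn_Ici h.continuousOn_w ht)
        (intervalIntegrable_of_continuousOn_Ici h'.continuousOn_w ht), h.eq_w t ht, h'.eq_w t ht]
    module

variable (h : IsMildSystemSolution G m g α γ χ u₀ v₀ w₀ u v w)

include h

omit [CompleteSpace E] in
theorem u_zero : u 0 = u₀ := by simpa using h.eq_u 0 le_rfl

omit [CompleteSpace E] in
theorem w_zero : w 0 = w₀ := by simpa using h.eq_w 0 le_rfl

/-- At `t = 0` the term `G ∫ v` vanishes because the operator is single-valued. -/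
theorem v_zero (hG : IsMaxDissipative G) (hdense : Dense (Prod.fst '' (G : Set (E × E)))) :
    v 0 = v₀ := by
  obtain ⟨f, hf, e⟩ := h.eq_v 0 le_rfl
  rw [intervalIntegral.integral_same] at hf
  simpa [hG.eq_zero_of_mem hdense hf] using e

omit [CompleteSpace E] in
/-- The mass of `v` obeys a scalar equation, because the operator does not change the mass. -/
theorem mass_v (hmG : ∀ p ∈ G, m p.2 = 0) (hmg : m g = 1) {t : ℝ} (ht : 0 ≤ t) :
    m (v t) = m v₀ + (γ * (∫ s in (0 : ℝ)..t, u s) - α * m (∫ s in (0 : ℝ)..t, v s)) := by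
  obtain ⟨f, hf, e⟩ := h.eq_v t ht
  have h0 : m f = 0 := hmG _ hf
  rw [e]
  simp only [map_add, map_sub, map_smul, smul_eq_mul, hmg, h0]
  ring

omit [CompleteSpace E] in
theorem mass_w {t : ℝ} (ht : 0 ≤ t) :
    m (w t) = m w₀ + (α * m (∫ s in (0 : ℝ)..t, v s) - χ * m (∫ s in (0 : ℝ)..t, w s)) := by
  rw [h.eq_w t ht]
  simp only [map_add, map_sub, map_smul, smul_eq_mul]

omit [CompleteSpace E] in
/-- Conservation of the total mass. -/
theorem total_mass (hmG : ∀ p ∈ G, m p.2 = 0) (hmg : m g = 1) {t : ℝ} (ht : 0 ≤ t) :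
    u t + m (v t) + m (w t) = u₀ + m v₀ + m w₀ := by
  rw [h.mass_v hmG hmg ht, h.mass_w ht, h.eq_u t ht]
  ring

/-- When the total mass is zero, the scalar equation for the three masses decays. -/
theorem u_sq_le (hmG : ∀ p ∈ G, m p.2 = 0) (hmg : m g = 1) (hm : ∀ v, |m v| ≤ ‖v‖)
    (hG : IsMaxDissipative G) (hdense : Dense (Prod.fst '' (G : Set (E × E)))) (hα : 0 < α)
    (hγ : 0 < γ) (hχ : 0 < χ) (h0 : u₀ + m v₀ + m w₀ = 0) {t : ℝ} (ht : 0 ≤ t) :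
    γ * u t ^ 2 ≤ Real.exp (-(1 / (1 / γ + 1 / α + 1 / χ)) * t)
        * ((α + γ + χ) * (|u₀| + ‖v₀‖ + ‖w₀‖) ^ 2) := by
  have hdm : ∀ {z : ℝ → E}, ContinuousOn z (Ici 0) → ∀ s, 0 < s →
      HasDerivAt (fun t => m (∫ r in (0 : ℝ)..t, z r)) (m (z s)) s := fun hz s hs =>
    m.hasFDerivAt.comp_hasDerivAt s (hasDerivAt_integral_of_continuousOn_Ici hz hs)
  have hdu : ∀ s, 0 < s → HasDerivAt (fun t => ∫ r in (0 : ℝ)..t, u r) (u s) s := fun s hs =>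
    hasDerivAt_integral_of_continuousOn_Ici h.continuousOn_u hs
  have hnhds : ∀ {s : ℝ}, 0 < s → ∀ᶠ r in 𝓝 s, 0 ≤ r := fun hs => Ici_mem_nhds hs
  have hdecay := compartments_decay hα hγ hχ h.continuousOn_u
    (m.continuous.comp_continuousOn h.continuousOn_v)
    (m.continuous.comp_continuousOn h.continuousOn_w)
    (fun s hs => by
      refine HasDerivAt.congr_of_eventuallyEq ?_
        ((hnhds hs).mono fun r hr => h.eq_u r hr)
      exact (((hdm h.continuousOn_w s hs).const_mul χ).sub ((hdu s hs).const_mul γ)).const_add u₀)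
    (fun s hs => by
      refine HasDerivAt.congr_of_eventuallyEq ?_
        ((hnhds hs).mono fun r hr => h.mass_v hmG hmg hr)
      exact (((hdu s hs).const_mul γ).sub
        ((hdm h.continuousOn_v s hs).const_mul α)).const_add (m v₀))
    (fun s hs => by
      refine HasDerivAt.congr_of_eventuallyEq ?_ ((hnhds hs).mono fun r hr => h.mass_w hr)
      exact (((hdm h.continuousOn_v s hs).const_mul α).sub
        ((hdm h.continuousOn_w s hs).const_mul χ)).const_add (m w₀))
    (fun s hs => (h.total_mass hmG hmg hs).trans h0) ht
  simp only [Function.comp_apply, h.u_zero, h.w_zero, h.v_zero hG hdense] at hdecay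
  have hsq : ∀ {a : ℝ}, |a| ≤ |u₀| + ‖v₀‖ + ‖w₀‖ → a ^ 2 ≤ (|u₀| + ‖v₀‖ + ‖w₀‖) ^ 2 :=
    fun ha => sq_le_sq' (abs_le.1 ha).1 (abs_le.1 ha).2
  have hu := hsq (a := u₀) (by linarith [norm_nonneg v₀, norm_nonneg w₀])
  have hv := hsq (a := m v₀) (by linarith [hm v₀, abs_nonneg u₀, norm_nonneg w₀])
  have hw := hsq (a := m w₀) (by linarith [hm w₀, abs_nonneg u₀, norm_nonneg v₀])
  have h1 : γ * u₀ ^ 2 + α * m v₀ ^ 2 + χ * m w₀ ^ 2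
      ≤ (α + γ + χ) * (|u₀| + ‖v₀‖ + ‖w₀‖) ^ 2 := by
    nlinarith [mul_le_mul_of_nonneg_left hu hγ.le, mul_le_mul_of_nonneg_left hv hα.le,
      mul_le_mul_of_nonneg_left hw hχ.le]
  have h2 : 0 ≤ α * m (v t) ^ 2 + χ * m (w t) ^ 2 := by positivity
  have h3 := mul_le_mul_of_nonneg_left h1
    (Real.exp_pos (-(1 / (1 / γ + 1 / α + 1 / χ)) * t)).le
  linarith

end IsMildSystemSolution

variable [CompleteSpace E]

/-- Mild solutions of total mass zero decay exponentially: first `u`, by the scalar equation for the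
masses; then `v`, which the operator `G - α` damps and only `u` feeds; then `w`, which only `v`
feeds. -/
theorem exists_decay (hG : IsMaxDissipative G) (hdense : Dense (Prod.fst '' (G : Set (E × E))))
    (hm : ∀ v, |m v| ≤ ‖v‖) (hmG : ∀ p ∈ G, m p.2 = 0) (hg : ‖g‖ ≤ 1) (hmg : m g = 1)
    (hα : 0 < α) (hγ : 0 < γ) (hχ : 0 < χ) :
    ∃ δ K : ℝ, 0 < δ ∧ 0 < K ∧ ∀ {u₀ : ℝ} {v₀ w₀ : E} {u : ℝ → ℝ} {v w : ℝ → E},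
      IsMildSystemSolution G m g α γ χ u₀ v₀ w₀ u v w → u₀ + m v₀ + m w₀ = 0 → ∀ t, 0 ≤ t →
        |u t| ≤ K * (|u₀| + ‖v₀‖ + ‖w₀‖) * Real.exp (-δ * t) ∧
        ‖v t‖ ≤ K * (|u₀| + ‖v₀‖ + ‖w₀‖) * Real.exp (-δ * t) ∧
        ‖w t‖ ≤ K * (|u₀| + ‖v₀‖ + ‖w₀‖) * Real.exp (-δ * t) := by
  set τ := 1 / (1 / γ + 1 / α + 1 / χ) with hτdef
  have hτ : 0 < τ := by positivity
  -- `u²` decays like `exp (-τ t)`; the rate has to stay below the damping rates of `v` and `w`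
  set δ := min (τ / 2) (min α χ / 2) with hδdef
  have hδ : 0 < δ := lt_min (by positivity) (half_pos (lt_min hα hχ))
  have hδτ : 2 * δ ≤ τ := by linarith [min_le_left (τ / 2) (min α χ / 2)]
  have hδm : δ ≤ min α χ / 2 := min_le_right _ _
  have hδα : δ < α := by linarith [min_le_left α χ]
  have hδχ : δ < χ := by linarith [min_le_right α χ]
  have hα' : 0 < α - δ := sub_pos.2 hδα
  have hχ' : 0 < χ - δ := sub_pos.2 hδχ
  -- `k₁ ^ 2 ≥ (α + γ + χ) / γ`, the constant in the bound for `u ^ 2`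
  set k₁ := 1 + (α + γ + χ) / γ with hk₁
  set k₂ := 1 + γ * k₁ / (α - δ) with hk₂
  set k₃ := 1 + α * k₂ / (χ - δ) with hk₃
  have hk₁0 : 0 < k₁ := by positivity
  have hk₂0 : 0 < k₂ := by positivity
  have hk₃0 : 0 < k₃ := by positivity
  refine ⟨δ, k₁ + k₂ + k₃, hδ, by positivity, ?_⟩
  intro u₀ v₀ w₀ u v w h h0
  set N := |u₀| + ‖v₀‖ + ‖w₀‖ with hN
  have hN0 : 0 ≤ N := by positivity
  have hexp : ∀ {c t : ℝ}, δ ≤ c → 0 ≤ t → Real.exp (-c * t) ≤ Real.exp (-δ * t) :=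
    fun hc ht => Real.exp_le_exp.2 (by nlinarith)
  have hu : ∀ t, 0 ≤ t → |u t| ≤ k₁ * N * Real.exp (-δ * t) := by
    intro t ht
    refine abs_le_of_sq_le_sq ?_ (by positivity)
    have h1 := h.u_sq_le hmG hmg hm hG hdense hα hγ hχ h0 ht
    have h2 : Real.exp (-τ * t) ≤ Real.exp (-δ * t) ^ 2 := by
      rw [← Real.exp_nat_mul]
      refine Real.exp_le_exp.2 ?_
      push_cast
      nlinarith
    have h3 : (α + γ + χ) / γ ≤ k₁ ^ 2 := by
      have : 0 < (α + γ + χ) / γ := by positivity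
      nlinarith
    have h4 : (α + γ + χ) ≤ γ * k₁ ^ 2 := by
      rwa [div_le_iff₀ hγ, mul_comm] at h3
    refine le_of_mul_le_mul_left (h1.trans ?_) hγ
    calc _ ≤ Real.exp (-δ * t) ^ 2 * (γ * k₁ ^ 2 * N ^ 2) := by gcongr
      _ = _ := by ring
  have hv : ∀ t, 0 ≤ t → ‖v t‖ ≤ k₂ * N * Real.exp (-δ * t) := by
    intro t ht
    have h1 := hG.norm_le_of_mild hdense hδα (h := fun s => (γ * u s) • g)
      (H := γ * (k₁ * N)) h.continuousOn_v
      ((continuousOn_const.mul h.continuousOn_u).smul continuousOn_const)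
      (fun s hs => by
        rw [norm_smul, Real.norm_eq_abs, abs_mul, abs_of_pos hγ, mul_assoc γ (k₁ * N)]
        refine (mul_le_of_le_one_right (mul_nonneg hγ.le (abs_nonneg _)) hg).trans ?_
        exact mul_le_mul_of_nonneg_left (hu s hs) hγ.le)
      (fun s hs => by
        obtain ⟨f, hf, e⟩ := h.eq_v s hs
        refine ⟨f, hf, ?_⟩
        rw [intervalIntegral.integral_smul_const, intervalIntegral.integral_const_mul,
          h.v_zero hG hdense, e])
      ht
    rw [h.v_zero hG hdense] at h1
    have hv₀ : ‖v₀‖ ≤ N := by linarith [abs_nonneg u₀, norm_nonneg w₀]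
    calc ‖v t‖ ≤ _ := h1
      _ ≤ Real.exp (-δ * t) * N + γ * (k₁ * N) / (α - δ) * Real.exp (-δ * t) := by
          gcongr ?_ * ?_ + _
          exact hexp hδα.le ht
      _ = _ := by rw [hk₂]; ring
  have hw : ∀ t, 0 ≤ t → ‖w t‖ ≤ k₃ * N * Real.exp (-δ * t) := by
    intro t ht
    have h1 := isMaxDissipative_zero.norm_le_of_mild dense_domain_zero hδχ (h := fun s => α • v s)
      (H := α * (k₂ * N)) h.continuousOn_w (continuousOn_const.smul h.continuousOn_v)
      (fun s hs => by
        rw [norm_smul, Real.norm_eq_abs, abs_of_pos hα, mul_assoc α]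
        exact mul_le_mul_of_nonneg_left (hv s hs) hα.le)
      (fun s hs => by
        refine ⟨0, ⟨trivial, by simp⟩, ?_⟩
        rw [intervalIntegral.integral_smul, h.w_zero, h.eq_w s hs]
        module)
      ht
    rw [h.w_zero] at h1
    have hw₀ : ‖w₀‖ ≤ N := by linarith [abs_nonneg u₀, norm_nonneg v₀]
    calc ‖w t‖ ≤ _ := h1
      _ ≤ Real.exp (-δ * t) * N + α * (k₂ * N) / (χ - δ) * Real.exp (-δ * t) := by
          gcongr ?_ * ?_ + _
          exact hexp hδχ.le ht
      _ = _ := by rw [hk₃]; ring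
  intro t ht
  refine ⟨(hu t ht).trans ?_, (hv t ht).trans ?_, (hw t ht).trans ?_⟩ <;>
  · gcongr
    linarith

/-- Convergence to equilibrium, in the abstract setting: existence, uniqueness, conservation of the
total mass, and an exponential rate that does not depend on the initial value. -/
theorem exists_unique_mild_and_convergence (hG : IsMaxDissipative G)
    (hdense : Dense (Prod.fst '' (G : Set (E × E)))) (hm : ∀ v, |m v| ≤ ‖v‖)
    (hmG : ∀ p ∈ G, m p.2 = 0) (hg : ‖g‖ ≤ 1) (hmg : m g = 1)
    (hα : 0 < α) (hγ : 0 < γ) (hχ : 0 < χ) :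
    ∃ δ : ℝ, 0 < δ ∧ ∀ (u₀ ubar : ℝ) (v₀ w₀ vbar wbar f : E),
      χ * m wbar - γ * ubar = 0 → (vbar, f) ∈ G → f - α • vbar + (γ * ubar) • g = 0 →
      α • vbar - χ • wbar = 0 → ubar + m vbar + m wbar = u₀ + m v₀ + m w₀ →
      ∃ (u : ℝ → ℝ) (v w : ℝ → E), IsMildSystemSolution G m g α γ χ u₀ v₀ w₀ u v w ∧
        (∀ (u' : ℝ → ℝ) (v' w' : ℝ → E), IsMildSystemSolution G m g α γ χ u₀ v₀ w₀ u' v' w' →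
          ∀ t, 0 ≤ t → u' t = u t ∧ v' t = v t ∧ w' t = w t) ∧
        (∀ t, 0 ≤ t → u t + m (v t) + m (w t) = u₀ + m v₀ + m w₀) ∧
        ∃ M : ℝ, 0 < M ∧ ∀ t, 0 ≤ t → |u t - ubar| ≤ M * Real.exp (-δ * t) ∧
          ‖v t - vbar‖ ≤ M * Real.exp (-δ * t) ∧ ‖w t - wbar‖ ≤ M * Real.exp (-δ * t) := by
  obtain ⟨δ, K, hδ, hK, hdecay⟩ := exists_decay hG hdense hm hmG hg hmg hα hγ hχ
  refine ⟨δ, hδ, ?_⟩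
  intro u₀ ubar v₀ w₀ vbar wbar f hu hf hv hw hmass
  obtain ⟨u, v, w, hcu, hcv, hcw, heq⟩ :=
    exists_mild_system hG hdense hm hmG hg hmg hα hγ hχ u₀ v₀ w₀
  have h : IsMildSystemSolution G m g α γ χ u₀ v₀ w₀ u v w :=
    ⟨hcu, hcv, hcw, fun t ht => (heq t ht).1, fun t ht => (heq t ht).2.1,
      fun t ht => (heq t ht).2.2⟩
  refine ⟨u, v, w, h, ?_, fun t ht => h.total_mass hmG hmg ht, ?_⟩
  · intro u' v' w' h' t ht
    have hd := hdecay (h'.sub h) (by simp) t ht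
    simp only [sub_self, abs_zero, norm_zero, add_zero, mul_zero, zero_mul] at hd
    exact ⟨sub_eq_zero.1 (abs_nonpos_iff.1 hd.1), sub_eq_zero.1 (norm_le_zero_iff.1 hd.2.1),
      sub_eq_zero.1 (norm_le_zero_iff.1 hd.2.2)⟩
  · have hd := hdecay (h.sub (isMildSystemSolution_const hu hf hv hw))
      (by rw [map_sub, map_sub]; linarith)
    refine ⟨K * (|u₀ - ubar| + ‖v₀ - vbar‖ + ‖w₀ - wbar‖) + 1, by positivity, fun t ht => ?_⟩
    have hle : K * (|u₀ - ubar| + ‖v₀ - vbar‖ + ‖w₀ - wbar‖) * Real.exp (-δ * t)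
        ≤ (K * (|u₀ - ubar| + ‖v₀ - vbar‖ + ‖w₀ - wbar‖) + 1) * Real.exp (-δ * t) := by
      gcongr
      linarith
    obtain ⟨h1, h2, h3⟩ := hd t ht
    exact ⟨h1.trans hle, h2.trans hle, h3.trans hle⟩

end MildSystem

/-! ### The total mass on `L¹(ℝ²)` -/

theorem abs_mass_le (v : L1) : |mass v| ≤ ‖v‖ := by
  rw [L1.norm_eq_integral_norm, ← Real.norm_eq_abs]
  exact norm_integral_le_integral_norm _

/-- The total mass as a continuous linear functional. -/
noncomputable def massCLM : L1 →L[ℝ] ℝ :=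
  LinearMap.mkContinuous
    { toFun := mass
      map_add' := fun v w => by
        rw [mass, mass, mass, ← integral_add (L1.integrable_coeFn v) (L1.integrable_coeFn w)]
        exact integral_congr_ae (Lp.coeFn_add v w)
      map_smul' := fun c v => by
        rw [mass, mass, RingHom.id_apply, smul_eq_mul, ← integral_const_mul]
        exact integral_congr_ae (Lp.coeFn_smul c v) } 1
    fun v => by simpa using abs_mass_le v

theorem massCLM_apply (v : L1) : massCLM v = mass v := rfl

/-- The generator of a mass-preserving semigroup takes values of mass zero. -/
theorem massCLM_generator {T : ℝ → L1 → L1} (hT : IsContractionSemigroup T)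
    (hmass : ∀ t, 0 ≤ t → ∀ v, mass (T t v) = mass v) {p : L1 × L1} (hp : p ∈ hT.generator) :
    massCLM p.2 = 0 := by
  refine tendsto_nhds_unique ((massCLM.continuous.tendsto _).comp (hT.mem_generator.1 hp)) ?_
  refine tendsto_const_nhds.congr' ?_
  filter_upwards [self_mem_nhdsWithin] with t ht
  rw [Function.comp_apply, map_smul, map_sub, massCLM_apply, massCLM_apply,
    hmass t (le_of_lt ht), sub_self, smul_zero]

/-! ### The Gaussian density -/

/-- The Gaussian density is a heat kernel. -/
theorem gaussian_eq_heatKernel (σ : ℝ) : gaussian σ = heatKernel σ (1 / 2) := by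
  ext x
  rw [gaussian, heatKernel, EuclideanSpace.norm_sq_eq, Fin.sum_univ_two, Real.norm_eq_abs,
    Real.norm_eq_abs, sq_abs, sq_abs]
  congr 2
  · ring
  · congr 2
    ring

variable {σ : ℝ} (hσ : 0 < σ) (y : Plane)

include hσ

theorem integrable_gaussian_sub : Integrable fun x : Plane => gaussian σ (x - y) := by
  rw [gaussian_eq_heatKernel]
  exact (integrable_heatKernel hσ one_half_pos).comp_sub_right y

theorem integral_gaussian_sub : ∫ x : Plane, gaussian σ (x - y) = 1 := by
  rw [integral_sub_right_eq_self (gaussian σ) y, gaussian_eq_heatKernel]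
  exact integral_heatKernel hσ one_half_pos

theorem mass_gaussianAt : mass (gaussianAt σ y) = 1 := by
  rw [gaussianAt, mass_toL1 (integrable_gaussian_sub hσ y), integral_gaussian_sub hσ]

theorem norm_gaussianAt : ‖gaussianAt σ y‖ = 1 := by
  rw [gaussianAt, norm_toL1 (integrable_gaussian_sub hσ y), ← integral_gaussian_sub hσ y]
  refine integral_congr_ae (Eventually.of_forall fun x => ?_)
  have h : 0 ≤ gaussian σ (x - y) := by
    rw [gaussian_eq_heatKernel]
    exact heatKernel_nonneg one_half_pos.le _
  exact abs_of_nonneg h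

end ReturnHome

open ReturnHome

theorem theorem4p8 (ε σ α γ χ : ℝ) (hε : 0 < ε) (hσ : 0 < σ) (hα : 0 < α) (hγ : 0 < γ) (hχ : 0 < χ)
    (C : ReturnHome.Plane → ReturnHome.Plane → ReturnHome.Plane)
    (y : ReturnHome.Plane) (hC : ReturnHome.IsAdmissibleSpeed (C y)) :
    -- `R = (α I - A - B_y)⁻¹`
    ∃ R : ReturnHome.L1 →L[ℝ] ReturnHome.L1,
      ReturnHome.IsResolvent (ReturnHome.graphAB ε (C y)) α R ∧
    ∃ δ : ℝ, 0 < δ ∧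
      ∀ (u₀ : ℝ) (v₀ w₀ : ReturnHome.L1) (n τ ubar : ℝ) (vbar wbar : ReturnHome.L1),
        n = u₀ + ReturnHome.mass v₀ + ReturnHome.mass w₀ →
        τ = 1 / (1 / γ + 1 / α + 1 / χ) →
        ubar = n / (1 + γ / α + γ / χ) →
        vbar = R ((τ * n) • ReturnHome.gaussianAt σ y) →
        wbar = (α / χ) • vbar →
        ReturnHome.IsEquilibrium ε σ α γ χ (C y) y ubar vbar wbar ∧
        ∃ (u : ℝ → ℝ) (v w : ℝ → ReturnHome.L1),
          ReturnHome.IsMildSolution ε σ α γ χ (C y) y u₀ v₀ w₀ u v w ∧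
          (∀ (u' : ℝ → ℝ) (v' w' : ℝ → ReturnHome.L1),
            ReturnHome.IsMildSolution ε σ α γ χ (C y) y u₀ v₀ w₀ u' v' w' →
              ∀ t, 0 ≤ t → u' t = u t ∧ v' t = v t ∧ w' t = w t) ∧
          (∀ t, 0 ≤ t → u t + ReturnHome.mass (v t) + ReturnHome.mass (w t) = n) ∧
          ∃ M : ℝ, 0 < M ∧ ∀ t, 0 ≤ t →
            |u t - ubar| ≤ M * Real.exp (-δ * t) ∧
            ‖v t - vbar‖ ≤ M * Real.exp (-δ * t) ∧
            ‖w t - wbar‖ ≤ M * Real.exp (-δ * t) := by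
  obtain ⟨c, d, hrel⟩ := exists_mem_generator_convection hε hC
  have hA := isContractionSemigroup_diffusion hε
  have hB := hC.isContractionSemigroup_convection
  have hG := hA.isMaxDissipative_sumGraph hB hrel
  have hdense := hA.dense_domain_sumGraph hB hrel
  have hmG : ∀ p ∈ sumGraph hA.generator hB.generator, massCLM p.2 = 0 := by
    rintro p ⟨a, b, ha, hb, hp⟩
    have h1 : massCLM a = 0 :=
      massCLM_generator hA (fun t ht v => mass_diffusionSemigroup hε ht v) ha
    have h2 : massCLM b = 0 :=
      massCLM_generator hB (fun t ht v => hC.mass_convectionSemigroup ht v) hb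
    rw [hp, map_add, h1, h2, add_zero]
  have hmg : massCLM (gaussianAt σ y) = 1 := mass_gaussianAt hσ y
  obtain ⟨δ, hδ, hconv⟩ := exists_unique_mild_and_convergence hG hdense abs_mass_le hmG
    (norm_gaussianAt hσ y).le hmg hα hγ hχ
  refine ⟨hG.resolvent α, fun f v => hG.resolvent_eq_iff hα, δ, hδ, ?_⟩
  intro u₀ v₀ w₀ n τ ubar vbar wbar hn hτ hubar hvbar hwbar
  have hmem : (vbar, α • vbar - (τ * n) • gaussianAt σ y) ∈ sumGraph hA.generator hB.generator := by
    rw [hvbar]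
    exact hG.resolvent_mem hα _
  -- at equilibrium all three fluxes equal `τ n`
  have hτu : γ * ubar = τ * n := by
    rw [hubar, hτ]
    field_simp
  have hmv : α * massCLM vbar = τ * n := by
    have h := hmG _ hmem
    simp only [map_sub, map_smul, smul_eq_mul, hmg, mul_one] at h
    linarith
  have hmw : χ * massCLM wbar = α * massCLM vbar := by
    rw [hwbar, map_smul, smul_eq_mul]
    field_simp
  have hu : χ * massCLM wbar - γ * ubar = 0 := by linarith
  have hv : (α • vbar - (τ * n) • gaussianAt σ y) - α • vbar + (γ * ubar) • gaussianAt σ y = 0 := by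
    rw [hτu]
    abel
  have hw : α • vbar - χ • wbar = 0 := by
    rw [hwbar, smul_smul, mul_div_cancel₀ _ hχ.ne', sub_self]
  have hsum : ubar + massCLM vbar + massCLM wbar = u₀ + massCLM v₀ + massCLM w₀ := by
    change _ = u₀ + mass v₀ + mass w₀
    have e1 : massCLM vbar = γ / α * ubar := by
      field_simp
      linarith
    have e2 : massCLM wbar = γ / χ * ubar := by
      field_simp
      linarith
    have e3 : ubar * (1 + γ / α + γ / χ) = n := by
      rw [hubar]
      exact div_mul_cancel₀ _ (by positivity)
    rw [← hn, e1, e2, ← e3]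
    ring
  obtain ⟨u, v, w, hsol, huniq, hmass, hM⟩ :=
    hconv u₀ ubar v₀ w₀ vbar wbar _ hu hmem hv hw hsum
  refine ⟨⟨hu, ⟨_, hmem, hv⟩, hw⟩, u, v, w, ⟨hsol.1, hsol.2, hsol.3, hsol.4, hsol.5, hsol.6⟩, ?_,
    fun t ht => (hmass t ht).trans hn.symm, hM⟩
  exact fun u' v' w' h' => huniq u' v' w' ⟨h'.1, h'.2, h'.3, h'.4, h'.5, h'.6⟩
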